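/- Let $G \rightrightarrows Q$ be a Lie groupoid (smooth finite-dimensional Hausdorff manifolds $G,Q$; source $\alpha$ and target $\beta$ smooth submersions; smooth identity section $\varepsilon: Q\to G$, inversion, and multiplication $(g,k)\mapsto gk$ defined for $\beta(g)=\alpha(k)$). Let $\tilde\tau: V\alpha=\ker T\alpha\to G$ be the vertical bundle of $\alpha$, with anchor the inclusion $V\alpha\subseteq TG$, and let $\tau: AG\to Q$ be the Lie algebroid of $G$, with fibres $A_qG=\ker T_{\varepsilon(q)}\alpha = V_{\varepsilon(q)}\alpha$ (so $AG\subseteq V\alpha$) and anchor $\rho(v)=T\beta(v)$. A SODE on either of these Lie algebroids is a smooth vector field $X$ on its total space whose projection to the base is the anchor, i.e. $(T_a\tau)(X(a))=\rho(a)$ for all $a$ (with $\tilde\tau$ in place of $\tau$ for $V\alpha$); its trajectories are the projections to the base of its integral curves. For a SODE on $V\alpha$ the integral curve over a trajectory $\sigma$ is its velocity $\dot\sigma$. Let $\Psi: V\alpha\to AG$, $\Psi(v_g)=(T_g l_{g^{-1}})(v_g)$, where $l_{g^{-1}}:\alpha^{-1}(\alpha(g))\to\alpha^{-1}(\beta(g))$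 is left translation by $g^{-1}$. Let $\Gamma$ be a SODE on $AG$ and let $q_0\in Q$. Then there is a unique SODE $\tilde\Gamma$ on $V\alpha$ which is $\Psi$-related to $\Gamma$, that is, $T\Psi\circ\tilde\Gamma=\Gamma\circ\Psi$. Moreover, there are $h_0>0$, a compact neighbourhood $C$ of $\varepsilon(q_0)$ in $G$, a compact set $\bar C\subseteq V\alpha$, and vectors $v_{(h,q_0)}\in A_{q_0}G\cap\bar C$ for $0<h\le h_0$, such that for every $h\in(0,h_0]$ the following holds. (0) There is a unique trajectory $\sigma:[0,h]\to\alpha^{-1}(q_0)\cap C$ of $\tilde\Gamma$ with $\sigma(0)=\sigma(h)=\varepsilon(q_0)$ and $\dot\sigma(t)\in\bar C$ for all $t\in[0,h]$; and $\dot\sigma(0)=v_{(h,q_0)}$. There are an open set $\mathcal U\subseteq AG$ with $v_{(h,q_0)}\in\mathcal U$ and an open set $U\subseteq G$ with $\varepsilon(q_0)\in U$ such that: (i) The flow $\Phi^{\tilde\Gamma}_t$ of $\tilde\Gamma$ is defined on $\mathcal U$ for all $t\in[0,h]$, and $$\exp_h^\Gamma:\mathcal U\to U,\qquad v\mapsto\tilde\tau(\Phi_h^{\tilde\Gamma}(v)),$$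 is a diffeomorphism. (ii) For every $g\in U$ there is a unique trajectory $\sigma:[0,h]\to\alpha^{-1}(\alpha(g))$ of $\tilde\Gamma$ with $\sigma(0)=\varepsilon(\alpha(g))$, $\sigma(h)=g$ and $\dot\sigma(0)\in\mathcal U$. The curve $a=\Psi\circ\dot\sigma:[0,h]\to AG$ is an integral curve of $\Gamma$, and its base trajectory $\tau\circ a$ satisfies $\tau(a(0))=\alpha(g)$ and $\tau(a(h))=\beta(g)$. -/

import Mathlib

open Set Filter Topology
open scoped Manifold ContDiff

section Submanifolds

variable {E : Type*} [NormedAddCommGroup E] [NormedSpace ℝ E]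
  {H : Type*} [TopologicalSpace H] {I : ModelWithCorners ℝ E H}
  {M : Type*} [TopologicalSpace M] [ChartedSpace H M]
  {E' : Type*} [NormedAddCommGroup E'] [NormedSpace ℝ E']
  {H' : Type*} [TopologicalSpace H'] {I' : ModelWithCorners ℝ E' H'}
  {N : Type*} [TopologicalSpace N] [ChartedSpace H' N]

/-- The vector `w ∈ T_x M` is tangent to the embedded submanifold `S ⊆ M` at `x`: it is the
velocity at time `0` of a smooth curve lying in `S`. -/
def IsTangentTo (S : Set M) (x : M) (w : TangentSpace I x) : Prop :=
  ∃ δ > 0, ∃ γ : ℝ → M, ContMDiffOn 𝓘(ℝ, ℝ) I ∞ γ (Ioo (-δ) δ) ∧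
    (∀ t ∈ Ioo (-δ) δ, γ t ∈ S) ∧
    tangentMap 𝓘(ℝ, ℝ) I γ ⟨0, (1 : ℝ)⟩ = (⟨x, w⟩ : TangentBundle I M)

/-- `X` is a smooth vector field on the embedded submanifold `S ⊆ M`. Only the values of `X` on `S`
matter. For an embedded submanifold `S`, which is locally a smooth retract of an open set,
`ContMDiffOn … S` is smoothness on the manifold `S`. -/
def IsVectorFieldOn [IsManifold I ∞ M] (S : Set M) (X : (x : M) → TangentSpace I x) : Prop :=
  ContMDiffOn I I.tangent ∞ (fun x => (⟨x, X x⟩ : TangentBundle I M)) S ∧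
    ∀ x ∈ S, IsTangentTo S x (X x)

/-- Second order differential equations on a Lie algebroid `τ : S → N` with anchor `ρ : S → TN`,
where the total space is realized as an embedded submanifold `S ⊆ M` and `τ` is the restriction of
a smooth map on `M`: a vector field `X` on `S` such that `(T_a τ)(X(a)) = ρ(a)` for all `a ∈ S`.
(The bracket of the Lie algebroid does not enter the notion.) -/
def IsSODE [IsManifold I ∞ M] (S : Set M) (τ : M → N) (ρ : M → TangentBundle I' N)
    (X : (x : M) → TangentSpace I x) : Prop :=
  IsVectorFieldOn S X ∧
    ∀ a ∈ S, tangentMap I I' τ (⟨a, X a⟩ : TangentBundle I M) = ρ a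

/-- `f` restricts to a diffeomorphism from `A` onto `B`, where `A` and `B` are embedded
submanifolds (or relatively open subsets of such). -/
def IsDiffeomorphOn (I : ModelWithCorners ℝ E H) (I' : ModelWithCorners ℝ E' H')
    (f : M → N) (A : Set M) (B : Set N) : Prop :=
  MapsTo f A B ∧ ContMDiffOn I I' ∞ f A ∧
    ∃ r : N → M, MapsTo r B A ∧ ContMDiffOn I' I ∞ r B ∧ InvOn r f A B

/-- `γ : [0, h] → S` is an integral curve of the vector field `X` on `S` starting at `x`. -/
def IsIntegralCurveFrom (S : Set M) (X : (x : M) → TangentSpace I x) (h : ℝ) (x : M)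
    (γ : ℝ → M) : Prop :=
  IsMIntegralCurveOn γ X (Icc 0 h) ∧ MapsTo γ (Icc 0 h) S ∧ γ 0 = x

/-- The set of points of `S` at which the flow of `X` is defined (at least) on `[0, h]`. -/
def flowDomain (S : Set M) (X : (x : M) → TangentSpace I x) (h : ℝ) : Set M :=
  {x | ∃ γ : ℝ → M, IsIntegralCurveFrom S X h x γ}

open Classical in
/-- The flow at time `h ≥ 0` of a vector field `X` on `S`: the value at time `h` of the integral
curve starting at `x` (with a junk value if `x` is not in the domain of the flow). -/
noncomputable def flowMap (S : Set M) (X : (x : M) → TangentSpace I x) (h : ℝ) (x : M) : M :=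
  if hx : x ∈ flowDomain S X h then hx.choose h else x

/-- The velocity curve `t ↦ σ̇(t) ∈ T_{σ(t)} M` of a curve `σ : [0, h] → M`
(one-sided at the end points). -/
noncomputable def velocity (I : ModelWithCorners ℝ E H) (σ : ℝ → M) (h t : ℝ) :
    TangentBundle I M :=
  tangentMapWithin 𝓘(ℝ, ℝ) I σ (Icc 0 h) ⟨t, (1 : ℝ)⟩

end Submanifolds

/-- A Lie groupoid `G ⇉ Q`: smooth manifolds `G`, `Q` (modelled on `E`, `F`), source `α` and target
`β` which are smooth submersions, and smooth identity section `ε`, inversion and multiplication.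
The product `gh` is meaningful when `β g = α h`; the values of `mul` at other pairs are junk, and
smoothness is required on the submanifold of composable pairs. -/
structure LieGroupoid (E F G Q : Type*)
    [NormedAddCommGroup E] [NormedSpace ℝ E] [NormedAddCommGroup F] [NormedSpace ℝ F]
    [TopologicalSpace G] [ChartedSpace E G] [IsManifold 𝓘(ℝ, E) ∞ G]
    [TopologicalSpace Q] [ChartedSpace F Q] [IsManifold 𝓘(ℝ, F) ∞ Q] where
  α : G → Q
  β : G → Q
  ε : Q → G
  inv : G → G
  mul : G → G → G
  α_mul : ∀ g h, β g = α h → α (mul g h) = α g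
  β_mul : ∀ g h, β g = α h → β (mul g h) = β h
  mul_assoc : ∀ g h k, β g = α h → β h = α k → mul g (mul h k) = mul (mul g h) k
  α_ε : ∀ q, α (ε q) = q
  β_ε : ∀ q, β (ε q) = q
  ε_mul : ∀ g, mul (ε (α g)) g = g
  mul_ε : ∀ g, mul g (ε (β g)) = g
  α_inv : ∀ g, α (inv g) = β g
  β_inv : ∀ g, β (inv g) = α g
  inv_mul : ∀ g, mul (inv g) g = ε (β g)
  mul_inv : ∀ g, mul g (inv g) = ε (α g)
  submersion_α : Manifold.IsSubmersion 𝓘(ℝ, E) 𝓘(ℝ, F) ∞ α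
  submersion_β : Manifold.IsSubmersion 𝓘(ℝ, E) 𝓘(ℝ, F) ∞ β
  smooth_ε : ContMDiff 𝓘(ℝ, F) 𝓘(ℝ, E) ∞ ε
  smooth_inv : ContMDiff 𝓘(ℝ, E) 𝓘(ℝ, E) ∞ inv
  smooth_mul : ContMDiffOn (𝓘(ℝ, E).prod 𝓘(ℝ, E)) 𝓘(ℝ, E) ∞ (fun p : G × G => mul p.1 p.2)
    {p | β p.1 = α p.2}

namespace LieGroupoid

variable {E F G Q : Type*}
  [NormedAddCommGroup E] [NormedSpace ℝ E] [NormedAddCommGroup F] [NormedSpace ℝ F]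
  [TopologicalSpace G] [ChartedSpace E G] [IsManifold 𝓘(ℝ, E) ∞ G]
  [TopologicalSpace Q] [ChartedSpace F Q] [IsManifold 𝓘(ℝ, F) ∞ Q]
  (𝒢 : LieGroupoid E F G Q)

/-- The total space of the vertical bundle `Vα = ker Tα → G`, an embedded submanifold of `TG`.
Its projection `τ̃` is the restriction of `TG → G` and its anchor is the inclusion in `TG`. -/
def vertical : Set (TangentBundle 𝓘(ℝ, E) G) :=
  {v | mfderiv 𝓘(ℝ, E) 𝓘(ℝ, F) 𝒢.α v.proj v.snd = 0}

/-- The total space of the Lie algebroid `AG → Q`, whose fibre at `q` is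
`A_q G = ker T_{ε(q)} α`, as an embedded submanifold of `Vα` (hence of `TG`): the restriction of
`Vα` to the submanifold `ε(Q)` of identities. -/
def algebroid : Set (TangentBundle 𝓘(ℝ, E) G) :=
  {v | v ∈ 𝒢.vertical ∧ v.proj ∈ range 𝒢.ε}

/-- The projection `τ : AG → Q`, `v ∈ A_q G ↦ q`. It is given by the formula `v ↦ α(v.proj)`, which
makes sense on all of `TG`. -/
def algebroidProj (v : TangentBundle 𝓘(ℝ, E) G) : Q := 𝒢.α v.proj

/-- The anchor `ρ : AG → TQ`, `ρ(v) = (T_{ε(q)} β)(v)` for `v ∈ A_q G`. -/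
noncomputable def anchor (v : TangentBundle 𝓘(ℝ, E) G) : TangentBundle 𝓘(ℝ, F) Q :=
  tangentMap 𝓘(ℝ, E) 𝓘(ℝ, F) 𝒢.β v

/-- `Γ` is a SODE on the Lie algebroid `AG → Q`. -/
def IsAlgebroidSODE (Γ : (v : TangentBundle 𝓘(ℝ, E) G) → TangentSpace 𝓘(ℝ, E).tangent v) : Prop :=
  IsSODE 𝒢.algebroid 𝒢.algebroidProj 𝒢.anchor Γ

/-- `X` is a SODE on the Lie algebroid `Vα → G`. -/
def IsVerticalSODE (X : (v : TangentBundle 𝓘(ℝ, E) G) → TangentSpace 𝓘(ℝ, E).tangent v) : Prop :=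
  IsSODE (I' := 𝓘(ℝ, E)) 𝒢.vertical (fun v => v.proj) (fun v => v) X

/-- The map `Ψ : Vα → AG`, `Ψ(v_g) = (T_g l_{g⁻¹})(v_g)`, where `l_{g⁻¹}` is the left translation
`α⁻¹(α(g)) → α⁻¹(β(g))`, `k ↦ g⁻¹k`. The derivative is taken along the `α`-fibre through `g`; on
vectors tangent to the fibre it does not depend on the choice made by `tangentMapWithin`. -/
noncomputable def Ψ (v : TangentBundle 𝓘(ℝ, E) G) : TangentBundle 𝓘(ℝ, E) G :=
  tangentMapWithin 𝓘(ℝ, E) 𝓘(ℝ, E) (fun k => 𝒢.mul (𝒢.inv v.proj) k)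
    (𝒢.α ⁻¹' {𝒢.α v.proj}) v

/-- The vector fields `X` on `Vα` and `Γ` on `AG` are `Ψ`-related: `TΨ ∘ X = Γ ∘ Ψ` on `Vα`. -/
def IsΨRelated (X Γ : (v : TangentBundle 𝓘(ℝ, E) G) → TangentSpace 𝓘(ℝ, E).tangent v) : Prop :=
  ∀ v ∈ 𝒢.vertical,
    tangentMapWithin 𝓘(ℝ, E).tangent 𝓘(ℝ, E).tangent 𝒢.Ψ 𝒢.vertical
        (⟨v, X v⟩ : TangentBundle 𝓘(ℝ, E).tangent (TangentBundle 𝓘(ℝ, E) G)) =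
      ⟨𝒢.Ψ v, Γ (𝒢.Ψ v)⟩

/-- `σ : [0, h] → α⁻¹(α(g))` is a trajectory of the SODE `X` on `Vα` with `σ(0) = g` and
`σ(h) = g'`; that is, the velocity curve `σ̇` is an integral curve of `X` in `Vα`. -/
def IsTrajectory (X : (v : TangentBundle 𝓘(ℝ, E) G) → TangentSpace 𝓘(ℝ, E).tangent v)
    (h : ℝ) (g g' : G) (σ : ℝ → G) : Prop :=
  IsMIntegralCurveOn (velocity 𝓘(ℝ, E) σ h) X (Icc 0 h) ∧
    (∀ t ∈ Icc 0 h, velocity 𝓘(ℝ, E) σ h t ∈ 𝒢.vertical ∧ 𝒢.α (σ t) = 𝒢.α g) ∧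
    σ 0 = g ∧ σ h = g'

/-- The exponential map `v ↦ τ̃(Φ_h^X(v))` at time `h`, where `Φ^X` is the flow of the vector field
`X` on `Vα`. -/
noncomputable def expMap
    (X : (v : TangentBundle 𝓘(ℝ, E) G) → TangentSpace 𝓘(ℝ, E).tangent v)
    (h : ℝ) (v : TangentBundle 𝓘(ℝ, E) G) : G :=
  (flowMap 𝒢.vertical X h v).proj

end LieGroupoid

/-!
The lift of `Γ` is determined fibrewise: a vector tangent to `Vα` is determined by its images under
the projection to `TG` and under `TΨ`, since `Vα` is the pull-back of `AG` along `β : G → Q`. Over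
the fibred charts `FibredChart` of the submersion `α` this becomes explicit. Left translation of a
frame of `AG` gives a frame `leftFrame` of `Vα`, in which `Ψ` only forgets the base point in favour
of its image by `β`, and the lift is the field `liftedField` with components `g' = v` and
`w' = fibreForce (β g, w)` (`exists_lift`).

In coordinates `(x, y, w)` near `ε q₀`, where `x` is the coordinate of the source, `y` that of the
arrow along the fibre of `α` and `w` that of `Ψ v`, the lifted equation reads `x' = 0`, `y' = A`,
`w' = B`, and `A (x, e x, w) = w` along the units `y = e x`. The substitution `y = e x + h • Y` with
rescaled time turns it into a system which is smooth up to `h = 0`, and has an equilibrium at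
`h = 0`, `Y = W = 0`. Its flow is smooth near this equilibrium
(`exists_smooth_flow_near_equilibrium`: the inverse function theorem for the integral equation in a
space of continuous curves), and at `h = 0`, `x = x₀` the end point `Y` is proportional to the
initial value `w`. By the inverse function theorem the map
`(h, x, w) ↦ (h, x, Z)`, where the solution ends at `y = e x + (h / τ) • Z`, is a diffeomorphism of
neighbourhoods of `((0, x₀), 0)` (`exists_boundary_value_solution`). As `h = 0` is included, these
neighbourhoods serve all short times at once. For fixed `h > 0` the map `(x, w) ↦ (x, y)` is the
exponential map `exp_h` in coordinates, hence a diffeomorphism (`ExpChart.isDiffeomorphOn_expMap`), and `Z = 0`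
gives the trajectories which return to `ε q₀`.

The remaining point is to pass between trajectories in `G` and solutions in coordinates. Integral
curves of the lift which start in the domain of `exp_h` are unique on `[0, h]` among all integral
curves in `Vα`, including those which might leave the coordinates
(`eqOn_of_isIntegralCurveFrom`); this uses that `G` is Hausdorff.
-/

universe u v

/-! ### The inverse function theorem with a smooth parameter -/

/-- The inverse function theorem for a smooth map on an open set: the local inverse is smooth on a
whole open set, and not only at the point considered. -/
theorem exists_smooth_openPartialHomeomorph {X Y : Type*} [NormedAddCommGroup X] [NormedSpace ℝ X]
    [CompleteSpace X] [NormedAddCommGroup Y] [NormedSpace ℝ Y] {f : X → Y} {Ω : Set X}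
    (hΩ : IsOpen Ω) (hf : ContDiffOn ℝ ∞ f Ω) {a : X} (ha : a ∈ Ω) {f' : X ≃L[ℝ] Y}
    (hf' : HasFDerivAt f (f' : X →L[ℝ] Y) a) :
    ∃ σ : OpenPartialHomeomorph X Y, a ∈ σ.source ∧ σ.source ⊆ Ω ∧ (σ : X → Y) = f ∧
      ContDiffOn ℝ ∞ σ σ.source ∧ ContDiffOn ℝ ∞ σ.symm σ.target := by
  have hfa : ∀ x ∈ Ω, ContDiffAt ℝ ∞ f x := fun x hx => hf.contDiffAt (hΩ.mem_nhds hx)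
  have hcont : ContinuousAt (fderiv ℝ f) a :=
    (hf.continuousOn_fderiv_of_isOpen hΩ (by simp)).continuousAt (hΩ.mem_nhds ha)
  have hev : ∀ᶠ x in 𝓝 a, fderiv ℝ f x ∈ range ((↑) : (X ≃L[ℝ] Y) → X →L[ℝ] Y) := by
    apply hcont
    rw [hf'.fderiv]
    exact f'.nhds
  obtain ⟨O, hOsub, hO, haO⟩ := mem_nhds_iff.1 (hev.and (hΩ.mem_nhds ha))
  let σ₀ := (hfa a ha).toOpenPartialHomeomorph f hf' (by simp)
  refine ⟨σ₀.restrOpen O hO, ⟨(hfa a ha).mem_toOpenPartialHomeomorph_source hf' (by simp), haO⟩,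
    fun x hx => (hOsub hx.2).2, rfl, fun x hx => (hfa x (hOsub hx.2).2).contDiffWithinAt, ?_⟩
  intro y hy
  have hx := (σ₀.restrOpen O hO).map_target hy
  obtain ⟨⟨e, he⟩, hxΩ⟩ := hOsub hx.2
  refine ((σ₀.restrOpen O hO).contDiffAt_symm hy (f₀' := e) ?_ (hfa _ hxΩ)).contDiffWithinAt
  rw [he]
  exact ((hfa _ hxΩ).differentiableAt (by simp)).hasFDerivAt

/-- A smooth map `f (p, v)` whose partial derivative in `v` is invertible can be solved for `v`,
smoothly in the parameter `p`: the map `(p, v) ↦ (p, f (p, v))` is a local diffeomorphism. -/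
theorem exists_smooth_openPartialHomeomorph_prodMk {P V V' : Type*}
    [NormedAddCommGroup P] [NormedSpace ℝ P] [CompleteSpace P]
    [NormedAddCommGroup V] [NormedSpace ℝ V] [CompleteSpace V]
    [NormedAddCommGroup V'] [NormedSpace ℝ V'] {f : P × V → V'} {Ω : Set (P × V)}
    (hΩ : IsOpen Ω) (hf : ContDiffOn ℝ ∞ f Ω) {p : P} {v : V} (ha : (p, v) ∈ Ω) {f' : V ≃L[ℝ] V'}
    (hf' : HasFDerivAt (fun w => f (p, w)) (f' : V →L[ℝ] V') v) :
    ∃ σ : OpenPartialHomeomorph (P × V) (P × V'), (p, v) ∈ σ.source ∧ σ.source ⊆ Ω ∧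
      (∀ z, σ z = (z.1, f z)) ∧
      ContDiffOn ℝ ∞ σ σ.source ∧ ContDiffOn ℝ ∞ σ.symm σ.target := by
  have hd : HasFDerivAt f (fderiv ℝ f (p, v)) (p, v) :=
    ((hf.contDiffAt (hΩ.mem_nhds ha)).differentiableAt (by simp)).hasFDerivAt
  set D := fderiv ℝ f (p, v) with hD
  have hD2 : ∀ w, D (0, w) = f' w := by
    have h1 : HasFDerivAt (fun w : V => (p, w)) (ContinuousLinearMap.inr ℝ P V) v :=
      hasFDerivAt_prodMk_right p v
    have h2 := (HasFDerivAt.comp v hd h1).unique hf'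
    intro w
    simpa using DFunLike.congr_fun h2 w
  have hDsplit : ∀ z, D z = D (z.1, 0) + f' z.2 := fun z => by
    rw [← hD2, ← map_add]; simp
  let S : (P × V) →L[ℝ] (P × V') := (ContinuousLinearMap.fst ℝ P V).prod D
  let T : (P × V') →L[ℝ] (P × V) := (ContinuousLinearMap.fst ℝ P V').prod
    ((f'.symm : V' →L[ℝ] V).comp (ContinuousLinearMap.snd ℝ P V' -
      (D.comp (ContinuousLinearMap.inl ℝ P V)).comp (ContinuousLinearMap.fst ℝ P V')))
  let S' : (P × V) ≃L[ℝ] (P × V') := ContinuousLinearEquiv.equivOfInverse S T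
    (fun z => by ext <;> simp [S, T, hDsplit z]) (fun z => by
      have h1 := hDsplit (z.1, f'.symm (z.2 - D (z.1, 0)))
      simp only [map_sub, ContinuousLinearEquiv.apply_symm_apply] at h1
      ext <;> simp [S, T, h1])
  obtain ⟨σ, h1, h2, h3, h4⟩ := exists_smooth_openPartialHomeomorph hΩ
    (f := fun z => (z.1, f z)) (contDiff_fst.contDiffOn.prodMk hf) ha (f' := S')
    (HasFDerivAt.prodMk (f₁ := Prod.fst) hasFDerivAt_fst hd)
  exact ⟨σ, h1, h2, fun z => by rw [h3], h4⟩

/-! ### Composition operators on spaces of continuous maps -/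

section Composition

variable {K : Type*} [TopologicalSpace K] [CompactSpace K]

/-- The pointwise application `(L, u) ↦ (t ↦ L t (u t))` of a continuous family of continuous linear
maps to a continuous curve, as a continuous bilinear map for the supremum norms. -/
noncomputable def ContinuousMap.applyBilin (K X Y : Type*) [TopologicalSpace K] [CompactSpace K]
    [NormedAddCommGroup X] [NormedSpace ℝ X] [NormedAddCommGroup Y] [NormedSpace ℝ Y] :
    C(K, X →L[ℝ] Y) →L[ℝ] C(K, X) →L[ℝ] C(K, Y) :=
  LinearMap.mkContinuous₂
    (LinearMap.mk₂ ℝ (fun (L : C(K, X →L[ℝ] Y)) (u : C(K, X)) =>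
        (⟨fun t => L t (u t), by fun_prop⟩ : C(K, Y)))
      (fun _ _ _ => by ext; simp) (fun _ _ _ => by ext; simp)
      (fun _ _ _ => by ext; simp) (fun _ _ _ => by ext; simp)) 1 (by
    intro L u
    rw [one_mul]
    refine (ContinuousMap.norm_le _ (by positivity)).2 fun t => ?_
    exact (L t).le_of_opNorm_le_of_le (L.norm_coe_le_norm t) (u.norm_coe_le_norm t))

/-- Composition with a `C¹` map `g` is differentiable on continuous curves, the derivative at `u`
being the multiplication by `g' ∘ u`. The estimate is uniform in `t` because `g' ∘ u` depends
continuously on `u` in the supremum norm. -/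
theorem hasFDerivAt_continuousMap_comp {X Y : Type*}
    [NormedAddCommGroup X] [NormedSpace ℝ X] [NormedAddCommGroup Y] [NormedSpace ℝ Y]
    (g : C(X, Y)) (g' : C(X, X →L[ℝ] Y)) (hg : ∀ x, HasFDerivAt g (g' x) x) (u : C(K, X)) :
    HasFDerivAt (fun u : C(K, X) => g.comp u)
      (ContinuousMap.applyBilin K X Y (g'.comp u)) u := by
  rw [hasFDerivAt_iff_isLittleO_nhds_zero, Asymptotics.isLittleO_iff]
  intro c hc
  have hcont : ContinuousAt (fun v : C(K, X) => g'.comp v) u :=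
    (ContinuousMap.continuous_postcomp g').continuousAt
  obtain ⟨δ, hδ, hδc⟩ := (Metric.continuousAt_iff
    (f := fun v : C(K, X) => g'.comp v) (a := u)).1 hcont c hc
  filter_upwards [Metric.ball_mem_nhds (0 : C(K, X)) hδ] with v hv
  rw [mem_ball_zero_iff] at hv
  refine (ContinuousMap.norm_le _ (by positivity)).2 fun t => ?_
  have hball : ∀ ξ ∈ Metric.ball (u t) δ, ‖g' ξ - g' (u t)‖ ≤ c := by
    intro ξ hξ
    rw [mem_ball_iff_norm] at hξ
    have h1 : dist (u + ContinuousMap.const K (ξ - u t)) u < δ := by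
      rw [dist_eq_norm, add_sub_cancel_left]
      exact lt_of_le_of_lt ((ContinuousMap.norm_le _ (norm_nonneg _)).2 fun _ => by simp) hξ
    have h2 := (ContinuousMap.dist_apply_le_dist t).trans (hδc h1).le
    simpa [dist_eq_norm] using h2
  have h3 := (convex_ball (u t) δ).norm_image_sub_le_of_norm_hasFDerivWithin_le'
    (f := g) (f' := fun ξ => g' ξ) (φ := g' (u t)) (C := c)
    (fun ξ _ => (hg ξ).hasFDerivWithinAt) hball (Metric.mem_ball_self hδ)
    (y := u t + v t) (by
      rw [mem_ball_iff_norm, add_sub_cancel_left]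
      exact (v.norm_coe_le_norm t).trans_lt hv)
  rw [add_sub_cancel_left] at h3
  exact h3.trans (mul_le_mul_of_nonneg_left (v.norm_coe_le_norm t) hc.le)

/-- The induction step applies the statement to the derivative of `g`, which takes values in
`X →L[ℝ] Y`; hence the universe of `Y`. -/
theorem contDiff_continuousMap_comp_nat {X : Type u} [NormedAddCommGroup X] [NormedSpace ℝ X]
    (n : ℕ) : ∀ {Y : Type (max u v)} [NormedAddCommGroup Y] [NormedSpace ℝ Y] (g : C(X, Y)),
    ContDiff ℝ n g → ContDiff ℝ n (fun u : C(K, X) => g.comp u) := by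
  induction n with
  | zero =>
    intro Y _ _ g _
    simp only [Nat.cast_zero, contDiff_zero]
    exact ContinuousMap.continuous_postcomp g
  | succ n ih =>
    intro Y _ _ g hg
    have hg1 : Differentiable ℝ g := hg.differentiable (by simp)
    have hgc : ContDiff ℝ n (fderiv ℝ g) := hg.fderiv_right (by simp)
    let g' : C(X, X →L[ℝ] Y) := ⟨fderiv ℝ g, hgc.continuous⟩
    push_cast
    rw [contDiff_succ_iff_hasFDerivAt]
    refine ⟨_, ?_, fun u => hasFDerivAt_continuousMap_comp g g' (fun x => (hg1 x).hasFDerivAt) u⟩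
    exact (ContinuousMap.applyBilin K X Y).contDiff.comp (ih g' hgc)

/-- The omega lemma: composition with a smooth map is a smooth operation on continuous curves. -/
theorem contDiff_continuousMap_comp {X : Type u} [NormedAddCommGroup X] [NormedSpace ℝ X]
    {Y : Type (max u v)} [NormedAddCommGroup Y] [NormedSpace ℝ Y] (g : C(X, Y))
    (hg : ContDiff ℝ ∞ g) : ContDiff ℝ ∞ (fun u : C(K, X) => g.comp u) :=
  contDiff_infty.2 fun n => contDiff_continuousMap_comp_nat.{u, v} n g (contDiff_infty.1 hg n)

end Composition

/-! ### Smooth dependence of solutions on initial values -/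

section Flow

variable {X : Type*} [NormedAddCommGroup X]

/-- The extension of a curve on the unit interval to the real line by constants. -/
noncomputable def extendCurve (u : C(unitInterval, X)) (s : ℝ) : X :=
  u (projIcc 0 1 zero_le_one s)

theorem continuous_extendCurve (u : C(unitInterval, X)) : Continuous (extendCurve u) :=
  u.continuous.comp continuous_projIcc

theorem extendCurve_of_mem (u : C(unitInterval, X)) {s : ℝ} (hs : s ∈ Icc (0 : ℝ) 1) :
    extendCurve u s = u ⟨s, hs⟩ := by
  simp [extendCurve, projIcc_of_mem _ hs]

variable [NormedSpace ℝ X]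

/-- The primitive vanishing at `0`, as a bounded operator on curves on the unit interval. -/
noncomputable def primitiveL (X : Type*) [NormedAddCommGroup X] [NormedSpace ℝ X]
    [CompleteSpace X] : C(unitInterval, X) →L[ℝ] C(unitInterval, X) :=
  LinearMap.mkContinuous
    { toFun := fun u => ⟨fun s => ∫ r in (0 : ℝ)..s, extendCurve u r,
        (intervalIntegral.continuous_primitive
          (fun a b => (continuous_extendCurve u).intervalIntegrable a b) 0).comp
          continuous_subtype_val⟩
      map_add' := fun u v => by
        ext s
        exact intervalIntegral.integral_add ((continuous_extendCurve u).intervalIntegrable _ _)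
          ((continuous_extendCurve v).intervalIntegrable _ _)
      map_smul' := fun c u => by
        ext s
        exact intervalIntegral.integral_smul c (extendCurve u) } 1 (by
    intro u
    rw [one_mul]
    refine (ContinuousMap.norm_le _ (norm_nonneg _)).2 fun s => ?_
    refine (intervalIntegral.norm_integral_le_of_norm_le_const
      fun r _ => u.norm_coe_le_norm _).trans ?_
    rw [sub_zero, abs_of_nonneg s.2.1]
    exact mul_le_of_le_one_right (norm_nonneg _) s.2.2)

theorem primitiveL_apply [CompleteSpace X] (u : C(unitInterval, X)) (s : unitInterval) :
    primitiveL X u s = ∫ r in (0 : ℝ)..s, extendCurve u r := rfl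

theorem hasDerivWithinAt_extendCurve_primitiveL [CompleteSpace X] (u : C(unitInterval, X)) {s : ℝ}
    (hs : s ∈ Icc (0 : ℝ) 1) :
    HasDerivWithinAt (extendCurve (primitiveL X u)) (extendCurve u s) (Icc 0 1) s := by
  have h1 : HasDerivAt (fun s => ∫ r in (0 : ℝ)..s, extendCurve u r) (extendCurve u s) s :=
    intervalIntegral.integral_hasDerivAt_right ((continuous_extendCurve u).intervalIntegrable _ _)
      ((continuous_extendCurve u).stronglyMeasurableAtFilter _ _)
      (continuous_extendCurve u).continuousAt
  refine h1.hasDerivWithinAt.congr_of_mem (fun r hr => ?_) hs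
  rw [extendCurve_of_mem _ hr, primitiveL_apply]

/-- Near an equilibrium `z₀` of a smooth vector field `g`, the solutions are defined up to a common
time `τ > 0` (time being rescaled to the unit interval), and as curves they depend smoothly on the
initial value. They are obtained by solving the integral equation `u = z + τ ∫ g (u)` with the
inverse function theorem, starting from `τ = 0`, where the left-hand side minus the right-hand side
has the identity for derivative with respect to `u`. The last clause is a local uniqueness
statement. -/
theorem exists_smooth_flow_near_equilibrium [FiniteDimensional ℝ X] {g : X → X} {Ω : Set X}
    (hΩ : IsOpen Ω) (hg : ContDiffOn ℝ ∞ g Ω) {z₀ : X} (hz₀ : z₀ ∈ Ω) (hgz : g z₀ = 0) :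
    ∃ τ > (0 : ℝ), ∃ N : Set X, IsOpen N ∧ z₀ ∈ N ∧ ∃ u : X → C(unitInterval, X),
      ContDiffOn ℝ ∞ u N ∧ u z₀ = ContinuousMap.const _ z₀ ∧
      (∀ z ∈ N, u z 0 = z ∧ (∀ s, u z s ∈ Ω) ∧ ∀ s ∈ Icc (0 : ℝ) 1,
        HasDerivWithinAt (extendCurve (u z)) (τ • g (extendCurve (u z) s)) (Icc 0 1) s) ∧
      ∃ δ > 0, ∀ z ∈ N, ∀ p : C(unitInterval, X), dist p (ContinuousMap.const _ z₀) < δ →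
        (∀ s : unitInterval, p s = z + τ • ∫ r in (0 : ℝ)..s, g (extendCurve p r)) →
        p = u z := by
  have : CompleteSpace X := FiniteDimensional.complete ℝ X
  obtain ⟨ρ, hρ, hρΩ⟩ := Metric.isOpen_iff.1 hΩ z₀ hz₀
  let χ : ContDiffBump z₀ := ⟨ρ / 3, ρ / 2, by positivity, by linarith⟩
  -- the field, cut off outside a neighbourhood of the equilibrium
  let gχ : X → X := fun x => χ x • g x
  have hgχ : ContDiff ℝ ∞ gχ := by
    rw [contDiff_iff_contDiffAt]
    intro x
    by_cases hx : x ∈ Ω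
    · exact χ.contDiff.contDiffAt.smul (hg.contDiffAt (hΩ.mem_nhds hx))
    · have hx' : x ∉ tsupport χ := by
        rw [χ.tsupport_eq]
        intro h
        exact hx (hρΩ (Metric.closedBall_subset_ball (by simp only [χ]; linarith) h))
      refine (contDiffAt_const (c := (0 : X))).congr_of_eventuallyEq ?_
      filter_upwards [(isClosed_tsupport χ).isOpen_compl.mem_nhds hx'] with y hy
      simp [gχ, image_eq_zero_of_notMem_tsupport hy]
  have hgχ_eq : ∀ x ∈ Metric.ball z₀ (ρ / 3), gχ x = g x := fun x hx => by
    simp [gχ, χ.one_of_mem_closedBall (Metric.ball_subset_closedBall hx)]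
  let G : C(X, X) := ⟨gχ, hgχ.continuous⟩
  let c₀ : C(unitInterval, X) := ContinuousMap.const _ z₀
  let cL : X →L[ℝ] C(unitInterval, X) := ContinuousLinearMap.const ℝ unitInterval
  let f : (ℝ × X) × C(unitInterval, X) → C(unitInterval, X) :=
    fun q => q.2 - cL q.1.2 - q.1.1 • primitiveL X (G.comp q.2)
  have hf : ContDiff ℝ ∞ f := by
    have h1 : ContDiff ℝ ∞ (fun q : (ℝ × X) × C(unitInterval, X) => primitiveL X (G.comp q.2)) :=
      (primitiveL X).contDiff.comp ((contDiff_continuousMap_comp G hgχ).comp contDiff_snd)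
    have h2 : ContDiff ℝ ∞ (fun q : (ℝ × X) × C(unitInterval, X) => cL q.1.2) :=
      cL.contDiff.comp (contDiff_snd.comp contDiff_fst)
    exact (contDiff_snd.sub h2).sub ((contDiff_fst.comp contDiff_fst).smul h1)
  obtain ⟨σ, hσ0, -, hσ, -, hσsymm⟩ := exists_smooth_openPartialHomeomorph_prodMk isOpen_univ
    hf.contDiffOn (p := ((0 : ℝ), z₀)) (v := c₀) (mem_univ _)
    (f' := ContinuousLinearEquiv.refl ℝ _) (by
      simpa [f] using (hasFDerivAt_id c₀).sub_const (cL z₀))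
  have hfc : ∀ τ : ℝ, f ((τ, z₀), c₀) = 0 := by
    intro τ
    have h1 : G.comp c₀ = 0 := by
      ext s
      simp [G, c₀, gχ, hgz]
    have h2 : cL z₀ = c₀ := rfl
    simp [f, h1, h2]
  obtain ⟨τ, hτ, hτs⟩ : ∃ τ > (0 : ℝ), ((τ, z₀), c₀) ∈ σ.source := by
    have h1 : ∀ᶠ τ in 𝓝 (0 : ℝ), ((τ, z₀), c₀) ∈ σ.source := by
      have h2 : Continuous (fun τ : ℝ => ((τ, z₀), c₀)) := by fun_prop
      exact h2.continuousAt (σ.open_source.mem_nhds hσ0)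
    obtain ⟨τ, h2, h3⟩ := ((h1.filter_mono nhdsWithin_le_nhds).and
      (self_mem_nhdsWithin (s := Ioi (0 : ℝ)))).exists
    exact ⟨τ, h3, h2⟩
  have hσc : σ ((τ, z₀), c₀) = ((τ, z₀), 0) := by rw [hσ, hfc]
  let u : X → C(unitInterval, X) := fun z => (σ.symm ((τ, z), 0)).2
  have huz₀ : u z₀ = c₀ := by
    simp only [u]
    rw [← hσc, σ.left_inv hτs]
  let ι : X → (ℝ × X) × C(unitInterval, X) := fun z => ((τ, z), 0)
  have hι : ContDiff ℝ ∞ ι := (contDiff_const.prodMk contDiff_id).prodMk contDiff_const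
  obtain ⟨N₁, hN₁, hzN₁, δ, hδ, hNδ⟩ : ∃ N₁ : Set X, IsOpen N₁ ∧ z₀ ∈ N₁ ∧ ∃ δ > 0,
      ∀ z ∈ N₁, ∀ p ∈ Metric.ball c₀ δ, ((τ, z), p) ∈ σ.source := by
    have h1 : Continuous (fun q : X × C(unitInterval, X) => ((τ, q.1), q.2)) := by fun_prop
    have h2 : (fun q : X × C(unitInterval, X) => ((τ, q.1), q.2)) ⁻¹' σ.source ∈ 𝓝 (z₀, c₀) :=
      h1.continuousAt (σ.open_source.mem_nhds hτs)
    obtain ⟨N₁, hN₁, B, hB, hsub⟩ := mem_nhds_prod_iff.1 h2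
    obtain ⟨O, hO, hO', hzO⟩ := mem_nhds_iff.1 hN₁
    obtain ⟨δ, hδ, hδB⟩ := Metric.mem_nhds_iff.1 hB
    exact ⟨O, hO', hzO, δ, hδ, fun z hz p hp => hsub (mk_mem_prod (hO hz) (hδB hp))⟩
  let N : Set X := N₁ ∩ ι ⁻¹' (σ.target ∩ σ.symm ⁻¹' (Prod.snd ⁻¹' Metric.ball c₀ (ρ / 3)))
  have hballs : ∀ p ∈ Metric.ball c₀ (ρ / 3), ∀ s, p s ∈ Metric.ball z₀ (ρ / 3) := fun p hp s =>
    (ContinuousMap.dist_apply_le_dist (f := p) (g := c₀) s).trans_lt hp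
  refine ⟨τ, hτ, N, ?_, ⟨hzN₁, ?_, ?_⟩, u, ?_, huz₀, ?_, min δ (ρ / 3), by positivity, ?_⟩
  · refine hN₁.inter (IsOpen.preimage hι.continuous ?_)
    exact σ.symm.isOpen_inter_preimage (Metric.isOpen_ball.preimage continuous_snd)
  · simpa only [ι, hσc] using σ.map_source hτs
  · change u z₀ ∈ Metric.ball c₀ (ρ / 3)
    rw [huz₀]
    exact Metric.mem_ball_self (by positivity)
  · exact contDiff_snd.comp_contDiffOn (hσsymm.comp hι.contDiffOn fun z hz => hz.2.1)
  · rintro z ⟨-, hzt, hzb⟩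
    have h1 : σ (σ.symm ((τ, z), 0)) = ((τ, z), 0) := σ.right_inv hzt
    rw [hσ] at h1
    have h2 : (σ.symm ((τ, z), 0)).1 = (τ, z) := congrArg Prod.fst h1
    have h3 : f (σ.symm ((τ, z), 0)) = 0 := congrArg Prod.snd h1
    have h4 : u z = cL z + τ • primitiveL X (G.comp (u z)) := by
      simp only [f, h2] at h3
      exact sub_eq_zero.1 (by rw [← h3]; simp only [u]; abel)
    have h5 : ∀ s, u z s ∈ Metric.ball z₀ (ρ / 3) := hballs _ hzb
    refine ⟨?_, fun s => hρΩ (Metric.ball_subset_ball (by linarith) (h5 s)), fun s hs => ?_⟩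
    · rw [h4]
      simp [primitiveL_apply, cL]
    · have h6 := ((hasDerivWithinAt_extendCurve_primitiveL (G.comp (u z)) hs).const_smul
        τ).const_add z
      have h7 : extendCurve (G.comp (u z)) s = g (extendCurve (u z) s) := hgχ_eq _ (h5 _)
      rw [h7] at h6
      refine h6.congr_of_mem (fun r hr => ?_) hs
      conv_lhs => rw [h4]
      rfl
  · rintro z ⟨hz, -⟩ p hp hps
    have hp1 : p ∈ Metric.ball c₀ δ := hp.trans_le (min_le_left _ _)
    have hp2 : p ∈ Metric.ball c₀ (ρ / 3) := hp.trans_le (min_le_right _ _)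
    have h1 : f ((τ, z), p) = 0 := by
      ext s
      have h2 : ∀ r, gχ (extendCurve p r) = g (extendCurve p r) :=
        fun r => hgχ_eq _ (hballs p hp2 _)
      have h3 : primitiveL X (G.comp p) s = ∫ r in (0 : ℝ)..s, g (extendCurve p r) := by
        rw [primitiveL_apply]
        exact intervalIntegral.integral_congr fun r _ => h2 r
      have h4 : (f ((τ, z), p)) s = p s - z - τ • primitiveL X (G.comp p) s := rfl
      rw [h4, h3, hps s]
      simp
    have h5 := σ.left_inv (hNδ z hz p hp1)
    rw [hσ, h1] at h5
    exact (congrArg Prod.snd h5).symm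

end Flow

/-! ### The boundary value problem for small times -/

theorem eq_of_hasDerivWithinAt_zero {X : Type*} [NormedAddCommGroup X] [NormedSpace ℝ X]
    {f : ℝ → X} {a b : ℝ} (hf : ∀ s ∈ Icc a b, HasDerivWithinAt f 0 (Icc a b) s) {s : ℝ}
    (hs : s ∈ Icc a b) : f s = f a :=
  constant_of_has_deriv_right_zero (fun s hs => (hf s hs).continuousWithinAt)
    (fun s hs => (hf s (Ico_subset_Icc_self hs)).mono_of_mem_nhdsWithin
      (Icc_mem_nhdsGE_of_mem hs)) s hs

theorem HasDerivWithinAt.prod_fst {X Y : Type*} [NormedAddCommGroup X] [NormedSpace ℝ X]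
    [NormedAddCommGroup Y] [NormedSpace ℝ Y] {f : ℝ → X × Y} {f' : X × Y} {s : Set ℝ} {t : ℝ}
    (h : HasDerivWithinAt f f' s t) : HasDerivWithinAt (fun t => (f t).1) f'.1 s t :=
  (ContinuousLinearMap.fst ℝ X Y).hasFDerivAt.comp_hasDerivWithinAt t h

theorem HasDerivWithinAt.prod_snd {X Y : Type*} [NormedAddCommGroup X] [NormedSpace ℝ X]
    [NormedAddCommGroup Y] [NormedSpace ℝ Y] {f : ℝ → X × Y} {f' : X × Y} {s : Set ℝ} {t : ℝ}
    (h : HasDerivWithinAt f f' s t) : HasDerivWithinAt (fun t => (f t).2) f'.2 s t :=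
  (ContinuousLinearMap.snd ℝ X Y).hasFDerivAt.comp_hasDerivWithinAt t h

/-- Solutions of the parametrized system `y' = A (x, y, w)`, `w' = B (x, y, w)` which start at the
point `y = e x` and return there, or nearby, at a small time `h`. The initial "velocity" `w` plays
the role of a coordinate on the end points: `y h = e x + (h / τ) • z`, where `(h, x, w) ↦ (h, x, z)`
is a local diffeomorphism `σ` at `((0, x₀), 0)`, the time `h = 0` included.

The substitution `y = e x + h • Y` with time `t = h s` turns the system into `Y' = A`, `W' = h • B`.
This system is smooth up to `h = 0` and has an equilibrium at `h = 0`, `x = x₀`, `Y = W = 0`. For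
`h = 0` and `x = x₀` its solutions are `Y s = s • w`, so that the initial value `w` is determined by
the end point. -/
theorem exists_boundary_value_solution {F V : Type*}
    [NormedAddCommGroup F] [NormedSpace ℝ F] [FiniteDimensional ℝ F]
    [NormedAddCommGroup V] [NormedSpace ℝ V] [FiniteDimensional ℝ V]
    {A B : F × V × V → V} {e : F → V} {D : Set (F × V × V)} {X₀ : Set F}
    (hD : IsOpen D) (hX₀ : IsOpen X₀) (he : ContDiffOn ℝ ∞ e X₀)
    (hA : ContDiffOn ℝ ∞ A D) (hB : ContDiffOn ℝ ∞ B D) {x₀ : F} (hx₀ : x₀ ∈ X₀)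
    (hD₀ : (x₀, e x₀, (0 : V)) ∈ D)
    (hA₀ : ∀ w, (x₀, e x₀, w) ∈ D → A (x₀, e x₀, w) = w) :
    ∃ τ > (0 : ℝ), ∃ σ : OpenPartialHomeomorph ((ℝ × F) × V) ((ℝ × F) × V),
      ∃ sol : (ℝ × F) × V → ℝ → V × V,
        ((0, x₀), 0) ∈ σ.source ∧ σ ((0, x₀), 0) = ((0, x₀), 0) ∧ (∀ z, (σ z).1 = z.1) ∧
        ContDiffOn ℝ ∞ σ σ.source ∧ ContDiffOn ℝ ∞ σ.symm σ.target ∧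
        (∀ z ∈ σ.source, z.1.2 ∈ X₀) ∧
        (∀ z ∈ σ.source, 0 < z.1.1 → sol z 0 = (e z.1.2, z.2) ∧
          (∀ t ∈ Icc 0 z.1.1, (z.1.2, sol z t) ∈ D ∧
            HasDerivWithinAt (sol z) (A (z.1.2, sol z t), B (z.1.2, sol z t)) (Icc 0 z.1.1) t) ∧
          (sol z z.1.1).1 = e z.1.2 + (z.1.1 / τ) • (σ z).2) ∧
        ∀ D' ∈ 𝓝 (x₀, e x₀, (0 : V)), ∀ᶠ z in 𝓝 (((0 : ℝ), x₀), (0 : V)),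
          0 < z.1.1 → ∀ t ∈ Icc 0 z.1.1, (z.1.2, sol z t) ∈ D' := by
  have : CompleteSpace F := FiniteDimensional.complete ℝ F
  have : CompleteSpace V := FiniteDimensional.complete ℝ V
  let aff : ℝ × F × V × V → F × V × V := fun q => (q.2.1, e q.2.1 + q.1 • q.2.2.1, q.2.2.2)
  let S : Set (ℝ × F × V × V) := (fun q => q.2.1) ⁻¹' X₀
  have hS : IsOpen S := hX₀.preimage (by fun_prop)
  have haff : ContDiffOn ℝ ∞ aff S := by
    have h1 : ContDiffOn ℝ ∞ (fun q : ℝ × F × V × V => e q.2.1) S :=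
      he.comp (contDiff_fst.comp contDiff_snd).contDiffOn fun q hq => hq
    refine (ContDiff.contDiffOn (by fun_prop)).prodMk
      ((h1.add (ContDiff.contDiffOn (by fun_prop))).prodMk (ContDiff.contDiffOn (by fun_prop)))
  let Ω : Set (ℝ × F × V × V) := S ∩ aff ⁻¹' D
  have hΩ : IsOpen Ω := haff.continuousOn.isOpen_inter_preimage hS hD
  let g : ℝ × F × V × V → ℝ × F × V × V := fun q => (0, 0, A (aff q), q.1 • B (aff q))
  have hg : ContDiffOn ℝ ∞ g Ω := by
    have h1 : ContDiffOn ℝ ∞ (fun q => A (aff q)) Ω :=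
      hA.comp (haff.mono inter_subset_left) fun q hq => hq.2
    have h2 : ContDiffOn ℝ ∞ (fun q => B (aff q)) Ω :=
      hB.comp (haff.mono inter_subset_left) fun q hq => hq.2
    exact contDiffOn_const.prodMk (contDiffOn_const.prodMk
      (h1.prodMk (contDiff_fst.contDiffOn.smul h2)))
  let z₀ : ℝ × F × V × V := (0, x₀, 0, 0)
  have haff₀ : aff z₀ = (x₀, e x₀, 0) := by simp [aff, z₀]
  have hz₀ : z₀ ∈ Ω := ⟨hx₀, by change aff z₀ ∈ D; rwa [haff₀]⟩
  have hgz : g z₀ = 0 := by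
    change ((0 : ℝ), (0 : F), A (aff z₀), (0 : ℝ) • B (aff z₀)) = 0
    rw [haff₀, hA₀ 0 hD₀, zero_smul]
    rfl
  obtain ⟨τ, hτ, N, hN, hzN, u, hu, huz₀, husol, δ, hδ, huniq⟩ :=
    exists_smooth_flow_near_equilibrium hΩ hg hz₀ hgz
  let ι : (ℝ × F) × V → ℝ × F × V × V := fun z => (z.1.1 / τ, z.1.2, 0, z.2)
  have hι : ContDiff ℝ ∞ ι := by fun_prop
  have hι₀ : ι ((0, x₀), 0) = z₀ := by simp [ι, z₀]
  let f : (ℝ × F) × V → V := fun z => (u (ι z) 1).2.2.1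
  let Ω' : Set ((ℝ × F) × V) := ι ⁻¹' N
  have hΩ' : IsOpen Ω' := hN.preimage hι.continuous
  have hΩ'₀ : ((0, x₀), 0) ∈ Ω' := by simpa [Ω', hι₀] using hzN
  have hf : ContDiffOn ℝ ∞ f Ω' := by
    have h1 : ContDiffOn ℝ ∞ (fun z => u (ι z)) Ω' := hu.comp hι.contDiffOn fun z hz => hz
    have h2 : ContDiffOn ℝ ∞ (fun z => u (ι z) 1) Ω' :=
      (ContinuousMap.evalCLM (M := ℝ × F × V × V) ℝ (1 : unitInterval)).contDiff.comp_contDiffOn h1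
    exact (contDiff_fst.comp (contDiff_snd.comp contDiff_snd)).comp_contDiffOn h2
  -- the explicit solutions for `h = 0` and `x = x₀`
  have hf₀ : ∀ᶠ w in 𝓝 (0 : V), f ((0, x₀), w) = τ • w := by
    have hc1 : Continuous (fun w : V => ι ((0, x₀), w)) := by fun_prop
    have hc2 : Continuous (fun w : V => (x₀, e x₀, w)) := by fun_prop
    filter_upwards [hc1.continuousAt.preimage_mem_nhds (by rw [hι₀]; exact hN.mem_nhds hzN),
      hc2.continuousAt.preimage_mem_nhds (hD.mem_nhds hD₀),
      Metric.ball_mem_nhds (0 : V) (show 0 < δ / (τ + 1) by positivity)] with w hw1 hw2 hw3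
    rw [mem_ball_zero_iff, lt_div_iff₀ (by positivity)] at hw3
    let p : C(unitInterval, ℝ × F × V × V) := ⟨fun s => (0, x₀, (τ * s) • w, w), by fun_prop⟩
    have hp1 : dist p (ContinuousMap.const _ z₀) < δ := by
      refine lt_of_le_of_lt ((ContinuousMap.dist_le (by positivity)).2 fun s => ?_) hw3
      have h1 : p s - z₀ = (0, 0, (τ * s) • w, w) := by simp [p, z₀]
      change dist (p s) z₀ ≤ _
      rw [dist_eq_norm, h1]
      simp only [Prod.norm_def, norm_zero, norm_smul, norm_mul, Real.norm_eq_abs,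
        abs_of_pos hτ, abs_of_nonneg s.2.1]
      have h2 : τ * (s : ℝ) ≤ τ := mul_le_of_le_one_right hτ.le s.2.2
      have h3 := norm_nonneg w
      refine max_le (by positivity) (max_le (by positivity) (max_le ?_ ?_)) <;> nlinarith
    have hp2 : ∀ s : unitInterval,
        p s = ι ((0, x₀), w) + τ • ∫ r in (0 : ℝ)..s, g (extendCurve p r) := by
      intro s
      have h1 : ∀ r, g (extendCurve p r) = (0, 0, w, 0) := by
        intro r
        have h2 : aff (extendCurve p r) = (x₀, e x₀, w) := by simp [aff, extendCurve, p]
        change ((0 : ℝ), (0 : F), A (aff (extendCurve p r)), (0 : ℝ) • B _) = _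
        rw [h2, hA₀ w hw2, zero_smul]
      simp [h1, p, ι, smul_smul]
    have hp3 := huniq _ hw1 p hp1 hp2
    simp only [f]
    rw [← hp3]
    simp [p]
  obtain ⟨σ, hσ₀, hσΩ, hσ, hσs, hσt⟩ := exists_smooth_openPartialHomeomorph_prodMk hΩ' hf
    (p := ((0 : ℝ), x₀)) (v := (0 : V)) hΩ'₀
    (f' := ContinuousLinearEquiv.smulLeft (Units.mk0 τ hτ.ne')) (by
      refine HasFDerivAt.congr_of_eventuallyEq ?_ hf₀
      exact (hasFDerivAt_id (0 : V)).const_smul τ)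
  let sol : (ℝ × F) × V → ℝ → V × V := fun z t =>
    (aff (extendCurve (u (ι z)) (t / z.1.1))).2
  -- the first two components of a solution are constant
  have hcst : ∀ z ∈ Ω', ∀ s ∈ Icc (0 : ℝ) 1,
      (extendCurve (u (ι z)) s).1 = z.1.1 / τ ∧ (extendCurve (u (ι z)) s).2.1 = z.1.2 := by
    intro z hz s hs
    obtain ⟨h1, -, h3⟩ := husol _ hz
    have h0 : extendCurve (u (ι z)) 0 = ι z :=
      (extendCurve_of_mem _ (left_mem_Icc.2 zero_le_one)).trans h1
    have h4 := eq_of_hasDerivWithinAt_zero (f := fun s => (extendCurve (u (ι z)) s).1)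
      (fun r hr => by simpa [g] using (h3 r hr).prod_fst) hs
    have h5 := eq_of_hasDerivWithinAt_zero (f := fun s => (extendCurve (u (ι z)) s).2.1)
      (fun r hr => by simpa [g] using (h3 r hr).prod_snd.prod_fst) hs
    rw [h4, h5, h0]
    exact ⟨rfl, rfl⟩
  have hsol : ∀ z ∈ Ω', 0 < z.1.1 → ∀ t ∈ Icc 0 z.1.1,
      (z.1.2, sol z t) = aff (extendCurve (u (ι z)) (t / z.1.1)) := by
    intro z hz hh t ht
    have h1 := (hcst z hz (t / z.1.1) ⟨div_nonneg ht.1 hh.le, div_le_one_of_le₀ ht.2 hh.le⟩).2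
    refine Prod.ext ?_ rfl
    exact h1.symm
  refine ⟨τ, hτ, σ, sol, hσ₀, ?_, fun z => by rw [hσ], hσs, hσt, ?_, ?_, ?_⟩
  · rw [hσ]
    have := hf₀.self_of_nhds
    rw [this, smul_zero]
  · intro z hz
    have h1 := husol _ (hσΩ hz)
    have h2 := (h1.2.1 0).1
    rw [h1.1] at h2
    exact h2
  · intro z hz hh
    have hzΩ := hσΩ hz
    obtain ⟨h1, h2, h3⟩ := husol _ hzΩ
    refine ⟨?_, fun t ht => ⟨?_, ?_⟩, ?_⟩
    · have h0 : extendCurve (u (ι z)) 0 = ι z :=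
        (extendCurve_of_mem _ (left_mem_Icc.2 zero_le_one)).trans h1
      simp [sol, h0, aff, ι]
    · rw [hsol z hzΩ hh t ht]
      exact (h2 _).2
    · have hts : t / z.1.1 ∈ Icc (0 : ℝ) 1 :=
        ⟨div_nonneg ht.1 hh.le, div_le_one_of_le₀ ht.2 hh.le⟩
      rw [hsol z hzΩ hh t ht]
      have h4 : HasDerivWithinAt (fun t : ℝ => t / z.1.1) (1 / z.1.1) (Icc 0 z.1.1) t :=
        ((hasDerivAt_id t).div_const _).hasDerivWithinAt
      have h5 := HasDerivWithinAt.scomp t (h3 _ hts) h4 fun r hr =>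
        ⟨div_nonneg hr.1 hh.le, div_le_one_of_le₀ hr.2 hh.le⟩
      have hq := (hcst z hzΩ _ hts).1
      set q := extendCurve (u (ι z)) (t / z.1.1) with hqdef
      have h6 : HasDerivWithinAt (fun t => e z.1.2 + (z.1.1 / τ) •
          (extendCurve (u (ι z)) (t / z.1.1)).2.2.1) (A (aff q)) (Icc 0 z.1.1) t := by
        have := (h5.prod_snd.prod_snd.prod_fst.const_smul (z.1.1 / τ)).const_add (e z.1.2)
        refine this.congr_deriv ?_
        have hh' := hh.ne'
        simp only [g, Prod.smul_mk, smul_smul]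
        rw [show z.1.1 / τ * (1 / z.1.1 * τ) = 1 by field_simp, one_smul]
      have h7 : HasDerivWithinAt (fun t => (extendCurve (u (ι z)) (t / z.1.1)).2.2.2)
          (B (aff q)) (Icc 0 z.1.1) t := by
        have := h5.prod_snd.prod_snd.prod_snd
        refine this.congr_deriv ?_
        have hh' := hh.ne'
        simp only [g, Prod.smul_mk, smul_smul, hq]
        rw [show 1 / z.1.1 * (τ * (z.1.1 / τ)) = 1 by field_simp, one_smul]
      refine (h6.prodMk h7).congr_of_mem (fun r hr => ?_) ht
      have h8 := hcst z hzΩ (r / z.1.1)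
        ⟨div_nonneg hr.1 hh.le, div_le_one_of_le₀ hr.2 hh.le⟩
      simp only [sol, aff, h8]
    · have h8 := hcst z hzΩ 1 (by simp)
      have h9 : extendCurve (u (ι z)) 1 = u (ι z) 1 := extendCurve_of_mem _ (by simp)
      rw [h9] at h8
      simp [sol, aff, div_self hh.ne', h9, h8, hσ, f]
  · intro D' hD'
    have h1 : aff ⁻¹' D' ∈ 𝓝 z₀ :=
      (haff.continuousOn.continuousAt (hS.mem_nhds hx₀)).preimage_mem_nhds (by rwa [haff₀])
    obtain ⟨ε, hε, hεD⟩ := Metric.mem_nhds_iff.1 h1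
    have h2 : ContinuousAt (fun z => u (ι z)) ((0, x₀), 0) :=
      ContinuousAt.comp (g := u) (by
        rw [hι₀]; exact hu.continuousOn.continuousAt (hN.mem_nhds hzN)) hι.continuous.continuousAt
    have h3 := h2.preimage_mem_nhds (t := Metric.ball (ContinuousMap.const _ z₀) ε) (by
      rw [hι₀, huz₀]; exact Metric.ball_mem_nhds _ hε)
    filter_upwards [h3, hΩ'.mem_nhds hΩ'₀] with z hz1 hz2 hh t ht
    rw [hsol z hz2 hh t ht]
    exact hεD ((ContinuousMap.dist_apply_le_dist _).trans_lt hz1)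

/-! ### Velocities of curves in manifolds -/

section Velocity

variable {E : Type*} [NormedAddCommGroup E] [NormedSpace ℝ E]
  {H : Type*} [TopologicalSpace H] {I : ModelWithCorners ℝ E H}
  {M : Type*} [TopologicalSpace M] [ChartedSpace H M]
  {E' : Type*} [NormedAddCommGroup E'] [NormedSpace ℝ E']
  {H' : Type*} [TopologicalSpace H'] {I' : ModelWithCorners ℝ E' H'}
  {N : Type*} [TopologicalSpace N] [ChartedSpace H' N]
  {V : Type*} [NormedAddCommGroup V] [NormedSpace ℝ V]

/-- The curve `c` passes at time `t` through the foot of the tangent vector `v`, and has velocity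
`v` there; the derivative is taken within the set of times `s`. -/
def HasVelocity (c : ℝ → M) (s : Set ℝ) (t : ℝ) (v : TangentBundle I M) : Prop :=
  c t = v.proj ∧ HasMFDerivWithinAt 𝓘(ℝ, ℝ) I c s t ((1 : ℝ →L[ℝ] ℝ).smulRight (v.2 : E))

theorem hasMFDerivWithinAt_smulRight {c : ℝ → M} {s : Set ℝ} {t : ℝ} {L : ℝ →L[ℝ] E} {u : E}
    (h : HasMFDerivWithinAt 𝓘(ℝ, ℝ) I c s t L) (hu : L 1 = u) :
    HasMFDerivWithinAt 𝓘(ℝ, ℝ) I c s t ((1 : ℝ →L[ℝ] ℝ).smulRight u) := by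
  have h1 : L = (1 : ℝ →L[ℝ] ℝ).smulRight u := by
    ext
    simp [hu]
  exact h1 ▸ h

theorem isMIntegralCurveOn_iff_hasVelocity {γ : ℝ → M} {X : (x : M) → TangentSpace I x}
    {s : Set ℝ} :
    IsMIntegralCurveOn γ X s ↔
      ∀ t ∈ s, HasVelocity γ s t (⟨γ t, X (γ t)⟩ : TangentBundle I M) :=
  ⟨fun h t ht => ⟨rfl, h t ht⟩, fun h t ht => (h t ht).2⟩

namespace HasVelocity

variable {c c' : ℝ → M} {s s' : Set ℝ} {t : ℝ} {v v' : TangentBundle I M}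

theorem continuousWithinAt (h : HasVelocity c s t v) : ContinuousWithinAt c s t :=
  h.2.continuousWithinAt

theorem mono (h : HasVelocity c s t v) (hs : s' ⊆ s) : HasVelocity c s' t v :=
  ⟨h.1, h.2.mono hs⟩

theorem mono_of_mem_nhdsWithin (h : HasVelocity c s t v) (hs : s ∈ 𝓝[s'] t) :
    HasVelocity c s' t v :=
  ⟨h.1, h.2.mono_of_mem_nhdsWithin hs⟩

theorem congr (h : HasVelocity c s t v) (hc : EqOn c' c s) (ht : t ∈ s) :
    HasVelocity c' s t v := by
  refine ⟨(hc ht).trans h.1, ?_⟩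
  exact HasMFDerivWithinAt.congr_mono (f := c) (f₁ := c') h.2 hc (hc ht) Subset.rfl

theorem congr_of_eventuallyEq (h : HasVelocity c s t v) (hc : c' =ᶠ[𝓝[s] t] c) (ht : c' t = c t) :
    HasVelocity c' s t v :=
  ⟨ht.trans h.1, HasMFDerivWithinAt.congr_of_eventuallyEq (f := c) (f₁ := c') h.2 hc ht⟩

theorem unique (h : HasVelocity c s t v) (h' : HasVelocity c s t v')
    (hs : UniqueDiffWithinAt ℝ s t) : v = v' := by
  obtain ⟨x, v⟩ := v
  obtain ⟨x', v'⟩ := v'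
  obtain ⟨rfl, h2⟩ := h
  obtain ⟨rfl, h2'⟩ := h'
  have h3 := hs.uniqueMDiffWithinAt.eq h2 h2'
  have h4 : (v : E) = v' := by
    have h5 := DFunLike.congr_fun (F := ℝ →L[ℝ] E) h3 (1 : ℝ)
    have h6 : ∀ u : E, ((1 : ℝ →L[ℝ] ℝ).smulRight u) 1 = u := fun u => by simp
    exact (h6 v).symm.trans (h5.trans (h6 v'))
  exact congrArg _ h4

theorem of_mdifferentiableWithinAt (h : MDifferentiableWithinAt 𝓘(ℝ, ℝ) I c s t) :
    HasVelocity c s t (tangentMapWithin 𝓘(ℝ, ℝ) I c s ⟨t, (1 : ℝ)⟩) := by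
  exact ⟨rfl, hasMFDerivWithinAt_smulRight h.hasMFDerivWithinAt rfl⟩

theorem tangentMapWithin_eq (h : HasVelocity c s t v) (hs : UniqueDiffWithinAt ℝ s t) :
    tangentMapWithin 𝓘(ℝ, ℝ) I c s ⟨t, (1 : ℝ)⟩ = v :=
  (of_mdifferentiableWithinAt h.2.mdifferentiableWithinAt).unique h hs

/-- The chain rule. Where `f` is only defined on a set, and that set is not a set of unique
differentiability, it still determines the image of the velocity of a curve in that set. -/
theorem comp_within {f : M → N} {S : Set M} (h : HasVelocity c s t v)
    (hf : MDifferentiableWithinAt I I' f S v.proj) (hc : MapsTo c s S) :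
    HasVelocity (fun r => f (c r)) s t (tangentMapWithin I I' f S v) := by
  obtain ⟨x, v⟩ := v
  obtain ⟨rfl, h2⟩ := h
  refine ⟨rfl, ?_⟩
  refine hasMFDerivWithinAt_smulRight (HasMFDerivWithinAt.comp t hf.hasMFDerivWithinAt h2 hc) ?_
  exact congrArg (mfderivWithin I I' f S (c t)) (one_smul ℝ v)

theorem comp {f : M → N} (h : HasVelocity c s t v) (hf : MDifferentiableAt I I' f v.proj) :
    HasVelocity (fun r => f (c r)) s t (tangentMap I I' f v) := by
  rw [← tangentMapWithin_univ]
  exact h.comp_within hf.mdifferentiableWithinAt (mapsTo_univ _ _)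

theorem prodMk {d : ℝ → N} {w : TangentBundle I' N} (h : HasVelocity c s t v)
    (h' : HasVelocity d s t w) :
    HasVelocity (fun r => (c r, d r)) s t ((equivTangentBundleProd I M I' N).symm (v, w)) := by
  obtain ⟨x, v⟩ := v
  obtain ⟨rfl, h2⟩ := h
  obtain ⟨y, w⟩ := w
  obtain ⟨rfl, h2'⟩ := h'
  refine ⟨rfl, ?_⟩
  refine hasMFDerivWithinAt_smulRight (I := I.prod I') (h2.prodMk h2') ?_
  exact Prod.ext (one_smul ℝ v) (one_smul ℝ w)

theorem const (x : M) : HasVelocity (fun _ => x) s t (⟨x, 0⟩ : TangentBundle I M) := by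
  refine ⟨rfl, ?_⟩
  exact hasMFDerivWithinAt_smulRight (hasMFDerivWithinAt_const x s t) rfl

theorem hasDerivWithinAt {c : ℝ → V} {v : TangentBundle 𝓘(ℝ, V) V} (h : HasVelocity c s t v) :
    HasDerivWithinAt c v.2 s t := by
  have h2 : HasFDerivWithinAt c ((1 : ℝ →L[ℝ] ℝ).smulRight (v.2 : V)) s t := h.2.hasFDerivWithinAt
  exact h2.hasDerivWithinAt.congr_deriv (one_smul ℝ (v.2 : V))

theorem of_hasDerivWithinAt {c : ℝ → V} {v : V} (h : HasDerivWithinAt c v s t) :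
    HasVelocity c s t (⟨c t, v⟩ : TangentBundle 𝓘(ℝ, V) V) := by
  refine ⟨rfl, ?_⟩
  exact hasMFDerivWithinAt_smulRight h.hasFDerivWithinAt.hasMFDerivWithinAt (one_smul ℝ v)

theorem line (y w : V) :
    HasVelocity (fun r : ℝ => y + r • w) s 0 (⟨y, w⟩ : TangentBundle 𝓘(ℝ, V) V) := by
  have h1 : HasDerivWithinAt (fun r : ℝ => y + r • w) w s 0 := by
    simpa using (((hasDerivAt_id (0 : ℝ)).smul_const w).const_add y).hasDerivWithinAt
  refine ⟨?_, (of_hasDerivWithinAt h1).2⟩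
  simp

end HasVelocity

theorem exists_curve_hasVelocity [I.Boundaryless] [IsManifold I ∞ M]
    (v : TangentBundle I M) : ∃ δ > 0, ∃ c : ℝ → M,
      ContMDiffOn 𝓘(ℝ, ℝ) I ∞ c (Ioo (-δ) δ) ∧ HasVelocity c univ 0 v := by
  let φ := extChartAt I v.proj
  let w : E := (tangentMap I 𝓘(ℝ, E) φ v).2
  let L : ℝ → E := fun t => φ v.proj + t • w
  have hL : ContDiff ℝ ∞ L := by fun_prop
  have hL0 : L 0 = φ v.proj := by simp [L]
  have htgt : L ⁻¹' φ.target ∈ 𝓝 (0 : ℝ) :=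
    hL.continuous.continuousAt.preimage_mem_nhds
      (by rw [hL0]; exact extChartAt_target_mem_nhds v.proj)
  obtain ⟨δ, hδ, hsub⟩ := Metric.mem_nhds_iff.1 htgt
  rw [Real.ball_eq_Ioo, zero_sub, zero_add] at hsub
  have hsymm : ContMDiffOn 𝓘(ℝ, E) I ∞ φ.symm φ.target := contMDiffOn_extChartAt_symm v.proj
  refine ⟨δ, hδ, fun t => φ.symm (L t), hsymm.comp hL.contMDiff.contMDiffOn hsub, ?_⟩
  have h1 : MDifferentiableAt 𝓘(ℝ, E) I φ.symm (φ v.proj) :=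
    (hsymm.contMDiffAt (extChartAt_target_mem_nhds v.proj)).mdifferentiableAt (by simp)
  have h2 : MDifferentiableAt I 𝓘(ℝ, E) φ v.proj :=
    (contMDiffAt_extChartAt (n := ∞)).mdifferentiableAt (by simp)
  have h3 : HasVelocity (fun t => φ.symm (L t)) univ 0
      (tangentMap 𝓘(ℝ, E) I φ.symm (tangentMap I 𝓘(ℝ, E) φ v)) :=
    (HasVelocity.line (φ v.proj) w).comp h1
  rw [← tangentMap_comp_at v h1 h2] at h3
  have h4 : tangentMap I I (φ.symm ∘ φ) v = v := by
    have h5 : (φ.symm ∘ φ) =ᶠ[𝓝 v.proj] id := by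
      filter_upwards [extChartAt_source_mem_nhds (I := I) v.proj] with x hx
      exact φ.left_inv hx
    have h6 : tangentMap I I (φ.symm ∘ φ) v = tangentMap I I id v := by
      refine Bundle.TotalSpace.ext h5.self_of_nhds ?_
      change HEq (mfderiv I I (φ.symm ∘ φ) v.proj v.2) (mfderiv I I id v.proj v.2)
      rw [h5.mfderiv_eq]
      rfl
    rw [h6, tangentMap_id]
    rfl
  rwa [h4] at h3

theorem IsTangentTo.exists_curve [IsManifold I ∞ M] {S : Set M} {x : M} {w : TangentSpace I x}
    (h : IsTangentTo S x w) : ∃ δ > 0, ∃ γ : ℝ → M, ContMDiffOn 𝓘(ℝ, ℝ) I ∞ γ (Ioo (-δ) δ) ∧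
      (∀ t ∈ Ioo (-δ) δ, γ t ∈ S) ∧ HasVelocity γ (Ioo (-δ) δ) 0 (⟨x, w⟩ : TangentBundle I M) := by
  obtain ⟨δ, hδ, γ, h1, h2, h3⟩ := h
  refine ⟨δ, hδ, γ, h1, h2, ?_⟩
  have h0 : Ioo (-δ) δ ∈ 𝓝 (0 : ℝ) := Ioo_mem_nhds (by linarith) hδ
  have h4 : MDifferentiableAt 𝓘(ℝ, ℝ) I γ 0 := (h1.contMDiffAt h0).mdifferentiableAt (by simp)
  rw [← h3, ← tangentMapWithin_univ]
  exact (HasVelocity.of_mdifferentiableWithinAt h4.mdifferentiableWithinAt).mono (subset_univ _)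

theorem isTangentTo_of_hasVelocity {S : Set M} {x : M} {w : TangentSpace I x} {δ : ℝ} (hδ : 0 < δ)
    {γ : ℝ → M} (h1 : ContMDiffOn 𝓘(ℝ, ℝ) I ∞ γ (Ioo (-δ) δ)) (h2 : ∀ t ∈ Ioo (-δ) δ, γ t ∈ S)
    (h3 : HasVelocity γ (Ioo (-δ) δ) 0 (⟨x, w⟩ : TangentBundle I M)) : IsTangentTo S x w := by
  have h0 : Ioo (-δ) δ ∈ 𝓝 (0 : ℝ) := Ioo_mem_nhds (by linarith) hδ
  refine ⟨δ, hδ, γ, h1, h2, ?_⟩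
  rw [← tangentMapWithin_univ]
  refine HasVelocity.tangentMapWithin_eq (h3.mono_of_mem_nhdsWithin ?_) uniqueDiffWithinAt_univ
  exact mem_nhdsWithin_of_mem_nhds h0

theorem t2Space_tangentBundle [IsManifold I 1 M] [T2Space M] : T2Space (TangentBundle I M) := by
  have hπ : Continuous (fun v : TangentBundle I M => v.proj) := FiberBundle.continuous_proj _ _
  refine ⟨fun v w hvw => ?_⟩
  by_cases h : v.proj = w.proj
  · let e := trivializationAt E (TangentSpace I) v.proj
    have hv : v ∈ e.source := e.mem_source.2 (FiberBundle.mem_baseSet_trivializationAt' _)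
    have hw : w ∈ e.source := e.mem_source.2 (h ▸ FiberBundle.mem_baseSet_trivializationAt' _)
    have hne : e v ≠ e w := fun h' => hvw (e.injOn hv hw h')
    obtain ⟨O, O', hO, hO', h1, h2, h3⟩ := t2_separation hne
    exact ⟨_, _, e.toOpenPartialHomeomorph.isOpen_inter_preimage hO,
      e.toOpenPartialHomeomorph.isOpen_inter_preimage hO', ⟨hv, h1⟩, ⟨hw, h2⟩,
      (h3.preimage _).mono inter_subset_right inter_subset_right⟩
  · obtain ⟨O, O', hO, hO', h1, h2, h3⟩ := t2_separation h
    exact ⟨_, _, hO.preimage hπ, hO'.preimage hπ, h1, h2, h3.preimage _⟩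

/-! ### Partial tangent maps -/

/-- The partial tangent map in the second variable: the value at `(w : T_y V)` of the tangent map
of `f (m, ·)`. -/
noncomputable def partialTangentMap (I' : ModelWithCorners ℝ E' H') (f : M × V → N)
    (z : M × V × V) : TangentBundle I' N :=
  tangentMap 𝓘(ℝ, V) I' (fun y => f (z.1, y)) ⟨z.2.1, z.2.2⟩

omit [TopologicalSpace M] in
theorem HasVelocity.comp_partial {f : M × V → N} {m : M} {y w : V} {s : Set ℝ} {t : ℝ} {c : ℝ → V}
    (hc : HasVelocity c s t (⟨y, w⟩ : TangentBundle 𝓘(ℝ, V) V))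
    (hf : MDifferentiableAt 𝓘(ℝ, V) I' (fun y => f (m, y)) y) :
    HasVelocity (fun r => f (m, c r)) s t (partialTangentMap I' f (m, y, w)) :=
  hc.comp hf

theorem partialTangentMap_eq_tangentMap {f : M × V → N} {m : M} {y w : V}
    (hf : MDifferentiableAt (I.prod 𝓘(ℝ, V)) I' f (m, y)) :
    partialTangentMap I' f (m, y, w) = tangentMap (I.prod 𝓘(ℝ, V)) I' f
      ((equivTangentBundleProd I M 𝓘(ℝ, V) V).symm (⟨m, 0⟩, ⟨y, w⟩)) := by
  have h1 : HasVelocity (fun r : ℝ => y + r • w) univ 0 (⟨y, w⟩ : TangentBundle 𝓘(ℝ, V) V) :=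
    HasVelocity.line y w
  have h2 : HasVelocity (fun _ : ℝ => m) univ 0 (⟨m, 0⟩ : TangentBundle I M) :=
    HasVelocity.const m
  have h3 : MDifferentiableAt 𝓘(ℝ, V) I' (fun y => f (m, y)) y :=
    hf.comp y (mdifferentiableAt_const.prodMk mdifferentiableAt_id)
  exact (h1.comp_partial h3).unique ((h2.prodMk h1).comp hf) uniqueDiffWithinAt_univ

theorem contMDiff_tangentBundle_mk_vectorSpace :
    ContMDiff (𝓘(ℝ, V).prod 𝓘(ℝ, V)) 𝓘(ℝ, V).tangent ∞
      (fun z : V × V => (⟨z.1, z.2⟩ : TangentBundle 𝓘(ℝ, V) V)) := by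
  intro z
  rw [Bundle.contMDiffAt_totalSpace]
  refine ⟨contMDiffAt_fst, ?_⟩
  convert contMDiffAt_snd (I := 𝓘(ℝ, V)) (J := 𝓘(ℝ, V)) (n := ∞) (p := z) using 1
  ext z
  simp

theorem ContMDiffOn.partialTangentMap [IsManifold I ∞ M] [IsManifold I' ∞ N] {f : M × V → N}
    {W : Set (M × V)} (hW : IsOpen W) (hf : ContMDiffOn (I.prod 𝓘(ℝ, V)) I' ∞ f W) :
    ContMDiffOn (I.prod (𝓘(ℝ, V).prod 𝓘(ℝ, V))) I'.tangent ∞ (partialTangentMap I' f)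
      {z | (z.1, z.2.1) ∈ W} := by
  have h1 : ContMDiff (I.prod (𝓘(ℝ, V).prod 𝓘(ℝ, V))) (I.tangent.prod 𝓘(ℝ, V).tangent) ∞
      (fun z : M × V × V => ((⟨z.1, 0⟩ : TangentBundle I M),
        (⟨z.2.1, z.2.2⟩ : TangentBundle 𝓘(ℝ, V) V))) :=
    ((Bundle.contMDiff_zeroSection ℝ (TangentSpace I : M → Type _)).comp contMDiff_fst).prodMk
      (contMDiff_tangentBundle_mk_vectorSpace.comp contMDiff_snd)
  have h2 := (contMDiff_equivTangentBundleProd_symm (n := ∞) (I := I) (M := M)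
    (I' := 𝓘(ℝ, V)) (M' := V)).comp h1
  have h3 := hf.contMDiffOn_tangentMapWithin (m := ∞) (by simp) hW.uniqueMDiffOn
  have h5 := h3.comp (s := {z : M × V × V | (z.1, z.2.1) ∈ W}) h2.contMDiffOn fun z hz => hz
  refine h5.congr ?_
  rintro ⟨m, y, w⟩ hz
  have h4 : MDifferentiableAt (I.prod 𝓘(ℝ, V)) I' f (m, y) :=
    (hf.contMDiffAt (hW.mem_nhds hz)).mdifferentiableAt (by simp)
  rw [partialTangentMap_eq_tangentMap h4]
  exact (tangentMapWithin_eq_tangentMap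
    (p := (equivTangentBundleProd I M 𝓘(ℝ, V) V).symm (⟨m, 0⟩, ⟨y, w⟩))
    (hW.uniqueMDiffOn (m, y) hz) h4).symm

end Velocity

/-! ### Fibred charts of a submersion -/

section FibredChart

variable {E : Type u} {F G Q : Type*}
  [NormedAddCommGroup E] [NormedSpace ℝ E] [NormedAddCommGroup F] [NormedSpace ℝ F]
  [TopologicalSpace G] [ChartedSpace E G] [TopologicalSpace Q] [ChartedSpace F Q]

/-- A local trivialization of a map `α : G → Q`: a diffeomorphism from the open set `dom ⊆ G` onto
the open set `img ⊆ Q × V` of the form `k ↦ (α k, y k)`, with inverse `κ`. -/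
structure FibredChart (E F V : Type*) {G Q : Type*}
    [NormedAddCommGroup E] [NormedSpace ℝ E] [NormedAddCommGroup F] [NormedSpace ℝ F]
    [TopologicalSpace G] [ChartedSpace E G] [TopologicalSpace Q] [ChartedSpace F Q]
    [NormedAddCommGroup V] [NormedSpace ℝ V] (α : G → Q) where
  dom : Set G
  img : Set (Q × V)
  κ : Q × V → G
  y : G → V
  isOpen_dom : IsOpen dom
  isOpen_img : IsOpen img
  contMDiffOn_κ : ContMDiffOn (𝓘(ℝ, F).prod 𝓘(ℝ, V)) 𝓘(ℝ, E) ∞ κ img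
  contMDiffOn_y : ContMDiffOn 𝓘(ℝ, E) 𝓘(ℝ, V) ∞ y dom
  κ_mem : ∀ {p}, p ∈ img → κ p ∈ dom
  α_κ : ∀ {p}, p ∈ img → α (κ p) = p.1
  y_κ : ∀ {p}, p ∈ img → y (κ p) = p.2
  mem_img : ∀ {k}, k ∈ dom → (α k, y k) ∈ img
  κ_y : ∀ {k}, k ∈ dom → κ (α k, y k) = k

theorem Manifold.IsSubmersionAt.exists_fibredChart [FiniteDimensional ℝ E]
    [IsManifold 𝓘(ℝ, E) ∞ G] [IsManifold 𝓘(ℝ, F) ∞ Q] {α : G → Q} {k₀ : G}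
    (h : Manifold.IsSubmersionAt 𝓘(ℝ, E) 𝓘(ℝ, F) ∞ α k₀) :
    ∃ (V : Type u) (_ : NormedAddCommGroup V) (_ : NormedSpace ℝ V) (ch : FibredChart E F V α),
      FiniteDimensional ℝ V ∧ k₀ ∈ ch.dom := by
  let L := h.equiv
  let e := h.domChart
  let f := h.codChart
  have hfin : FiniteDimensional ℝ h.complement :=
    FiniteDimensional.of_injective
      ((L.symm : F × h.complement →L[ℝ] E).comp
        (ContinuousLinearMap.inr ℝ F h.complement)).toLinearMap
      (L.symm.injective.comp (Prod.mk_right_injective 0))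
  have hw : ∀ z ∈ e.target, f (α (e.symm z)) = (L z).1 := fun z hz => by
    have h0 := h.writtenInCharts
    have h1 := h0 (x := z) (by simpa [e] using hz)
    simpa using h1
  have hsub : ∀ k ∈ e.source, α k ∈ f.source := fun k hk => h.source_subset_preimage_source hk
  have he := contMDiffOn_of_mem_maximalAtlas h.domChart_mem_maximalAtlas
  have he' := contMDiffOn_symm_of_mem_maximalAtlas h.domChart_mem_maximalAtlas
  have hf := contMDiffOn_of_mem_maximalAtlas h.codChart_mem_maximalAtlas
  have hfe : ∀ k ∈ e.source, L.symm (f (α k), (L (e k)).2) = e k := fun k hk => by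
    have h1 := hw (e k) (e.map_source hk)
    rw [e.left_inv hk] at h1
    rw [h1, Prod.mk.eta, L.symm_apply_apply]
  let S : Set (Q × h.complement) := Prod.fst ⁻¹' f.source
  have hS : IsOpen S := f.open_source.preimage continuous_fst
  let T : Q × h.complement → E := fun p => L.symm (f p.1, p.2)
  have hT : ContMDiffOn (𝓘(ℝ, F).prod 𝓘(ℝ, h.complement)) 𝓘(ℝ, E) ∞ T S := by
    have h1 : ContMDiffOn (𝓘(ℝ, F).prod 𝓘(ℝ, h.complement)) 𝓘(ℝ, F × h.complement) ∞
        (fun p : Q × h.complement => (f p.1, p.2)) S :=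
      ContMDiffOn.prodMk_space (hf.comp contMDiff_fst.contMDiffOn fun p hp => hp)
        contMDiff_snd.contMDiffOn
    exact L.symm.contDiff.contMDiff.comp_contMDiffOn h1
  refine ⟨h.complement, inferInstance, inferInstance,
    { dom := e.source
      img := S ∩ T ⁻¹' e.target
      κ := fun p => e.symm (T p)
      y := fun k => (L (e k)).2
      isOpen_dom := e.open_source
      isOpen_img := hT.continuousOn.isOpen_inter_preimage hS e.open_target
      contMDiffOn_κ := he'.comp (hT.mono inter_subset_left) fun p hp => hp.2
      contMDiffOn_y := (contDiff_snd.comp L.contDiff).contMDiff.comp_contMDiffOn he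
      κ_mem := fun hp => e.map_target hp.2
      α_κ := fun {p} hp => by
        have h1 := hw _ hp.2
        refine f.injOn (hsub _ (e.map_target hp.2)) hp.1 (h1.trans ?_)
        simp [T]
      y_κ := fun {p} hp => by
        rw [e.right_inv hp.2]
        simp [T]
      mem_img := fun {k} hk => ⟨hsub k hk, by
        change L.symm _ ∈ e.target
        rw [hfe k hk]
        exact e.map_source hk⟩
      κ_y := fun {k} hk => by
        change e.symm (L.symm _) = k
        rw [hfe k hk, e.left_inv hk] }, hfin, h.mem_domChart_source⟩

namespace FibredChart

variable {V : Type*} [NormedAddCommGroup V] [NormedSpace ℝ V] {α : G → Q}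
  (ch : FibredChart E F V α)

/-- The derivative of the fibre coordinate `y`, as a function on the tangent bundle. -/
noncomputable def dy (v : TangentBundle 𝓘(ℝ, E) G) : V :=
  (tangentMap 𝓘(ℝ, E) 𝓘(ℝ, V) ch.y v).2

theorem mdifferentiableAt_y {k : G} (hk : k ∈ ch.dom) :
    MDifferentiableAt 𝓘(ℝ, E) 𝓘(ℝ, V) ch.y k :=
  (ch.contMDiffOn_y.contMDiffAt (ch.isOpen_dom.mem_nhds hk)).mdifferentiableAt (by simp)

theorem mdifferentiableAt_κ {p : Q × V} (hp : p ∈ ch.img) :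
    MDifferentiableAt (𝓘(ℝ, F).prod 𝓘(ℝ, V)) 𝓘(ℝ, E) ch.κ p :=
  (ch.contMDiffOn_κ.contMDiffAt (ch.isOpen_img.mem_nhds hp)).mdifferentiableAt (by simp)

theorem mdifferentiableAt_κ_right {q : Q} {y : V} (hp : (q, y) ∈ ch.img) :
    MDifferentiableAt 𝓘(ℝ, V) 𝓘(ℝ, E) (fun y => ch.κ (q, y)) y :=
  (ch.mdifferentiableAt_κ hp).comp y (mdifferentiableAt_const.prodMk mdifferentiableAt_id)

theorem hasDerivWithinAt_y {c : ℝ → G} {s : Set ℝ} {t : ℝ} {v : TangentBundle 𝓘(ℝ, E) G}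
    (h : HasVelocity c s t v) (hv : v.proj ∈ ch.dom) :
    HasDerivWithinAt (fun r => ch.y (c r)) (ch.dy v) s t :=
  (h.comp (ch.mdifferentiableAt_y hv)).hasDerivWithinAt

theorem contMDiffOn_dy [IsManifold 𝓘(ℝ, E) ∞ G] :
    ContMDiffOn 𝓘(ℝ, E).tangent 𝓘(ℝ, V) ∞ ch.dy {v | v.proj ∈ ch.dom} := by
  have h1 := ch.contMDiffOn_y.contMDiffOn_tangentMapWithin (m := ∞) (by simp)
    ch.isOpen_dom.uniqueMDiffOn
  refine ((contMDiff_snd_tangentBundle_modelSpace V 𝓘(ℝ, V)).comp_contMDiffOn h1).congr ?_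
  intro v hv
  exact (congrArg (fun p : TangentBundle 𝓘(ℝ, V) V => (p.2 : V))
    (tangentMapWithin_eq_tangentMap (ch.isOpen_dom.uniqueMDiffOn _ hv)
      (ch.mdifferentiableAt_y hv))).symm

theorem mdifferentiableAt_dy [IsManifold 𝓘(ℝ, E) ∞ G] {v : TangentBundle 𝓘(ℝ, E) G}
    (hv : v.proj ∈ ch.dom) : MDifferentiableAt 𝓘(ℝ, E).tangent 𝓘(ℝ, V) ch.dy v :=
  (ch.contMDiffOn_dy.contMDiffAt ((ch.isOpen_dom.preimage
    (FiberBundle.continuous_proj E (TangentSpace 𝓘(ℝ, E)))).mem_nhds hv)).mdifferentiableAt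
    (by simp)

end FibredChart

/-- A curve along which `α` is constant has velocity in the kernel of `Tα`. -/
theorem mfderiv_eq_zero_of_hasVelocity {α : G → Q} {c : ℝ → G} {s : Set ℝ} {t : ℝ}
    {v : TangentBundle 𝓘(ℝ, E) G} (h : HasVelocity c s t v) (hs : UniqueDiffWithinAt ℝ s t)
    (hα : MDifferentiableAt 𝓘(ℝ, E) 𝓘(ℝ, F) α v.proj)
    (hc : ∀ᶠ r in 𝓝[s] t, α (c r) = α v.proj) :
    mfderiv 𝓘(ℝ, E) 𝓘(ℝ, F) α v.proj v.snd = 0 := by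
  have h1 : HasVelocity (fun r => α (c r)) s t (⟨α v.proj, 0⟩ : TangentBundle 𝓘(ℝ, F) Q) :=
    (HasVelocity.const (α v.proj)).congr_of_eventuallyEq hc (by rw [h.1])
  have h2 := (h.comp hα).unique h1 hs
  exact eq_of_heq (Bundle.TotalSpace.mk.inj h2).2

theorem tangentMap_of_mfderiv_eq_zero {α : G → Q} {v : TangentBundle 𝓘(ℝ, E) G}
    (h : mfderiv 𝓘(ℝ, E) 𝓘(ℝ, F) α v.proj v.snd = 0) :
    tangentMap 𝓘(ℝ, E) 𝓘(ℝ, F) α v = ⟨α v.proj, 0⟩ := by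
  rw [← h]
  rfl

namespace FibredChart

variable {V : Type*} [NormedAddCommGroup V] [NormedSpace ℝ V] {α : G → Q}
  (ch : FibredChart E F V α)

/-- A vector tangent to the fibres of `α` is determined by its foot and by `dy`. -/
theorem partialTangentMap_κ_dy [IsManifold 𝓘(ℝ, E) ∞ G] (hα : ContMDiff 𝓘(ℝ, E) 𝓘(ℝ, F) ∞ α)
    {v : TangentBundle 𝓘(ℝ, E) G} (hv : v.proj ∈ ch.dom)
    (h : mfderiv 𝓘(ℝ, E) 𝓘(ℝ, F) α v.proj v.snd = 0) :
    partialTangentMap 𝓘(ℝ, E) ch.κ (α v.proj, ch.y v.proj, ch.dy v) = v := by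
  obtain ⟨δ, hδ, c, -, hc⟩ := exists_curve_hasVelocity v
  have hαc := hc.comp (I' := 𝓘(ℝ, F)) (hα.mdifferentiableAt (by simp))
  rw [tangentMap_of_mfderiv_eq_zero h] at hαc
  have hyc := hc.comp (ch.mdifferentiableAt_y hv)
  have h1 := (hαc.prodMk hyc).comp (ch.mdifferentiableAt_κ (ch.mem_img hv))
  have h2 : HasVelocity (fun r => ch.κ (α (c r), ch.y (c r))) univ 0 v := by
    refine hc.congr_of_eventuallyEq ?_ ?_
    · rw [nhdsWithin_univ]
      have hcc : ContinuousAt c 0 := (continuousWithinAt_univ c 0).1 hc.continuousWithinAt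
      filter_upwards [hcc.preimage_mem_nhds (ch.isOpen_dom.mem_nhds (by rwa [hc.1]))] with r hr
      exact ch.κ_y hr
    · rw [hc.1]
      exact ch.κ_y hv
  rw [partialTangentMap_eq_tangentMap (ch.mdifferentiableAt_κ (ch.mem_img hv))]
  exact h1.unique h2 uniqueDiffWithinAt_univ

variable {q : Q} {y w : V}

theorem hasVelocity_κ (hp : (q, y) ∈ ch.img) {c : ℝ → V} {s : Set ℝ} {t : ℝ}
    (hc : HasVelocity c s t (⟨y, w⟩ : TangentBundle 𝓘(ℝ, V) V)) :
    HasVelocity (fun r => ch.κ (q, c r)) s t (partialTangentMap 𝓘(ℝ, E) ch.κ (q, y, w)) :=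
  hc.comp_partial (ch.mdifferentiableAt_κ_right hp)

/-- The set of times for which the line `y + t • w` stays in the fibred chart over `q`. -/
def lineTimes (q : Q) (y w : V) : Set ℝ := {t | (q, y + t • w) ∈ ch.img}

theorem isOpen_lineTimes : IsOpen (ch.lineTimes q y w) :=
  ch.isOpen_img.preimage (f := fun t : ℝ => (q, y + t • w)) (by fun_prop)

theorem zero_mem_lineTimes (hp : (q, y) ∈ ch.img) : (0 : ℝ) ∈ ch.lineTimes q y w := by
  simpa [lineTimes] using hp

theorem uniqueDiffWithinAt_lineTimes (hp : (q, y) ∈ ch.img) :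
    UniqueDiffWithinAt ℝ (ch.lineTimes q y w) 0 :=
  ch.isOpen_lineTimes.uniqueDiffOn _ (ch.zero_mem_lineTimes hp)

theorem mfderiv_partialTangentMap_κ (hα : ContMDiff 𝓘(ℝ, E) 𝓘(ℝ, F) ∞ α) (hp : (q, y) ∈ ch.img) :
    mfderiv 𝓘(ℝ, E) 𝓘(ℝ, F) α (partialTangentMap 𝓘(ℝ, E) ch.κ (q, y, w)).proj
      (partialTangentMap 𝓘(ℝ, E) ch.κ (q, y, w)).snd = 0 := by
  refine mfderiv_eq_zero_of_hasVelocity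
    (ch.hasVelocity_κ hp (HasVelocity.line (s := ch.lineTimes q y w) y w))
    (ch.uniqueDiffWithinAt_lineTimes hp) (hα.mdifferentiableAt (by simp)) ?_
  filter_upwards [self_mem_nhdsWithin] with r hr
  exact (ch.α_κ hr).trans (ch.α_κ hp).symm

theorem dy_partialTangentMap_κ (hp : (q, y) ∈ ch.img) :
    ch.dy (partialTangentMap 𝓘(ℝ, E) ch.κ (q, y, w)) = w := by
  have h1 := ch.hasDerivWithinAt_y
    (ch.hasVelocity_κ hp (HasVelocity.line (s := ch.lineTimes q y w) y w)) (ch.κ_mem hp)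
  have h2 : HasDerivWithinAt (fun r : ℝ => y + r • w) w (ch.lineTimes q y w) 0 :=
    (HasVelocity.line y w).hasDerivWithinAt
  refine (ch.uniqueDiffWithinAt_lineTimes hp).eq_deriv _ h1 (h2.congr_of_mem ?_ ?_)
  · exact fun r hr => ch.y_κ hr
  · exact ch.zero_mem_lineTimes hp

end FibredChart

end FibredChart

/-! ### Left translation on the vertical bundle -/

namespace LieGroupoid

variable {E : Type u} {F G Q : Type*}
  [NormedAddCommGroup E] [NormedSpace ℝ E] [NormedAddCommGroup F] [NormedSpace ℝ F]
  [TopologicalSpace G] [ChartedSpace E G] [IsManifold 𝓘(ℝ, E) ∞ G]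
  [TopologicalSpace Q] [ChartedSpace F Q] [IsManifold 𝓘(ℝ, F) ∞ Q]
  (𝒢 : LieGroupoid E F G Q)

theorem contMDiff_α : ContMDiff 𝓘(ℝ, E) 𝓘(ℝ, F) ∞ 𝒢.α := 𝒢.submersion_α.contMDiff

theorem contMDiff_β : ContMDiff 𝓘(ℝ, E) 𝓘(ℝ, F) ∞ 𝒢.β := 𝒢.submersion_β.contMDiff

theorem inv_mul_cancel_left {g k : G} (h : 𝒢.β g = 𝒢.α k) :
    𝒢.mul (𝒢.inv g) (𝒢.mul g k) = k := by
  rw [𝒢.mul_assoc _ _ _ (𝒢.β_inv g) h, 𝒢.inv_mul, h, 𝒢.ε_mul]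

theorem mul_inv_cancel_left {g k : G} (h : 𝒢.α k = 𝒢.α g) :
    𝒢.mul g (𝒢.mul (𝒢.inv g) k) = k := by
  rw [𝒢.mul_assoc _ _ _ (𝒢.α_inv g).symm ((𝒢.β_inv g).trans h.symm), 𝒢.mul_inv, ← h, 𝒢.ε_mul]

theorem α_inv_mul {g k : G} (h : 𝒢.α k = 𝒢.α g) : 𝒢.α (𝒢.mul (𝒢.inv g) k) = 𝒢.β g := by
  rw [𝒢.α_mul _ _ ((𝒢.β_inv g).trans h.symm), 𝒢.α_inv]

theorem β_inv_mul {g k : G} (h : 𝒢.α k = 𝒢.α g) : 𝒢.β (𝒢.mul (𝒢.inv g) k) = 𝒢.β k :=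
  𝒢.β_mul _ _ ((𝒢.β_inv g).trans h.symm)

theorem exists_fibredChart [FiniteDimensional ℝ E] (k₀ : G) :
    ∃ (V : Type u) (_ : NormedAddCommGroup V) (_ : NormedSpace ℝ V) (ch : FibredChart E F V 𝒢.α),
      FiniteDimensional ℝ V ∧ k₀ ∈ ch.dom :=
  (𝒢.submersion_α.isSubmersionAt k₀).exists_fibredChart

/-- Vertical vectors are the velocities of curves in the fibres of `α`. -/
theorem exists_curve_of_mem_vertical [FiniteDimensional ℝ E] {v : TangentBundle 𝓘(ℝ, E) G}
    (hv : v ∈ 𝒢.vertical) : ∃ s : Set ℝ, IsOpen s ∧ (0 : ℝ) ∈ s ∧ ∃ c : ℝ → G,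
      HasVelocity c s 0 v ∧ ∀ r ∈ s, 𝒢.α (c r) = 𝒢.α v.proj := by
  obtain ⟨V, _, _, ch, -, hdom⟩ := 𝒢.exists_fibredChart v.proj
  have hp := ch.mem_img hdom
  refine ⟨ch.lineTimes (𝒢.α v.proj) (ch.y v.proj) (ch.dy v), ch.isOpen_lineTimes,
    ch.zero_mem_lineTimes hp, _, ?_, fun r hr => ch.α_κ hr⟩
  have h1 := ch.hasVelocity_κ hp (HasVelocity.line
    (s := ch.lineTimes (𝒢.α v.proj) (ch.y v.proj) (ch.dy v)) (ch.y v.proj) (ch.dy v))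
  rwa [ch.partialTangentMap_κ_dy 𝒢.contMDiff_α hdom hv] at h1

theorem mem_vertical_of_hasVelocity {c : ℝ → G} {s : Set ℝ} {t : ℝ}
    {v : TangentBundle 𝓘(ℝ, E) G} (h : HasVelocity c s t v) (hs : UniqueDiffWithinAt ℝ s t)
    (hc : ∀ r ∈ s, 𝒢.α (c r) = 𝒢.α v.proj) : v ∈ 𝒢.vertical :=
  mfderiv_eq_zero_of_hasVelocity h hs (𝒢.contMDiff_α.mdifferentiableAt (by simp))
    (by filter_upwards [self_mem_nhdsWithin] with r hr using hc r hr)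

theorem Ψ_proj (v : TangentBundle 𝓘(ℝ, E) G) : (𝒢.Ψ v).proj = 𝒢.ε (𝒢.β v.proj) :=
  𝒢.inv_mul v.proj

/-- `Ψ` maps the velocity of a curve in an `α`-fibre to the velocity of the left translate of the
curve. -/
theorem hasVelocity_Ψ {v : TangentBundle 𝓘(ℝ, E) G} {c : ℝ → G} {s : Set ℝ} {t : ℝ}
    (h : HasVelocity c s t v) (hc : ∀ r ∈ s, 𝒢.α (c r) = 𝒢.α v.proj) :
    HasVelocity (fun r => 𝒢.mul (𝒢.inv v.proj) (c r)) s t (𝒢.Ψ v) := by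
  refine h.comp_within (S := 𝒢.α ⁻¹' {𝒢.α v.proj}) ?_ hc
  have h1 : ContMDiffOn 𝓘(ℝ, E) 𝓘(ℝ, E) ∞ (fun k => 𝒢.mul (𝒢.inv v.proj) k)
      (𝒢.α ⁻¹' {𝒢.α v.proj}) :=
    𝒢.smooth_mul.comp (contMDiff_const.prodMk contMDiff_id).contMDiffOn fun k hk => by
      change 𝒢.β (𝒢.inv v.proj) = 𝒢.α k
      rw [𝒢.β_inv]
      exact hk.symm
  exact (h1 v.proj rfl).mdifferentiableWithinAt (by simp)

theorem Ψ_mem_algebroid [FiniteDimensional ℝ E] {v : TangentBundle 𝓘(ℝ, E) G}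
    (hv : v ∈ 𝒢.vertical) : 𝒢.Ψ v ∈ 𝒢.algebroid := by
  refine ⟨?_, 𝒢.β v.proj, (𝒢.Ψ_proj v).symm⟩
  obtain ⟨s, hs, h0, c, hc, hα⟩ := 𝒢.exists_curve_of_mem_vertical hv
  refine 𝒢.mem_vertical_of_hasVelocity (𝒢.hasVelocity_Ψ hc hα) (hs.uniqueDiffOn 0 h0)
    fun r hr => ?_
  rw [𝒢.α_inv_mul (hα r hr), 𝒢.Ψ_proj, 𝒢.α_ε]

/-- The anchors of `Vα` and `AG` are compatible: `Tβ ∘ Ψ = Tβ` on `Vα`. -/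
theorem anchor_Ψ [FiniteDimensional ℝ E] {v : TangentBundle 𝓘(ℝ, E) G}
    (hv : v ∈ 𝒢.vertical) : 𝒢.anchor (𝒢.Ψ v) = tangentMap 𝓘(ℝ, E) 𝓘(ℝ, F) 𝒢.β v := by
  obtain ⟨s, hs, h0, c, hc, hα⟩ := 𝒢.exists_curve_of_mem_vertical hv
  have h1 := (𝒢.hasVelocity_Ψ hc hα).comp (I' := 𝓘(ℝ, F))
    (𝒢.contMDiff_β.mdifferentiableAt (by simp))
  have h2 := hc.comp (I' := 𝓘(ℝ, F)) (𝒢.contMDiff_β.mdifferentiableAt (by simp))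
  exact h1.unique (h2.congr (fun r hr => 𝒢.β_inv_mul (hα r hr)) h0) (hs.uniqueDiffOn 0 h0)

section Chart

variable {V : Type*} [NormedAddCommGroup V] [NormedSpace ℝ V] (ch : FibredChart E F V 𝒢.α)

/-- In a fibred chart at its foot, a vertical vector can be left translated by a formula which makes
sense, and is smooth, on an open set of tangent vectors. -/
theorem Ψ_eq_partialTangentMap {v : TangentBundle 𝓘(ℝ, E) G} (hv : v ∈ 𝒢.vertical)
    (hdom : v.proj ∈ ch.dom)
    (hd : MDifferentiableAt 𝓘(ℝ, V) 𝓘(ℝ, E)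
      (fun y => 𝒢.mul (𝒢.inv v.proj) (ch.κ (𝒢.α v.proj, y))) (ch.y v.proj)) :
    𝒢.Ψ v = partialTangentMap 𝓘(ℝ, E)
      (fun p : G × V => 𝒢.mul (𝒢.inv p.1) (ch.κ (𝒢.α p.1, p.2)))
      (v.proj, ch.y v.proj, ch.dy v) := by
  have hp := ch.mem_img hdom
  have h0 := HasVelocity.line
    (s := ch.lineTimes (𝒢.α v.proj) (ch.y v.proj) (ch.dy v)) (ch.y v.proj) (ch.dy v)
  have h1 := ch.hasVelocity_κ hp h0
  rw [ch.partialTangentMap_κ_dy 𝒢.contMDiff_α hdom hv] at h1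
  have h2 := 𝒢.hasVelocity_Ψ h1 fun r hr => ch.α_κ hr
  have h3 := HasVelocity.comp_partial (I' := 𝓘(ℝ, E)) (m := v.proj)
    (f := fun p : G × V => 𝒢.mul (𝒢.inv p.1) (ch.κ (𝒢.α p.1, p.2))) h0 hd
  exact h2.unique h3 (ch.uniqueDiffWithinAt_lineTimes hp)

theorem contMDiffOn_inv_mul_κ :
    ContMDiffOn (𝓘(ℝ, E).prod 𝓘(ℝ, V)) 𝓘(ℝ, E) ∞
      (fun p : G × V => 𝒢.mul (𝒢.inv p.1) (ch.κ (𝒢.α p.1, p.2)))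
      {p | (𝒢.α p.1, p.2) ∈ ch.img} := by
  have h1 : ContMDiff (𝓘(ℝ, E).prod 𝓘(ℝ, V)) (𝓘(ℝ, F).prod 𝓘(ℝ, V)) ∞
      (fun p : G × V => (𝒢.α p.1, p.2)) :=
    (𝒢.contMDiff_α.comp contMDiff_fst).prodMk contMDiff_snd
  refine 𝒢.smooth_mul.comp ((𝒢.smooth_inv.comp contMDiff_fst).contMDiffOn.prodMk
    (ch.contMDiffOn_κ.comp h1.contMDiffOn fun p hp => hp)) fun p hp => ?_
  change 𝒢.β (𝒢.inv p.1) = 𝒢.α (ch.κ _)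
  rw [𝒢.β_inv, ch.α_κ hp]

/-- Left translation by `g` of the fibre of `α` over `β g`, seen in a fibred chart: the map
`(g, y) ↦ g κ(β g, y)`. -/
def leftMul (p : G × V) : G := 𝒢.mul p.1 (ch.κ (𝒢.β p.1, p.2))

theorem isOpen_leftMul_domain : IsOpen {p : G × V | (𝒢.β p.1, p.2) ∈ ch.img} :=
  ch.isOpen_img.preimage (f := fun p : G × V => (𝒢.β p.1, p.2))
    ((𝒢.contMDiff_β.continuous.comp continuous_fst).prodMk continuous_snd)

theorem contMDiffOn_leftMul :
    ContMDiffOn (𝓘(ℝ, E).prod 𝓘(ℝ, V)) 𝓘(ℝ, E) ∞ (𝒢.leftMul ch)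
      {p | (𝒢.β p.1, p.2) ∈ ch.img} := by
  have h1 : ContMDiff (𝓘(ℝ, E).prod 𝓘(ℝ, V)) (𝓘(ℝ, F).prod 𝓘(ℝ, V)) ∞
      (fun p : G × V => (𝒢.β p.1, p.2)) :=
    (𝒢.contMDiff_β.comp contMDiff_fst).prodMk contMDiff_snd
  refine 𝒢.smooth_mul.comp (contMDiff_fst.contMDiffOn.prodMk
    (ch.contMDiffOn_κ.comp h1.contMDiffOn fun p hp => hp)) fun p hp => ?_
  exact (ch.α_κ hp).symm

/-- The frame of `AG` given by a fibred chart: the vector of `A_q G` with fibre coordinate `w`. -/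
noncomputable def algebroidFrame (p : Q × V) : TangentBundle 𝓘(ℝ, E) G :=
  partialTangentMap 𝓘(ℝ, E) ch.κ (p.1, ch.y (𝒢.ε p.1), p.2)

/-- The frame of `Vα` obtained from `algebroidFrame` by left translation: the vertical vector at `g`
whose image by `Ψ` is the vector of `A_{β g} G` with fibre coordinate `w`. -/
noncomputable def leftFrame (p : G × V) : TangentBundle 𝓘(ℝ, E) G :=
  partialTangentMap 𝓘(ℝ, E) (𝒢.leftMul ch) (p.1, ch.y (𝒢.ε (𝒢.β p.1)), p.2)

/-- The open set of those `g` for which the unit `ε (β g)` lies in the fibred chart. -/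
def leftDom : Set G := {g | 𝒢.ε (𝒢.β g) ∈ ch.dom}

theorem isOpen_leftDom : IsOpen (𝒢.leftDom ch) :=
  ch.isOpen_dom.preimage (𝒢.smooth_ε.continuous.comp 𝒢.contMDiff_β.continuous)

variable {ch}

theorem mem_img_of_unit {q : Q} (hq : 𝒢.ε q ∈ ch.dom) : (q, ch.y (𝒢.ε q)) ∈ ch.img := by
  simpa [𝒢.α_ε] using ch.mem_img hq

theorem κ_unit {q : Q} (hq : 𝒢.ε q ∈ ch.dom) : ch.κ (q, ch.y (𝒢.ε q)) = 𝒢.ε q := by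
  simpa [𝒢.α_ε] using ch.κ_y hq

theorem algebroidFrame_proj {q : Q} (hq : 𝒢.ε q ∈ ch.dom) (w : V) :
    (𝒢.algebroidFrame ch (q, w)).proj = 𝒢.ε q := 𝒢.κ_unit hq

theorem algebroidFrame_mem {q : Q} (hq : 𝒢.ε q ∈ ch.dom) (w : V) :
    𝒢.algebroidFrame ch (q, w) ∈ 𝒢.algebroid :=
  ⟨ch.mfderiv_partialTangentMap_κ 𝒢.contMDiff_α (𝒢.mem_img_of_unit hq),
    q, (𝒢.algebroidFrame_proj hq w).symm⟩

theorem dy_algebroidFrame {q : Q} (hq : 𝒢.ε q ∈ ch.dom) (w : V) :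
    ch.dy (𝒢.algebroidFrame ch (q, w)) = w :=
  ch.dy_partialTangentMap_κ (𝒢.mem_img_of_unit hq)

theorem algebroidFrame_dy {a : TangentBundle 𝓘(ℝ, E) G} (ha : a ∈ 𝒢.algebroid)
    (hdom : a.proj ∈ ch.dom) : 𝒢.algebroidFrame ch (𝒢.α a.proj, ch.dy a) = a := by
  have h1 : 𝒢.ε (𝒢.α a.proj) = a.proj := by
    obtain ⟨q, hq⟩ := ha.2
    rw [← hq, 𝒢.α_ε]
  rw [algebroidFrame, h1]
  exact ch.partialTangentMap_κ_dy 𝒢.contMDiff_α hdom ha.1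

theorem leftFrame_proj {g : G} (hg : g ∈ 𝒢.leftDom ch) (w : V) :
    (𝒢.leftFrame ch (g, w)).proj = g := by
  change 𝒢.mul g (ch.κ (𝒢.β g, ch.y (𝒢.ε (𝒢.β g)))) = g
  rw [𝒢.κ_unit hg, 𝒢.mul_ε]

theorem hasVelocity_leftMul {g : G} (hg : g ∈ 𝒢.leftDom ch) {w : V} {c : ℝ → V} {s : Set ℝ} {t : ℝ}
    (hc : HasVelocity c s t (⟨ch.y (𝒢.ε (𝒢.β g)), w⟩ : TangentBundle 𝓘(ℝ, V) V)) :
    HasVelocity (fun r => 𝒢.leftMul ch (g, c r)) s t (𝒢.leftFrame ch (g, w)) := by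
  refine hc.comp_partial (m := g) ?_
  have h1 : MDifferentiableAt (𝓘(ℝ, E).prod 𝓘(ℝ, V)) 𝓘(ℝ, E) (𝒢.leftMul ch)
      (g, ch.y (𝒢.ε (𝒢.β g))) :=
    ((𝒢.contMDiffOn_leftMul ch).contMDiffAt ((𝒢.isOpen_leftMul_domain ch).mem_nhds
      (𝒢.mem_img_of_unit hg))).mdifferentiableAt (by simp)
  exact h1.comp _ (mdifferentiableAt_const.prodMk mdifferentiableAt_id)

theorem leftFrame_mem_vertical {g : G} (hg : g ∈ 𝒢.leftDom ch) (w : V) :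
    𝒢.leftFrame ch (g, w) ∈ 𝒢.vertical := by
  have hp := 𝒢.mem_img_of_unit hg
  refine 𝒢.mem_vertical_of_hasVelocity (𝒢.hasVelocity_leftMul hg (HasVelocity.line
    (s := ch.lineTimes (𝒢.β g) (ch.y (𝒢.ε (𝒢.β g))) w) _ w))
    (ch.uniqueDiffWithinAt_lineTimes hp) fun r hr => ?_
  rw [𝒢.leftFrame_proj hg]
  exact 𝒢.α_mul _ _ (ch.α_κ hr).symm

theorem Ψ_leftFrame {g : G} (hg : g ∈ 𝒢.leftDom ch) (w : V) :
    𝒢.Ψ (𝒢.leftFrame ch (g, w)) = 𝒢.algebroidFrame ch (𝒢.β g, w) := by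
  have hp := 𝒢.mem_img_of_unit hg
  have h0 := HasVelocity.line
    (s := ch.lineTimes (𝒢.β g) (ch.y (𝒢.ε (𝒢.β g))) w) (ch.y (𝒢.ε (𝒢.β g))) w
  have h1 := 𝒢.hasVelocity_Ψ (𝒢.hasVelocity_leftMul hg h0) fun r hr => by
    rw [𝒢.leftFrame_proj hg]
    exact 𝒢.α_mul _ _ (ch.α_κ hr).symm
  rw [𝒢.leftFrame_proj hg] at h1
  refine h1.unique ((ch.hasVelocity_κ hp h0).congr (fun r hr => ?_) (ch.zero_mem_lineTimes hp))
    (ch.uniqueDiffWithinAt_lineTimes hp)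
  exact 𝒢.inv_mul_cancel_left (ch.α_κ hr).symm

/-- On `Vα`, the inverse of `leftFrame` is `v ↦ (v.proj, dy (Ψ v))`. -/
theorem leftFrame_dy_Ψ [FiniteDimensional ℝ E] {v : TangentBundle 𝓘(ℝ, E) G}
    (hv : v ∈ 𝒢.vertical) (hdom : v.proj ∈ 𝒢.leftDom ch) :
    𝒢.leftFrame ch (v.proj, ch.dy (𝒢.Ψ v)) = v := by
  obtain ⟨s, hs, h0, c, hc, hα⟩ := 𝒢.exists_curve_of_mem_vertical hv
  have h1 := 𝒢.hasVelocity_Ψ hc hα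
  have hΨdom : (𝒢.Ψ v).proj ∈ ch.dom := by rwa [𝒢.Ψ_proj]
  have h2 := h1.comp (ch.mdifferentiableAt_y hΨdom)
  have h3 : tangentMap 𝓘(ℝ, E) 𝓘(ℝ, V) ch.y (𝒢.Ψ v) =
      ⟨ch.y (𝒢.ε (𝒢.β v.proj)), ch.dy (𝒢.Ψ v)⟩ :=
    Bundle.TotalSpace.ext (congrArg ch.y (𝒢.Ψ_proj v)) HEq.rfl
  rw [h3] at h2
  have h5 : 𝒢.mul (𝒢.inv v.proj) (c 0) = (𝒢.Ψ v).proj := h1.1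
  refine (𝒢.hasVelocity_leftMul hdom h2).unique (hc.congr_of_eventuallyEq ?_ ?_)
    (hs.uniqueDiffOn 0 h0)
  · filter_upwards [self_mem_nhdsWithin, h1.continuousWithinAt.preimage_mem_nhdsWithin
      (ch.isOpen_dom.mem_nhds (by rwa [h5]))] with r hr hr'
    have h4 := ch.κ_y hr'
    rw [𝒢.α_inv_mul (hα r hr)] at h4
    change 𝒢.mul v.proj (ch.κ _) = c r
    rw [h4, 𝒢.mul_inv_cancel_left (hα r hr)]
  · have h4 := ch.κ_y hΨdom
    rw [← h5, 𝒢.α_inv_mul (hα 0 h0)] at h4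
    change 𝒢.mul v.proj (ch.κ _) = c 0
    rw [h4, 𝒢.mul_inv_cancel_left (hα 0 h0)]

/-- At a unit, left translation does nothing. -/
theorem leftFrame_unit {q : Q} (hq : 𝒢.ε q ∈ ch.dom) (w : V) :
    𝒢.leftFrame ch (𝒢.ε q, w) = 𝒢.algebroidFrame ch (q, w) := by
  have hg : 𝒢.ε q ∈ 𝒢.leftDom ch := by simpa [leftDom, 𝒢.β_ε] using hq
  have hp := 𝒢.mem_img_of_unit hq
  have h0 := HasVelocity.line (s := ch.lineTimes q (ch.y (𝒢.ε q)) w) (ch.y (𝒢.ε q)) w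
  refine (𝒢.hasVelocity_leftMul hg (by rw [𝒢.β_ε]; exact h0)).unique
    ((ch.hasVelocity_κ hp h0).congr (fun r hr => ?_) (ch.zero_mem_lineTimes hp))
    (ch.uniqueDiffWithinAt_lineTimes hp)
  change 𝒢.mul (𝒢.ε q) (ch.κ (𝒢.β (𝒢.ε q), _)) = ch.κ (q, _)
  rw [𝒢.β_ε]
  have h1 := 𝒢.ε_mul (ch.κ (q, ch.y (𝒢.ε q) + r • w))
  rwa [ch.α_κ hr] at h1

variable (ch)

theorem contMDiffOn_algebroidFrame :
    ContMDiffOn (𝓘(ℝ, F).prod 𝓘(ℝ, V)) 𝓘(ℝ, E).tangent ∞ (𝒢.algebroidFrame ch)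
      {p | 𝒢.ε p.1 ∈ ch.dom} := by
  have h1 : ContMDiffOn (𝓘(ℝ, F).prod 𝓘(ℝ, V)) (𝓘(ℝ, F).prod (𝓘(ℝ, V).prod 𝓘(ℝ, V))) ∞
      (fun p : Q × V => (p.1, ch.y (𝒢.ε p.1), p.2)) {p | 𝒢.ε p.1 ∈ ch.dom} :=
    contMDiff_fst.contMDiffOn.prodMk ((ch.contMDiffOn_y.comp
      (𝒢.smooth_ε.comp contMDiff_fst).contMDiffOn fun p hp => hp).prodMk contMDiff_snd.contMDiffOn)
  exact (ch.contMDiffOn_κ.partialTangentMap ch.isOpen_img).comp h1 fun p hp => 𝒢.mem_img_of_unit hp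

theorem contMDiffOn_leftFrame :
    ContMDiffOn (𝓘(ℝ, E).prod 𝓘(ℝ, V)) 𝓘(ℝ, E).tangent ∞ (𝒢.leftFrame ch)
      {p | p.1 ∈ 𝒢.leftDom ch} := by
  have h1 : ContMDiffOn (𝓘(ℝ, E).prod 𝓘(ℝ, V)) (𝓘(ℝ, E).prod (𝓘(ℝ, V).prod 𝓘(ℝ, V))) ∞
      (fun p : G × V => (p.1, ch.y (𝒢.ε (𝒢.β p.1)), p.2)) {p | p.1 ∈ 𝒢.leftDom ch} :=
    contMDiff_fst.contMDiffOn.prodMk ((ch.contMDiffOn_y.comp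
      (𝒢.smooth_ε.comp (𝒢.contMDiff_β.comp contMDiff_fst)).contMDiffOn fun p hp => hp).prodMk
        contMDiff_snd.contMDiffOn)
  exact ((𝒢.contMDiffOn_leftMul ch).partialTangentMap (𝒢.isOpen_leftMul_domain ch)).comp h1
    fun p hp => 𝒢.mem_img_of_unit hp

end Chart

theorem contMDiffOn_Ψ [FiniteDimensional ℝ E] :
    ContMDiffOn 𝓘(ℝ, E).tangent 𝓘(ℝ, E).tangent ∞ 𝒢.Ψ 𝒢.vertical := by
  intro v₀ hv₀
  obtain ⟨V, _, _, ch, -, hdom⟩ := 𝒢.exists_fibredChart v₀.proj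
  have hπ : ContMDiff 𝓘(ℝ, E).tangent 𝓘(ℝ, E) ∞ (fun v : TangentBundle 𝓘(ℝ, E) G => v.proj) :=
    Bundle.contMDiff_proj _
  have hO : IsOpen {v : TangentBundle 𝓘(ℝ, E) G | v.proj ∈ ch.dom} :=
    ch.isOpen_dom.preimage hπ.continuous
  have hW : IsOpen {p : G × V | (𝒢.α p.1, p.2) ∈ ch.img} :=
    ch.isOpen_img.preimage (f := fun p : G × V => (𝒢.α p.1, p.2))
      ((𝒢.contMDiff_α.continuous.comp continuous_fst).prodMk continuous_snd)
  have hμ := 𝒢.contMDiffOn_inv_mul_κ ch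
  have h1 : ContMDiffOn 𝓘(ℝ, E).tangent (𝓘(ℝ, E).prod (𝓘(ℝ, V).prod 𝓘(ℝ, V))) ∞
      (fun v : TangentBundle 𝓘(ℝ, E) G => (v.proj, ch.y v.proj, ch.dy v))
      {v | v.proj ∈ ch.dom} :=
    hπ.contMDiffOn.prodMk ((ch.contMDiffOn_y.comp hπ.contMDiffOn fun v hv => hv).prodMk
      ch.contMDiffOn_dy)
  have h2 := (hμ.partialTangentMap hW).comp h1 fun v hv => ch.mem_img hv
  have h3 : ContMDiffWithinAt 𝓘(ℝ, E).tangent 𝓘(ℝ, E).tangent ∞ 𝒢.Ψ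
      (𝒢.vertical ∩ {v | v.proj ∈ ch.dom}) v₀ := by
    refine (h2.mono inter_subset_right v₀ ⟨hv₀, hdom⟩).congr_of_mem ?_ ⟨hv₀, hdom⟩
    intro v hv
    refine 𝒢.Ψ_eq_partialTangentMap ch hv.1 hv.2 ?_
    have h4 : MDifferentiableAt (𝓘(ℝ, E).prod 𝓘(ℝ, V)) 𝓘(ℝ, E)
        (fun p : G × V => 𝒢.mul (𝒢.inv p.1) (ch.κ (𝒢.α p.1, p.2))) (v.proj, ch.y v.proj) :=
      (hμ.contMDiffAt (hW.mem_nhds (ch.mem_img hv.2))).mdifferentiableAt (by simp)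
    exact h4.comp (ch.y v.proj) (mdifferentiableAt_const.prodMk mdifferentiableAt_id)
  exact h3.mono_of_mem_nhdsWithin
    (inter_mem self_mem_nhdsWithin (mem_nhdsWithin_of_mem_nhds (hO.mem_nhds hdom)))

end LieGroupoid

/-! ### The lift of a second order differential equation to the vertical bundle -/

namespace LieGroupoid

variable {E : Type u} {F G Q : Type*}
  [NormedAddCommGroup E] [NormedSpace ℝ E] [NormedAddCommGroup F] [NormedSpace ℝ F]
  [TopologicalSpace G] [ChartedSpace E G] [IsManifold 𝓘(ℝ, E) ∞ G]
  [TopologicalSpace Q] [ChartedSpace F Q] [IsManifold 𝓘(ℝ, F) ∞ Q]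
  (𝒢 : LieGroupoid E F G Q)

section Chart

variable {V : Type*} [NormedAddCommGroup V] [NormedSpace ℝ V] (ch : FibredChart E F V 𝒢.α)
  (Γ : (v : TangentBundle 𝓘(ℝ, E) G) → TangentSpace 𝓘(ℝ, E).tangent v)

/-- The component of the vector field `Γ` in the direction of the fibres of `AG`, in the coordinates
given by a fibred chart. -/
noncomputable def fibreForce (p : Q × V) : V :=
  (tangentMap 𝓘(ℝ, E).tangent 𝓘(ℝ, V) ch.dy
    (⟨𝒢.algebroidFrame ch p, Γ (𝒢.algebroidFrame ch p)⟩ :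
      TangentBundle 𝓘(ℝ, E).tangent (TangentBundle 𝓘(ℝ, E) G))).2

/-- The lift of `Γ` to `Vα` in the coordinates `(g, w) ↦ leftFrame (g, w)`: it is the vector field
`g' = v`, `w' = fibreForce (β g, w)`. -/
noncomputable def liftedField (v : TangentBundle 𝓘(ℝ, E) G) :
    TangentBundle 𝓘(ℝ, E).tangent (TangentBundle 𝓘(ℝ, E) G) :=
  tangentMap (𝓘(ℝ, E).prod 𝓘(ℝ, V)) 𝓘(ℝ, E).tangent (𝒢.leftFrame ch)
    ((equivTangentBundleProd 𝓘(ℝ, E) G 𝓘(ℝ, V) V).symm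
      (v, ⟨ch.dy (𝒢.Ψ v), (𝒢.fibreForce ch Γ (𝒢.β v.proj, ch.dy (𝒢.Ψ v)) : V)⟩))

variable {ch Γ}

theorem isOpen_proj_preimage {O : Set G} (hO : IsOpen O) :
    IsOpen {v : TangentBundle 𝓘(ℝ, E) G | v.proj ∈ O} :=
  hO.preimage (FiberBundle.continuous_proj E (TangentSpace 𝓘(ℝ, E)))

theorem tangentMap_dy_eq {a : TangentBundle 𝓘(ℝ, E) G} (ha : a ∈ 𝒢.algebroid)
    (hdom : a.proj ∈ ch.dom) :
    tangentMap 𝓘(ℝ, E).tangent 𝓘(ℝ, V) ch.dy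
      (⟨a, Γ a⟩ : TangentBundle 𝓘(ℝ, E).tangent (TangentBundle 𝓘(ℝ, E) G)) =
    ⟨ch.dy a, (𝒢.fibreForce ch Γ (𝒢.α a.proj, ch.dy a) : V)⟩ := by
  rw [fibreForce, 𝒢.algebroidFrame_dy ha hdom]
  rfl

theorem tangentMap_dy_Ψ_eq [FiniteDimensional ℝ E] {v : TangentBundle 𝓘(ℝ, E) G}
    (hv : v ∈ 𝒢.vertical) (hdom : v.proj ∈ 𝒢.leftDom ch) :
    tangentMap 𝓘(ℝ, E).tangent 𝓘(ℝ, V) ch.dy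
      (⟨𝒢.Ψ v, Γ (𝒢.Ψ v)⟩ : TangentBundle 𝓘(ℝ, E).tangent (TangentBundle 𝓘(ℝ, E) G)) =
    ⟨ch.dy (𝒢.Ψ v), (𝒢.fibreForce ch Γ (𝒢.β v.proj, ch.dy (𝒢.Ψ v)) : V)⟩ := by
  rw [𝒢.tangentMap_dy_eq (𝒢.Ψ_mem_algebroid hv) (by rw [𝒢.Ψ_proj]; exact hdom), 𝒢.Ψ_proj, 𝒢.α_ε]

theorem contMDiffOn_fibreForce (hΓ : 𝒢.IsAlgebroidSODE Γ) :
    ContMDiffOn (𝓘(ℝ, F).prod 𝓘(ℝ, V)) 𝓘(ℝ, V) ∞ (𝒢.fibreForce ch Γ)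
      {p | 𝒢.ε p.1 ∈ ch.dom} := by
  have hO : IsOpen {v : TangentBundle 𝓘(ℝ, E) G | v.proj ∈ ch.dom} :=
    isOpen_proj_preimage ch.isOpen_dom
  have h1 := ch.contMDiffOn_dy.contMDiffOn_tangentMapWithin (m := ∞) (by simp) hO.uniqueMDiffOn
  have h2 := hΓ.1.1.comp (𝒢.contMDiffOn_algebroidFrame ch)
    fun p hp => 𝒢.algebroidFrame_mem hp p.2
  have h3 : MapsTo ((fun v : TangentBundle 𝓘(ℝ, E) G => (⟨v, Γ v⟩ :
      TangentBundle 𝓘(ℝ, E).tangent (TangentBundle 𝓘(ℝ, E) G))) ∘ 𝒢.algebroidFrame ch)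
      {p | 𝒢.ε p.1 ∈ ch.dom} (Bundle.TotalSpace.proj ⁻¹' {v | v.proj ∈ ch.dom}) := by
    intro p hp
    change (𝒢.algebroidFrame ch p).proj ∈ ch.dom
    rw [𝒢.algebroidFrame_proj hp]
    exact hp
  refine ((contMDiff_snd_tangentBundle_modelSpace V 𝓘(ℝ, V)).comp_contMDiffOn
    (h1.comp h2 h3)).congr ?_
  intro p hp
  have h4 := h3 hp
  exact (congrArg (fun p : TangentBundle 𝓘(ℝ, V) V => (p.2 : V))
    (tangentMapWithin_eq_tangentMap (hO.uniqueMDiffOn _ h4)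
      (ch.mdifferentiableAt_dy h4))).symm

theorem mdifferentiableAt_leftFrame {p : G × V} (hp : p.1 ∈ 𝒢.leftDom ch) :
    MDifferentiableAt (𝓘(ℝ, E).prod 𝓘(ℝ, V)) 𝓘(ℝ, E).tangent (𝒢.leftFrame ch) p :=
  ((𝒢.contMDiffOn_leftFrame ch).contMDiffAt
    (((𝒢.isOpen_leftDom ch).preimage continuous_fst).mem_nhds hp)).mdifferentiableAt (by simp)

/-- The lifted field at `v`, described as the velocity of a curve in the coordinates
`(g, w) ↦ leftFrame (g, w)`. -/
theorem hasVelocity_liftedField [FiniteDimensional ℝ E] {v : TangentBundle 𝓘(ℝ, E) G}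
    (hdom : v.proj ∈ 𝒢.leftDom ch) {c : ℝ → G} {d : ℝ → V} {s : Set ℝ} {t : ℝ}
    (hc : HasVelocity c s t v)
    (hd : HasVelocity d s t (⟨ch.dy (𝒢.Ψ v), (𝒢.fibreForce ch Γ (𝒢.β v.proj, ch.dy (𝒢.Ψ v)) : V)⟩ :
      TangentBundle 𝓘(ℝ, V) V)) :
    HasVelocity (fun r => 𝒢.leftFrame ch (c r, d r)) s t (𝒢.liftedField ch Γ v) :=
  (hc.prodMk hd).comp (𝒢.mdifferentiableAt_leftFrame hdom)

theorem mdifferentiableWithinAt_Ψ [FiniteDimensional ℝ E] {v : TangentBundle 𝓘(ℝ, E) G}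
    (hv : v ∈ 𝒢.vertical) :
    MDifferentiableWithinAt 𝓘(ℝ, E).tangent 𝓘(ℝ, E).tangent 𝒢.Ψ 𝒢.vertical v :=
  (𝒢.contMDiffOn_Ψ v hv).mdifferentiableWithinAt (by simp)

theorem contMDiff_tangentBundle_proj : ContMDiff 𝓘(ℝ, E).tangent 𝓘(ℝ, E) ∞
    (fun v : TangentBundle 𝓘(ℝ, E) G => v.proj) :=
  Bundle.contMDiff_proj _

/-- A vector tangent to `Vα` is determined by its images in `TG` and in `T(AG)`. -/
theorem eq_liftedField [FiniteDimensional ℝ E]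
    {Z : TangentBundle 𝓘(ℝ, E).tangent (TangentBundle 𝓘(ℝ, E) G)}
    {c : ℝ → TangentBundle 𝓘(ℝ, E) G} {s : Set ℝ} {t : ℝ} (hs : UniqueDiffWithinAt ℝ s t)
    (ht : t ∈ s) (hc : HasVelocity c s t Z) (hvert : ∀ r ∈ s, c r ∈ 𝒢.vertical)
    (hdom : Z.proj.proj ∈ 𝒢.leftDom ch)
    (hπ : tangentMap 𝓘(ℝ, E).tangent 𝓘(ℝ, E)
      (fun v : TangentBundle 𝓘(ℝ, E) G => v.proj) Z = Z.proj)
    (hΨ : tangentMapWithin 𝓘(ℝ, E).tangent 𝓘(ℝ, E).tangent 𝒢.Ψ 𝒢.vertical Z =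
      ⟨𝒢.Ψ Z.proj, Γ (𝒢.Ψ Z.proj)⟩) :
    Z = 𝒢.liftedField ch Γ Z.proj := by
  have hZ : Z.proj ∈ 𝒢.vertical := hc.1 ▸ hvert t ht
  have h1 := hc.comp (I' := 𝓘(ℝ, E)) (contMDiff_tangentBundle_proj.mdifferentiableAt (by simp))
  rw [hπ] at h1
  have h2 := hc.comp_within (𝒢.mdifferentiableWithinAt_Ψ hZ) hvert
  rw [hΨ] at h2
  have h3 := h2.comp (ch.mdifferentiableAt_dy
    (by rw [𝒢.Ψ_proj]; exact hdom))
  rw [𝒢.tangentMap_dy_Ψ_eq hZ hdom] at h3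
  refine (hc.congr_of_eventuallyEq ?_ ?_).unique (𝒢.hasVelocity_liftedField hdom h1 h3) hs
  · filter_upwards [self_mem_nhdsWithin, h1.continuousWithinAt.preimage_mem_nhdsWithin
      ((𝒢.isOpen_leftDom ch).mem_nhds (by rwa [hc.1]))] with r hr hr'
    exact 𝒢.leftFrame_dy_Ψ (hvert r hr) hr'
  · exact 𝒢.leftFrame_dy_Ψ (hvert t ht) (by rwa [hc.1])

theorem liftedField_proj [FiniteDimensional ℝ E] {v : TangentBundle 𝓘(ℝ, E) G}
    (hv : v ∈ 𝒢.vertical) (hdom : v.proj ∈ 𝒢.leftDom ch) :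
    (𝒢.liftedField ch Γ v).proj = v :=
  𝒢.leftFrame_dy_Ψ hv hdom

/-- The lifted field is tangent to `Vα`: it is the velocity of a smooth curve in `Vα`, which lies
over a curve in `G` with velocity `v` and has a linear second coordinate. -/
theorem exists_curve_liftedField [FiniteDimensional ℝ E] {v : TangentBundle 𝓘(ℝ, E) G}
    (hdom : v.proj ∈ 𝒢.leftDom ch) :
    ∃ δ > 0, ∃ c : ℝ → G, ∃ d : ℝ → V,
      ContMDiffOn 𝓘(ℝ, ℝ) 𝓘(ℝ, E).tangent ∞ (fun r => 𝒢.leftFrame ch (c r, d r)) (Ioo (-δ) δ) ∧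
      (∀ r ∈ Ioo (-δ) δ, c r ∈ 𝒢.leftDom ch) ∧ HasVelocity c (Ioo (-δ) δ) 0 v ∧
      HasVelocity d (Ioo (-δ) δ) 0
        (⟨ch.dy (𝒢.Ψ v), (𝒢.fibreForce ch Γ (𝒢.β v.proj, ch.dy (𝒢.Ψ v)) : V)⟩ :
          TangentBundle 𝓘(ℝ, V) V) := by
  obtain ⟨δ, hδ, c, hc, hcv⟩ := exists_curve_hasVelocity v
  have hcc : ContinuousAt c 0 := (continuousWithinAt_univ c 0).1 hcv.continuousWithinAt
  obtain ⟨δ', hδ', hsub⟩ := Metric.mem_nhds_iff.1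
    (hcc.preimage_mem_nhds ((𝒢.isOpen_leftDom ch).mem_nhds (by rwa [hcv.1])))
  rw [Real.ball_eq_Ioo, zero_sub, zero_add] at hsub
  have hsub' : Ioo (-min δ δ') (min δ δ') ⊆ Ioo (-δ) δ :=
    Ioo_subset_Ioo (neg_le_neg (min_le_left _ _)) (min_le_left _ _)
  have hsub'' : ∀ r ∈ Ioo (-min δ δ') (min δ δ'), c r ∈ 𝒢.leftDom ch := fun r hr =>
    hsub (Ioo_subset_Ioo (neg_le_neg (min_le_right _ _)) (min_le_right _ _) hr)
  let d : ℝ → V := fun r => ch.dy (𝒢.Ψ v) + r • 𝒢.fibreForce ch Γ (𝒢.β v.proj, ch.dy (𝒢.Ψ v))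
  have hd : ContDiff ℝ ∞ d := by fun_prop
  refine ⟨min δ δ', lt_min hδ hδ', c, d, ?_, hsub'', hcv.mono (subset_univ _),
    HasVelocity.line _ _⟩
  exact (𝒢.contMDiffOn_leftFrame ch).comp ((hc.mono hsub').prodMk hd.contMDiff.contMDiffOn) hsub''

theorem tangentMap_proj_liftedField [FiniteDimensional ℝ E] {v : TangentBundle 𝓘(ℝ, E) G}
    (hdom : v.proj ∈ 𝒢.leftDom ch) :
    tangentMap 𝓘(ℝ, E).tangent 𝓘(ℝ, E) (fun v : TangentBundle 𝓘(ℝ, E) G => v.proj)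
      (𝒢.liftedField ch Γ v) = v := by
  obtain ⟨δ, hδ, c, d, -, hcd, hc, hd⟩ := 𝒢.exists_curve_liftedField (Γ := Γ) hdom
  have h0 : (0 : ℝ) ∈ Ioo (-δ) δ := ⟨by linarith, hδ⟩
  have h1 := (𝒢.hasVelocity_liftedField hdom hc hd).comp (I' := 𝓘(ℝ, E))
    (contMDiff_tangentBundle_proj.mdifferentiableAt (by simp))
  exact h1.unique (hc.congr (fun r hr => 𝒢.leftFrame_proj (hcd r hr) _) h0)
    (isOpen_Ioo.uniqueDiffOn 0 h0)

theorem tangentMapWithin_Ψ_liftedField [FiniteDimensional ℝ E] (hΓ : 𝒢.IsAlgebroidSODE Γ)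
    {v : TangentBundle 𝓘(ℝ, E) G} (hv : v ∈ 𝒢.vertical) (hdom : v.proj ∈ 𝒢.leftDom ch) :
    tangentMapWithin 𝓘(ℝ, E).tangent 𝓘(ℝ, E).tangent 𝒢.Ψ 𝒢.vertical (𝒢.liftedField ch Γ v) =
      ⟨𝒢.Ψ v, Γ (𝒢.Ψ v)⟩ := by
  obtain ⟨δ, hδ, c, d, -, hcd, hc, hd⟩ := 𝒢.exists_curve_liftedField (Γ := Γ) hdom
  have h0 : (0 : ℝ) ∈ Ioo (-δ) δ := ⟨by linarith, hδ⟩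
  have hΨv := 𝒢.Ψ_mem_algebroid hv
  have hΨdom : (𝒢.Ψ v).proj ∈ ch.dom := by rw [𝒢.Ψ_proj]; exact hdom
  -- the image by `Ψ` of the curve tangent to the lifted field
  have h1 := (𝒢.hasVelocity_liftedField hdom hc hd).comp_within
    (𝒢.mdifferentiableWithinAt_Ψ (by rwa [𝒢.liftedField_proj hv hdom]))
    fun r hr => 𝒢.leftFrame_mem_vertical (hcd r hr) _
  have h2 := h1.congr (c' := fun r => 𝒢.algebroidFrame ch (𝒢.β (c r), d r))
    (fun r hr => (𝒢.Ψ_leftFrame (hcd r hr) _).symm) h0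
  have hframe : MDifferentiableAt (𝓘(ℝ, F).prod 𝓘(ℝ, V)) 𝓘(ℝ, E).tangent (𝒢.algebroidFrame ch)
      (𝒢.β v.proj, ch.dy (𝒢.Ψ v)) :=
    ((𝒢.contMDiffOn_algebroidFrame ch).contMDiffAt (IsOpen.mem_nhds
      (ch.isOpen_dom.preimage (𝒢.smooth_ε.continuous.comp continuous_fst)) hdom)).mdifferentiableAt
      (by simp)
  have h3 := ((hc.comp (𝒢.contMDiff_β.mdifferentiableAt (by simp))).prodMk hd).comp hframe
  -- a curve in `AG` tangent to `Γ`, in the same coordinates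
  obtain ⟨δ', hδ', a, -, ha, hav⟩ := (hΓ.1.2 _ hΨv).exists_curve
  have h0' : (0 : ℝ) ∈ Ioo (-δ') δ' := ⟨by linarith, hδ'⟩
  have h4 := hav.comp (I' := 𝓘(ℝ, F)) (f := 𝒢.algebroidProj)
    ((𝒢.contMDiff_α.comp contMDiff_tangentBundle_proj).mdifferentiableAt (by simp))
  rw [hΓ.2 _ hΨv, 𝒢.anchor_Ψ hv] at h4
  have h5 := hav.comp (ch.mdifferentiableAt_dy hΨdom)
  rw [𝒢.tangentMap_dy_Ψ_eq hv hdom] at h5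
  have h6 := (h4.prodMk h5).comp hframe
  have hdomc : (a 0).proj ∈ ch.dom := by rw [hav.1]; exact hΨdom
  have h7 := (hav.congr_of_eventuallyEq
    (c' := fun r => 𝒢.algebroidFrame ch (𝒢.algebroidProj (a r), ch.dy (a r))) (by
      filter_upwards [self_mem_nhdsWithin, hav.continuousWithinAt.preimage_mem_nhdsWithin
        ((isOpen_proj_preimage ch.isOpen_dom).mem_nhds hdomc)] with r hr hr'
      exact 𝒢.algebroidFrame_dy (ha r hr) hr')
    (𝒢.algebroidFrame_dy (ha 0 h0') hdomc)).unique h6 (isOpen_Ioo.uniqueDiffOn 0 h0')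
  rw [h7]
  exact h2.unique h3 (isOpen_Ioo.uniqueDiffOn 0 h0)

theorem contMDiffOn_liftedField [FiniteDimensional ℝ E] (hΓ : 𝒢.IsAlgebroidSODE Γ) :
    ContMDiffOn 𝓘(ℝ, E).tangent 𝓘(ℝ, E).tangent.tangent ∞ (𝒢.liftedField ch Γ)
      (𝒢.vertical ∩ {v | v.proj ∈ 𝒢.leftDom ch}) := by
  have hO : IsOpen {p : G × V | p.1 ∈ 𝒢.leftDom ch} :=
    (𝒢.isOpen_leftDom ch).preimage continuous_fst
  have h1 := (𝒢.contMDiffOn_leftFrame ch).contMDiffOn_tangentMapWithin (m := ∞) (by simp)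
    hO.uniqueMDiffOn
  have h2 : ContMDiffOn 𝓘(ℝ, E).tangent 𝓘(ℝ, V) ∞ (fun v => ch.dy (𝒢.Ψ v))
      (𝒢.vertical ∩ {v | v.proj ∈ 𝒢.leftDom ch}) :=
    ch.contMDiffOn_dy.comp (𝒢.contMDiffOn_Ψ.mono inter_subset_left) fun v hv => by
      change (𝒢.Ψ v).proj ∈ ch.dom
      rw [𝒢.Ψ_proj]
      exact hv.2
  have h3 : ContMDiffOn 𝓘(ℝ, E).tangent 𝓘(ℝ, V) ∞
      (fun v => 𝒢.fibreForce ch Γ (𝒢.β v.proj, ch.dy (𝒢.Ψ v)))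
      (𝒢.vertical ∩ {v | v.proj ∈ 𝒢.leftDom ch}) :=
    (𝒢.contMDiffOn_fibreForce hΓ).comp
      ((𝒢.contMDiff_β.comp contMDiff_tangentBundle_proj).contMDiffOn.prodMk h2) fun v hv => hv.2
  have h4 := (contMDiff_equivTangentBundleProd_symm (n := ∞) (I := 𝓘(ℝ, E)) (M := G)
    (I' := 𝓘(ℝ, V)) (M' := V)).comp_contMDiffOn
    (contMDiffOn_id.prodMk (contMDiff_tangentBundle_mk_vectorSpace.comp_contMDiffOn (h2.prodMk h3)))
  refine (h1.comp h4 fun v hv => hv.2).congr fun v hv => ?_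
  exact (tangentMapWithin_eq_tangentMap
    (p := (equivTangentBundleProd 𝓘(ℝ, E) G 𝓘(ℝ, V) V).symm
      (v, ⟨ch.dy (𝒢.Ψ v), (𝒢.fibreForce ch Γ (𝒢.β v.proj, ch.dy (𝒢.Ψ v)) : V)⟩))
    (hO.uniqueMDiffOn (v.proj, ch.dy (𝒢.Ψ v)) hv.2) (𝒢.mdifferentiableAt_leftFrame hv.2)).symm

end Chart

/-- A SODE on `AG` has a unique lift to a SODE on `Vα`, which is given in the coordinates of every
fibred chart by `liftedField`. -/
theorem exists_lift [FiniteDimensional ℝ E]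
    {Γ : (v : TangentBundle 𝓘(ℝ, E) G) → TangentSpace 𝓘(ℝ, E).tangent v}
    (hΓ : 𝒢.IsAlgebroidSODE Γ) :
    ∃ Γt : (v : TangentBundle 𝓘(ℝ, E) G) → TangentSpace 𝓘(ℝ, E).tangent v,
      𝒢.IsVerticalSODE Γt ∧ 𝒢.IsΨRelated Γt Γ ∧
      (∀ X : (v : TangentBundle 𝓘(ℝ, E) G) → TangentSpace 𝓘(ℝ, E).tangent v,
        𝒢.IsVerticalSODE X → 𝒢.IsΨRelated X Γ → ∀ v ∈ 𝒢.vertical, X v = Γt v) ∧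
      ∀ {V : Type u} [NormedAddCommGroup V] [NormedSpace ℝ V] (ch : FibredChart E F V 𝒢.α),
        ∀ v ∈ 𝒢.vertical, v.proj ∈ 𝒢.leftDom ch →
        (⟨v, Γt v⟩ : TangentBundle 𝓘(ℝ, E).tangent (TangentBundle 𝓘(ℝ, E) G)) =
          𝒢.liftedField ch Γ v := by
  -- the conditions which characterize the value of the lift at `v`
  let P : (v : TangentBundle 𝓘(ℝ, E) G) → TangentSpace 𝓘(ℝ, E).tangent v → Prop := fun v X =>
    IsTangentTo 𝒢.vertical v X ∧
    tangentMap 𝓘(ℝ, E).tangent 𝓘(ℝ, E) (fun v : TangentBundle 𝓘(ℝ, E) G => v.proj)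
      (⟨v, X⟩ : TangentBundle 𝓘(ℝ, E).tangent (TangentBundle 𝓘(ℝ, E) G)) = v ∧
    tangentMapWithin 𝓘(ℝ, E).tangent 𝓘(ℝ, E).tangent 𝒢.Ψ 𝒢.vertical
      (⟨v, X⟩ : TangentBundle 𝓘(ℝ, E).tangent (TangentBundle 𝓘(ℝ, E) G)) = ⟨𝒢.Ψ v, Γ (𝒢.Ψ v)⟩
  have hPeq : ∀ {V : Type u} [NormedAddCommGroup V] [NormedSpace ℝ V]
      (ch : FibredChart E F V 𝒢.α) (v) (X : TangentSpace 𝓘(ℝ, E).tangent v), P v X →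
      v.proj ∈ 𝒢.leftDom ch →
      (⟨v, X⟩ : TangentBundle 𝓘(ℝ, E).tangent (TangentBundle 𝓘(ℝ, E) G)) =
        𝒢.liftedField ch Γ v := by
    rintro V _ _ ch v X ⟨h1, h2, h3⟩ hdom
    obtain ⟨δ, hδ, c, -, hc, hcv⟩ := h1.exists_curve
    have h0 : (0 : ℝ) ∈ Ioo (-δ) δ := ⟨by linarith, hδ⟩
    exact 𝒢.eq_liftedField (isOpen_Ioo.uniqueDiffOn 0 h0) h0 hcv hc hdom h2 h3
  have hPex : ∀ v ∈ 𝒢.vertical, ∃ X, P v X := by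
    intro v hv
    obtain ⟨V, _, _, ch, -, hdom⟩ := 𝒢.exists_fibredChart (𝒢.ε (𝒢.β v.proj))
    have h1 : (𝒢.liftedField ch Γ v).proj = v := 𝒢.liftedField_proj hv hdom
    obtain ⟨X, hX⟩ : ∃ X : TangentSpace 𝓘(ℝ, E).tangent v,
        (⟨v, X⟩ : TangentBundle 𝓘(ℝ, E).tangent (TangentBundle 𝓘(ℝ, E) G)) =
          𝒢.liftedField ch Γ v := by
      generalize 𝒢.liftedField ch Γ v = Z at h1
      subst h1
      exact ⟨Z.2, rfl⟩
    refine ⟨X, ?_, ?_, ?_⟩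
    · obtain ⟨δ, hδ, c, d, hcd, hdom', hc, hd⟩ := 𝒢.exists_curve_liftedField (Γ := Γ) hdom
      refine isTangentTo_of_hasVelocity hδ hcd
        (fun r hr => 𝒢.leftFrame_mem_vertical (hdom' r hr) _) ?_
      rw [hX]
      exact 𝒢.hasVelocity_liftedField hdom hc hd
    · rw [hX]
      exact 𝒢.tangentMap_proj_liftedField hdom
    · rw [hX]
      exact 𝒢.tangentMapWithin_Ψ_liftedField hΓ hv hdom
  classical
  let Γt : (v : TangentBundle 𝓘(ℝ, E) G) → TangentSpace 𝓘(ℝ, E).tangent v := fun v =>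
    if hv : v ∈ 𝒢.vertical then (hPex v hv).choose else 0
  have hΓt : ∀ v ∈ 𝒢.vertical, P v (Γt v) := fun v hv => by
    simp only [Γt, dif_pos hv]
    exact (hPex v hv).choose_spec
  have hΓt' : ∀ {V : Type u} [NormedAddCommGroup V] [NormedSpace ℝ V]
      (ch : FibredChart E F V 𝒢.α), ∀ v ∈ 𝒢.vertical, v.proj ∈ 𝒢.leftDom ch →
      (⟨v, Γt v⟩ : TangentBundle 𝓘(ℝ, E).tangent (TangentBundle 𝓘(ℝ, E) G)) =
        𝒢.liftedField ch Γ v := fun ch v hv hdom => hPeq ch v _ (hΓt v hv) hdom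
  refine ⟨Γt, ⟨⟨?_, fun v hv => (hΓt v hv).1⟩, fun v hv => (hΓt v hv).2.1⟩,
    fun v hv => (hΓt v hv).2.2, ?_, hΓt'⟩
  · intro v hv
    obtain ⟨V, _, _, ch, -, hdom⟩ := 𝒢.exists_fibredChart (𝒢.ε (𝒢.β v.proj))
    have h1 := (𝒢.contMDiffOn_liftedField (ch := ch) hΓ v ⟨hv, hdom⟩).congr_of_mem
      (fun w hw => hΓt' ch w hw.1 hw.2) ⟨hv, hdom⟩
    exact h1.mono_of_mem_nhdsWithin (inter_mem self_mem_nhdsWithin (mem_nhdsWithin_of_mem_nhds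
      ((isOpen_proj_preimage (𝒢.isOpen_leftDom ch)).mem_nhds hdom)))
  · intro X hX hXΨ v hv
    obtain ⟨V, _, _, ch, -, hdom⟩ := 𝒢.exists_fibredChart (𝒢.ε (𝒢.β v.proj))
    have h1 := hPeq ch v (X v) ⟨hX.1.2 v hv, hX.2 v hv, hXΨ v hv⟩ hdom
    exact eq_of_heq (Bundle.TotalSpace.mk.inj (h1.trans (hΓt' ch v hv hdom).symm)).2

end LieGroupoid

/-! ### The lifted equation in coordinates -/

namespace LieGroupoid

variable {E : Type u} {F G Q : Type*}
  [NormedAddCommGroup E] [NormedSpace ℝ E] [NormedAddCommGroup F] [NormedSpace ℝ F]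
  [TopologicalSpace G] [ChartedSpace E G] [IsManifold 𝓘(ℝ, E) ∞ G]
  [TopologicalSpace Q] [ChartedSpace F Q] [IsManifold 𝓘(ℝ, F) ∞ Q]
  (𝒢 : LieGroupoid E F G Q)
  {V : Type*} [NormedAddCommGroup V] [NormedSpace ℝ V] (ch : FibredChart E F V 𝒢.α) (q₀ : Q)
  (Γ : (v : TangentBundle 𝓘(ℝ, E) G) → TangentSpace 𝓘(ℝ, E).tangent v)

/-- The arrow with coordinates `(x, y)`, where `x` is the coordinate of its source in the preferred
chart at `q₀` and `y` is the coordinate along the fibre of `α`. -/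
def arrowOf (p : F × V) : G := ch.κ ((chartAt F q₀).symm p.1, p.2)

/-- The coordinates of arrows, inverse to `arrowOf`. -/
def arrowCoord (g : G) : F × V := (chartAt F q₀ (𝒢.α g), ch.y g)

/-- The domain of the coordinates `arrowCoord`, restricted to the arrows at which `leftFrame` is
a frame. -/
def coordDom : Set G := {g | g ∈ ch.dom ∧ 𝒢.α g ∈ (chartAt F q₀).source ∧ g ∈ 𝒢.leftDom ch}

/-- The open set of coordinates of the arrows in `coordDom`. -/
def coordImg : Set (F × V) :=
  {p | (p.1 ∈ (chartAt F q₀).target ∧ ((chartAt F q₀).symm p.1, p.2) ∈ ch.img) ∧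
    𝒢.arrowOf ch q₀ p ∈ 𝒢.leftDom ch}

/-- The vertical vector with coordinates `(x, y, w)`: it sits at the arrow with coordinates `(x, y)`
and `Ψ` maps it to the element of `AG` with fibre coordinate `w`. -/
noncomputable def vectorOf (z : F × V × V) : TangentBundle 𝓘(ℝ, E) G :=
  𝒢.leftFrame ch (𝒢.arrowOf ch q₀ (z.1, z.2.1), z.2.2)

/-- The coordinates of vertical vectors, inverse to `vectorOf`. -/
noncomputable def vectorCoord (v : TangentBundle 𝓘(ℝ, E) G) : F × V × V :=
  (chartAt F q₀ (𝒢.α v.proj), ch.y v.proj, ch.dy (𝒢.Ψ v))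

/-- The lifted equation in coordinates: the right hand side of the equation for `y`. -/
noncomputable def velocityField (z : F × V × V) : V := ch.dy (𝒢.vectorOf ch q₀ z)

/-- The lifted equation in coordinates: the right hand side of the equation for `w`. -/
noncomputable def forceField (z : F × V × V) : V :=
  𝒢.fibreForce ch Γ (𝒢.β (𝒢.arrowOf ch q₀ (z.1, z.2.1)), z.2.2)

/-- The fibre coordinate of the units. -/
def unitCoord (x : F) : V := ch.y (𝒢.ε ((chartAt F q₀).symm x))

/-- The coordinates of the units in the fibred chart. -/
def unitDom : Set F := {x | x ∈ (chartAt F q₀).target ∧ 𝒢.ε ((chartAt F q₀).symm x) ∈ ch.dom}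

theorem isOpen_coordDom : IsOpen (𝒢.coordDom ch q₀) :=
  ch.isOpen_dom.inter (((chartAt F q₀).open_source.preimage 𝒢.contMDiff_α.continuous).inter
    (𝒢.isOpen_leftDom ch))

theorem contMDiffOn_prod_chart_symm :
    ContMDiffOn 𝓘(ℝ, F × V) (𝓘(ℝ, F).prod 𝓘(ℝ, V)) ∞
      (fun p : F × V => ((chartAt F q₀).symm p.1, p.2)) {p | p.1 ∈ (chartAt F q₀).target} :=
  ((contMDiffOn_chart_symm (I := 𝓘(ℝ, F)) (n := ∞) (x := q₀)).comp
    contDiff_fst.contMDiff.contMDiffOn fun _ hp => hp).prodMk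
    contDiff_snd.contMDiff.contMDiffOn

theorem isOpen_arrowOf_domain : IsOpen {p : F × V | p.1 ∈ (chartAt F q₀).target ∧
    ((chartAt F q₀).symm p.1, p.2) ∈ ch.img} :=
  (contMDiffOn_prod_chart_symm q₀).continuousOn.isOpen_inter_preimage
    ((chartAt F q₀).open_target.preimage continuous_fst) ch.isOpen_img

theorem contMDiffOn_arrowOf :
    ContMDiffOn 𝓘(ℝ, F × V) 𝓘(ℝ, E) ∞ (𝒢.arrowOf ch q₀) {p | p.1 ∈ (chartAt F q₀).target ∧
      ((chartAt F q₀).symm p.1, p.2) ∈ ch.img} :=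
  ch.contMDiffOn_κ.comp ((contMDiffOn_prod_chart_symm q₀).mono fun _ hp => hp.1) fun _ hp => hp.2

theorem isOpen_coordImg : IsOpen (𝒢.coordImg ch q₀) :=
  (𝒢.contMDiffOn_arrowOf ch q₀).continuousOn.isOpen_inter_preimage
    (𝒢.isOpen_arrowOf_domain ch q₀) (𝒢.isOpen_leftDom ch)

theorem contMDiffOn_arrowCoord :
    ContMDiffOn 𝓘(ℝ, E) 𝓘(ℝ, F × V) ∞ (𝒢.arrowCoord ch q₀) (𝒢.coordDom ch q₀) :=
  ((contMDiffOn_chart (I := 𝓘(ℝ, F)) (n := ∞) (x := q₀)).comp 𝒢.contMDiff_α.contMDiffOn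
    fun _ hg => hg.2.1).prodMk_space (ch.contMDiffOn_y.mono fun _ hg => hg.1)

variable {ch q₀}

theorem arrowOf_mem {p : F × V} (hp : p ∈ 𝒢.coordImg ch q₀) :
    𝒢.arrowOf ch q₀ p ∈ 𝒢.coordDom ch q₀ := by
  refine ⟨ch.κ_mem hp.1.2, ?_, hp.2⟩
  rw [arrowOf, ch.α_κ hp.1.2]
  exact (chartAt F q₀).map_target hp.1.1

theorem α_arrowOf {p : F × V} (hp : p ∈ 𝒢.coordImg ch q₀) :
    𝒢.α (𝒢.arrowOf ch q₀ p) = (chartAt F q₀).symm p.1 := ch.α_κ hp.1.2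

theorem arrowCoord_arrowOf {p : F × V} (hp : p ∈ 𝒢.coordImg ch q₀) :
    𝒢.arrowCoord ch q₀ (𝒢.arrowOf ch q₀ p) = p := by
  rw [arrowCoord, 𝒢.α_arrowOf hp, (chartAt F q₀).right_inv hp.1.1, arrowOf, ch.y_κ hp.1.2]

theorem arrowOf_arrowCoord {g : G} (hg : g ∈ 𝒢.coordDom ch q₀) :
    𝒢.arrowOf ch q₀ (𝒢.arrowCoord ch q₀ g) = g := by
  rw [arrowOf, arrowCoord, (chartAt F q₀).left_inv hg.2.1, ch.κ_y hg.1]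

theorem arrowCoord_mem {g : G} (hg : g ∈ 𝒢.coordDom ch q₀) :
    𝒢.arrowCoord ch q₀ g ∈ 𝒢.coordImg ch q₀ := by
  refine ⟨⟨(chartAt F q₀).map_source hg.2.1, ?_⟩, ?_⟩
  · change ((chartAt F q₀).symm (chartAt F q₀ (𝒢.α g)), ch.y g) ∈ ch.img
    rw [(chartAt F q₀).left_inv hg.2.1]
    exact ch.mem_img hg.1
  · rw [𝒢.arrowOf_arrowCoord hg]
    exact hg.2.2

theorem vectorOf_proj {z : F × V × V} (hz : (z.1, z.2.1) ∈ 𝒢.coordImg ch q₀) :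
    (𝒢.vectorOf ch q₀ z).proj = 𝒢.arrowOf ch q₀ (z.1, z.2.1) :=
  𝒢.leftFrame_proj hz.2 _

theorem vectorOf_mem_vertical {z : F × V × V} (hz : (z.1, z.2.1) ∈ 𝒢.coordImg ch q₀) :
    𝒢.vectorOf ch q₀ z ∈ 𝒢.vertical :=
  𝒢.leftFrame_mem_vertical hz.2 _

theorem dy_Ψ_vectorOf {z : F × V × V} (hz : (z.1, z.2.1) ∈ 𝒢.coordImg ch q₀) :
    ch.dy (𝒢.Ψ (𝒢.vectorOf ch q₀ z)) = z.2.2 := by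
  rw [vectorOf, 𝒢.Ψ_leftFrame hz.2, 𝒢.dy_algebroidFrame hz.2]

theorem vectorOf_vectorCoord [FiniteDimensional ℝ E] {v : TangentBundle 𝓘(ℝ, E) G}
    (hv : v ∈ 𝒢.vertical) (hdom : v.proj ∈ 𝒢.coordDom ch q₀) :
    𝒢.vectorOf ch q₀ (𝒢.vectorCoord ch q₀ v) = v := by
  change 𝒢.leftFrame ch (𝒢.arrowOf ch q₀ (𝒢.arrowCoord ch q₀ v.proj), _) = v
  rw [𝒢.arrowOf_arrowCoord hdom]
  exact 𝒢.leftFrame_dy_Ψ hv hdom.2.2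

variable (ch q₀)

theorem contMDiffOn_vectorOf :
    ContMDiffOn 𝓘(ℝ, F × V × V) 𝓘(ℝ, E).tangent ∞ (𝒢.vectorOf ch q₀)
      {z | (z.1, z.2.1) ∈ 𝒢.coordImg ch q₀} := by
  have h1 : ContDiff ℝ ∞ (fun z : F × V × V => (z.1, z.2.1)) := by fun_prop
  have h2 : ContDiff ℝ ∞ (fun z : F × V × V => z.2.2) := by fun_prop
  exact (𝒢.contMDiffOn_leftFrame ch).comp (((𝒢.contMDiffOn_arrowOf ch q₀).comp
    h1.contMDiff.contMDiffOn fun z hz => hz.1).prodMk h2.contMDiff.contMDiffOn) fun z hz => hz.2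

theorem isOpen_vectorDom : IsOpen {z : F × V × V | (z.1, z.2.1) ∈ 𝒢.coordImg ch q₀} :=
  (𝒢.isOpen_coordImg ch q₀).preimage (f := fun z : F × V × V => (z.1, z.2.1)) (by fun_prop)

theorem contDiffOn_velocityField :
    ContDiffOn ℝ ∞ (𝒢.velocityField ch q₀) {z | (z.1, z.2.1) ∈ 𝒢.coordImg ch q₀} := by
  rw [← contMDiffOn_iff_contDiffOn]
  refine ch.contMDiffOn_dy.comp (𝒢.contMDiffOn_vectorOf ch q₀) fun z hz => ?_
  change (𝒢.vectorOf ch q₀ z).proj ∈ ch.dom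
  rw [𝒢.vectorOf_proj hz]
  exact ch.κ_mem hz.1.2

variable {Γ}

theorem contDiffOn_forceField (hΓ : 𝒢.IsAlgebroidSODE Γ) :
    ContDiffOn ℝ ∞ (𝒢.forceField ch q₀ Γ) {z | (z.1, z.2.1) ∈ 𝒢.coordImg ch q₀} := by
  rw [← contMDiffOn_iff_contDiffOn]
  have h1 : ContDiff ℝ ∞ (fun z : F × V × V => (z.1, z.2.1)) := by fun_prop
  have h2 : ContDiff ℝ ∞ (fun z : F × V × V => z.2.2) := by fun_prop
  exact (𝒢.contMDiffOn_fibreForce hΓ).comp ((𝒢.contMDiff_β.comp_contMDiffOn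
    ((𝒢.contMDiffOn_arrowOf ch q₀).comp h1.contMDiff.contMDiffOn fun z hz => hz.1)).prodMk
      h2.contMDiff.contMDiffOn) fun z hz => hz.2

theorem isOpen_unitDom : IsOpen (𝒢.unitDom ch q₀) :=
  (𝒢.smooth_ε.continuous.comp_continuousOn
    (chartAt F q₀).continuousOn_symm).isOpen_inter_preimage (chartAt F q₀).open_target
    ch.isOpen_dom

theorem contDiffOn_unitCoord :
    ContDiffOn ℝ ∞ (𝒢.unitCoord ch q₀) (𝒢.unitDom ch q₀) := by
  rw [← contMDiffOn_iff_contDiffOn]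
  exact ch.contMDiffOn_y.comp (𝒢.smooth_ε.comp_contMDiffOn
    ((contMDiffOn_chart_symm (I := 𝓘(ℝ, F)) (n := ∞) (x := q₀)).mono fun x hx => hx.1))
    fun x hx => hx.2

variable {ch q₀}

theorem arrowOf_unitCoord {x : F} (hx : x ∈ 𝒢.unitDom ch q₀) :
    𝒢.arrowOf ch q₀ (x, 𝒢.unitCoord ch q₀ x) = 𝒢.ε ((chartAt F q₀).symm x) :=
  𝒢.κ_unit hx.2

theorem unitCoord_mem {x : F} (hx : x ∈ 𝒢.unitDom ch q₀) :
    (x, 𝒢.unitCoord ch q₀ x) ∈ 𝒢.coordImg ch q₀ := by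
  refine ⟨⟨hx.1, 𝒢.mem_img_of_unit hx.2⟩, ?_⟩
  rw [𝒢.arrowOf_unitCoord hx, leftDom, mem_ofPred, 𝒢.β_ε]
  exact hx.2

theorem vectorOf_unitCoord {x : F} (hx : x ∈ 𝒢.unitDom ch q₀) (w : V) :
    𝒢.vectorOf ch q₀ (x, 𝒢.unitCoord ch q₀ x, w) =
    𝒢.algebroidFrame ch ((chartAt F q₀).symm x, w) := by
  rw [vectorOf]
  simp only
  rw [𝒢.arrowOf_unitCoord hx, 𝒢.leftFrame_unit hx.2]

theorem velocityField_unitCoord {x : F} (hx : x ∈ 𝒢.unitDom ch q₀) (w : V) :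
    𝒢.velocityField ch q₀ (x, 𝒢.unitCoord ch q₀ x, w) = w := by
  rw [velocityField, 𝒢.vectorOf_unitCoord hx, 𝒢.dy_algebroidFrame hx.2]

variable {Γt : (v : TangentBundle 𝓘(ℝ, E) G) → TangentSpace 𝓘(ℝ, E).tangent v}

/-- In coordinates, an integral curve of the lift solves `x' = 0`, `y' = velocityField`,
`w' = forceField`. -/
theorem hasDerivWithinAt_vectorCoord [FiniteDimensional ℝ E] (hΓt : 𝒢.IsVerticalSODE Γt)
    (hΨ : 𝒢.IsΨRelated Γt Γ) {c : ℝ → TangentBundle 𝓘(ℝ, E) G} {s : Set ℝ} {t : ℝ} (ht : t ∈ s)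
    (hc : IsMIntegralCurveOn c Γt s) (hvert : MapsTo c s 𝒢.vertical)
    (hdom : (c t).proj ∈ 𝒢.coordDom ch q₀) :
    HasDerivWithinAt (fun r => 𝒢.vectorCoord ch q₀ (c r))
      (0, 𝒢.velocityField ch q₀ (𝒢.vectorCoord ch q₀ (c t)),
        𝒢.forceField ch q₀ Γ (𝒢.vectorCoord ch q₀ (c t))) s t := by
  have h0 := isMIntegralCurveOn_iff_hasVelocity.1 hc t ht
  have hv := hvert ht
  have hπ := h0.comp (I' := 𝓘(ℝ, E)) (contMDiff_tangentBundle_proj.mdifferentiableAt (by simp))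
  rw [hΓt.2 _ hv] at hπ
  have hα := hπ.comp (I' := 𝓘(ℝ, F)) (𝒢.contMDiff_α.mdifferentiableAt (by simp))
  rw [tangentMap_of_mfderiv_eq_zero hv] at hα
  have hφ : MDifferentiableAt 𝓘(ℝ, F) 𝓘(ℝ, F) (chartAt F q₀) (𝒢.α (c t).proj) :=
    ((contMDiffOn_chart (I := 𝓘(ℝ, F)) (n := ∞) (x := q₀)).contMDiffAt
      ((chartAt F q₀).open_source.mem_nhds hdom.2.1)).mdifferentiableAt (by simp)
  have hx := (hα.comp hφ).hasDerivWithinAt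
  have hx0 : ((tangentMap 𝓘(ℝ, F) 𝓘(ℝ, F) (chartAt F q₀)
      (⟨𝒢.α (c t).proj, 0⟩ : TangentBundle 𝓘(ℝ, F) Q)).2 : F) = 0 :=
    map_zero (mfderiv 𝓘(ℝ, F) 𝓘(ℝ, F) (chartAt F q₀) (𝒢.α (c t).proj))
  have hy := ch.hasDerivWithinAt_y hπ hdom.1
  have h1 := h0.comp_within (𝒢.mdifferentiableWithinAt_Ψ hv) hvert
  rw [hΨ _ hv] at h1
  have h2 := h1.comp (ch.mdifferentiableAt_dy
    (by rw [𝒢.Ψ_proj]; exact hdom.2.2))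
  rw [𝒢.tangentMap_dy_Ψ_eq hv hdom.2.2] at h2
  have h3 := (hx.congr_deriv hx0).prodMk (hy.prodMk h2.hasDerivWithinAt)
  refine h3.congr_deriv (Prod.ext rfl (Prod.ext ?_ ?_))
  · change ch.dy (c t) = ch.dy _
    rw [𝒢.vectorOf_vectorCoord hv hdom]
  · change 𝒢.fibreForce ch Γ _ = 𝒢.fibreForce ch Γ (𝒢.β (𝒢.arrowOf ch q₀
      (𝒢.arrowCoord ch q₀ (c t).proj)), _)
    rw [𝒢.arrowOf_arrowCoord hdom]
    rfl

/-- Conversely, solutions of the equation in coordinates are integral curves of the lift. -/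
theorem hasVelocity_vectorOf [FiniteDimensional ℝ E]
    (hlift : ∀ v ∈ 𝒢.vertical, v.proj ∈ 𝒢.leftDom ch →
      (⟨v, Γt v⟩ : TangentBundle 𝓘(ℝ, E).tangent (TangentBundle 𝓘(ℝ, E) G)) =
        𝒢.liftedField ch Γ v) {x : F} {u : ℝ → V × V} {s : Set ℝ} {t : ℝ}
    (hz : (x, (u t).1) ∈ 𝒢.coordImg ch q₀)
    (hu : HasDerivWithinAt u (𝒢.velocityField ch q₀ (x, u t), 𝒢.forceField ch q₀ Γ (x, u t)) s t) :
    HasVelocity (fun r => 𝒢.vectorOf ch q₀ (x, u r)) s t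
      (⟨𝒢.vectorOf ch q₀ (x, u t), Γt (𝒢.vectorOf ch q₀ (x, u t))⟩ :
        TangentBundle 𝓘(ℝ, E).tangent (TangentBundle 𝓘(ℝ, E) G)) := by
  have hz' : (((x, u t) : F × V × V).1, ((x, u t) : F × V × V).2.1) ∈ 𝒢.coordImg ch q₀ := hz
  have hv := 𝒢.vectorOf_mem_vertical hz'
  have hproj := 𝒢.vectorOf_proj hz'
  have hdom : (𝒢.vectorOf ch q₀ (x, u t)).proj ∈ 𝒢.coordDom ch q₀ := by
    rw [hproj]
    exact 𝒢.arrowOf_mem hz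
  rw [hlift _ hv hdom.2.2]
  have h1 := ch.hasVelocity_κ hz.1.2 (HasVelocity.of_hasDerivWithinAt hu.prod_fst)
  have h2 := ch.partialTangentMap_κ_dy 𝒢.contMDiff_α hdom.1 hv
  have h3 : 𝒢.α (𝒢.vectorOf ch q₀ (x, u t)).proj = (chartAt F q₀).symm x := by
    rw [hproj]
    exact 𝒢.α_arrowOf hz
  have h4 : ch.y (𝒢.vectorOf ch q₀ (x, u t)).proj = (u t).1 := by
    rw [hproj]
    exact ch.y_κ hz.1.2
  rw [h3, h4] at h2
  rw [velocityField, h2] at h1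
  have h5 := HasVelocity.of_hasDerivWithinAt hu.prod_snd
  refine 𝒢.hasVelocity_liftedField hdom.2.2 h1 ?_
  rw [𝒢.dy_Ψ_vectorOf hz', hproj]
  exact h5

/-- Integral curves of the lift in `Vα` are determined by their initial values, as long as one of
them stays in the domain of the coordinates. -/
theorem eqOn_of_isIntegralCurveFrom [FiniteDimensional ℝ E] [FiniteDimensional ℝ F]
    [FiniteDimensional ℝ V] [T2Space G] (hΓ : 𝒢.IsAlgebroidSODE Γ)
    (hΓt : 𝒢.IsVerticalSODE Γt) (hΨ : 𝒢.IsΨRelated Γt Γ) {h : ℝ}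
    {v : TangentBundle 𝓘(ℝ, E) G} {c c' : ℝ → TangentBundle 𝓘(ℝ, E) G}
    (hc : IsIntegralCurveFrom 𝒢.vertical Γt h v c)
    (hc' : IsIntegralCurveFrom 𝒢.vertical Γt h v c')
    (hdom : ∀ t ∈ Icc 0 h, (c t).proj ∈ 𝒢.coordDom ch q₀) : EqOn c' c (Icc 0 h) := by
  have : IsManifold 𝓘(ℝ, E) 1 G := IsManifold.of_le (n := ∞) (by simp)
  have : T2Space (TangentBundle 𝓘(ℝ, E) G) := t2Space_tangentBundle
  have hcont : ∀ {d : ℝ → TangentBundle 𝓘(ℝ, E) G}, IsMIntegralCurveOn d Γt (Icc 0 h) →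
      ContinuousOn d (Icc 0 h) := fun hd t ht =>
    (isMIntegralCurveOn_iff_hasVelocity.1 hd t ht).continuousWithinAt
  have hclosed : IsClosed ({t | c' t = c t} ∩ Icc 0 h) := by
    have h1 := (hcont hc'.1).prodMk (hcont hc.1)
    have h2 := h1.preimage_isClosed_of_isClosed isClosed_Icc (isClosed_diagonal
      (X := TangentBundle 𝓘(ℝ, E) G))
    rw [inter_comm]
    exact h2
  refine hclosed.Icc_subset_of_forall_exists_gt (hc'.2.2.trans hc.2.2.symm) ?_
  rintro t ⟨hteq, ht⟩ b (hb : t < b)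
  have htI : t ∈ Icc 0 h := ⟨ht.1, ht.2.le⟩
  -- the field is Lipschitz near the common value of the two curves
  let X : F × V × V → F × V × V := fun z => (0, 𝒢.velocityField ch q₀ z, 𝒢.forceField ch q₀ Γ z)
  have hzt : ((𝒢.vectorCoord ch q₀ (c t)).1, (𝒢.vectorCoord ch q₀ (c t)).2.1) ∈
      𝒢.coordImg ch q₀ := 𝒢.arrowCoord_mem (hdom t htI)
  have hX : ContDiffOn ℝ ∞ X {z | (z.1, z.2.1) ∈ 𝒢.coordImg ch q₀} :=
    contDiffOn_const.prodMk ((𝒢.contDiffOn_velocityField ch q₀).prodMk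
      (𝒢.contDiffOn_forceField ch q₀ hΓ))
  obtain ⟨K, S, hS, hLip⟩ := ((hX.contDiffAt
    ((𝒢.isOpen_vectorDom ch q₀).mem_nhds hzt)).of_le (m := 1) (by simp)).exists_lipschitzOnWith
  -- both curves stay near this value for a short time
  have hnear : ∀ {d : ℝ → TangentBundle 𝓘(ℝ, E) G}, IsIntegralCurveFrom 𝒢.vertical Γt h v d →
      d t = c t → ∀ᶠ r in 𝓝[Icc 0 h] t,
        (d r).proj ∈ 𝒢.coordDom ch q₀ ∧ 𝒢.vectorCoord ch q₀ (d r) ∈ S := by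
    intro d hd hdt
    have h1 : (d t).proj ∈ 𝒢.coordDom ch q₀ := hdt ▸ hdom t htI
    have h2 := 𝒢.hasDerivWithinAt_vectorCoord hΓt hΨ htI hd.1 hd.2.1 h1
    refine Filter.Eventually.and (((hcont hd.1) t htI).preimage_mem_nhdsWithin
      ((isOpen_proj_preimage (𝒢.isOpen_coordDom ch q₀)).mem_nhds h1)) ?_
    refine h2.continuousWithinAt.preimage_mem_nhdsWithin ?_
    rwa [hdt]
  obtain ⟨δ, hδ, hsub⟩ := Metric.mem_nhdsWithin_iff.1 
    ((hnear hc rfl).and (hnear hc' hteq))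
  let T := min (min h b) (t + δ / 2)
  have htT : t < T := lt_min (lt_min ht.2 hb) (by linarith)
  have hT : ∀ r ∈ Icc t T, r ∈ Metric.ball t δ ∩ Icc 0 h := by
    intro r hr
    have h1 : r ≤ t + δ / 2 := hr.2.trans (min_le_right _ _)
    refine ⟨?_, ht.1.trans hr.1, hr.2.trans ((min_le_left _ _).trans (min_le_left _ _))⟩
    rw [Metric.mem_ball, Real.dist_eq, abs_of_nonneg (by linarith [hr.1])]
    linarith
  have hTI : Icc t T ⊆ Icc 0 h := fun r hr => (hT r hr).2
  have hder : ∀ {d : ℝ → TangentBundle 𝓘(ℝ, E) G}, IsIntegralCurveFrom 𝒢.vertical Γt h v d →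
      (∀ r ∈ Icc t T, (d r).proj ∈ 𝒢.coordDom ch q₀) → ∀ r ∈ Icc t T,
      HasDerivWithinAt (fun r => 𝒢.vectorCoord ch q₀ (d r)) (X (𝒢.vectorCoord ch q₀ (d r)))
        (Icc t T) r := fun hd hd' r hr =>
    (𝒢.hasDerivWithinAt_vectorCoord hΓt hΨ (hTI hr) hd.1 hd.2.1 (hd' r hr)).mono hTI
  have hd1 := hder hc fun r hr => (hsub (hT r hr)).1.1
  have hd2 := hder hc' fun r hr => (hsub (hT r hr)).2.1
  have hIci : ∀ r ∈ Ico t T, Icc t T ∈ 𝓝[Ici r] r := fun r hr =>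
    mem_of_superset (Icc_mem_nhdsGE hr.2) (Icc_subset_Icc_left hr.1)
  have huniq := ODE_solution_unique_of_mem_Icc_right (v := fun _ => X) (s := fun _ => S) (K := K)
    (fun _ _ => hLip)
    (fun r hr => (hd2 r hr).continuousWithinAt)
    (fun r hr => (hd2 r ⟨hr.1, hr.2.le⟩).mono_of_mem_nhdsWithin (hIci r hr))
    (fun r hr => (hsub (hT r ⟨hr.1, hr.2.le⟩)).2.2)
    (fun r hr => (hd1 r hr).continuousWithinAt)
    (fun r hr => (hd1 r ⟨hr.1, hr.2.le⟩).mono_of_mem_nhdsWithin (hIci r hr))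
    (fun r hr => (hsub (hT r ⟨hr.1, hr.2.le⟩)).1.2)
    (congrArg (𝒢.vectorCoord ch q₀) hteq)
  have hTm : T ∈ Icc t T := ⟨htT.le, le_rfl⟩
  refine ⟨T, ?_, htT, (min_le_left _ _).trans (min_le_right _ _)⟩
  have h1 := huniq hTm
  change c' T = c T
  rw [← 𝒢.vectorOf_vectorCoord (hc.2.1 (hTI hTm)) (hsub (hT T hTm)).1.1,
    ← 𝒢.vectorOf_vectorCoord (hc'.2.1 (hTI hTm)) (hsub (hT T hTm)).2.1]
  exact congrArg _ h1

end LieGroupoid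

/-! ### Trajectories and integral curves -/

namespace LieGroupoid

variable {E : Type u} {F G Q : Type*}
  [NormedAddCommGroup E] [NormedSpace ℝ E] [NormedAddCommGroup F] [NormedSpace ℝ F]
  [TopologicalSpace G] [ChartedSpace E G] [IsManifold 𝓘(ℝ, E) ∞ G]
  [TopologicalSpace Q] [ChartedSpace F Q] [IsManifold 𝓘(ℝ, F) ∞ Q]
  (𝒢 : LieGroupoid E F G Q)

section Trajectory

variable {Γ Γt : (v : TangentBundle 𝓘(ℝ, E) G) → TangentSpace 𝓘(ℝ, E).tangent v} {h : ℝ}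

/-- An integral curve of a SODE on `Vα` is the velocity of its projection to `G`. -/
theorem velocity_proj (hΓt : 𝒢.IsVerticalSODE Γt) (hh : 0 < h)
    {v : TangentBundle 𝓘(ℝ, E) G} {c : ℝ → TangentBundle 𝓘(ℝ, E) G}
    (hc : IsIntegralCurveFrom 𝒢.vertical Γt h v c) {t : ℝ} (ht : t ∈ Icc 0 h) :
    velocity 𝓘(ℝ, E) (fun r => (c r).proj) h t = c t := by
  have h0 := isMIntegralCurveOn_iff_hasVelocity.1 hc.1 t ht
  have h1 := h0.comp (I' := 𝓘(ℝ, E)) (contMDiff_tangentBundle_proj.mdifferentiableAt (by simp))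
  rw [hΓt.2 _ (hc.2.1 ht)] at h1
  exact h1.tangentMapWithin_eq (uniqueDiffOn_Icc hh t ht)

theorem isTrajectory_proj (hΓt : 𝒢.IsVerticalSODE Γt) (hh : 0 < h)
    {v : TangentBundle 𝓘(ℝ, E) G} {c : ℝ → TangentBundle 𝓘(ℝ, E) G}
    (hc : IsIntegralCurveFrom 𝒢.vertical Γt h v c)
    (hα : ∀ t ∈ Icc 0 h, 𝒢.α (c t).proj = 𝒢.α v.proj) :
    𝒢.IsTrajectory Γt h v.proj (c h).proj (fun t => (c t).proj) := by
  have hvel : EqOn (velocity 𝓘(ℝ, E) (fun r => (c r).proj) h) c (Icc 0 h) := fun t ht =>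
    𝒢.velocity_proj hΓt hh hc ht
  refine ⟨?_, fun t ht => ⟨?_, hα t ht⟩, ?_, rfl⟩
  · rw [isMIntegralCurveOn_iff_hasVelocity]
    intro t ht
    rw [hvel ht]
    exact (isMIntegralCurveOn_iff_hasVelocity.1 hc.1 t ht).congr hvel ht
  · rw [hvel ht]
    exact hc.2.1 ht
  · exact congrArg _ hc.2.2

variable {𝒢}

theorem IsTrajectory.isIntegralCurveFrom {g g' : G} {σ : ℝ → G}
    (hσ : 𝒢.IsTrajectory Γt h g g' σ) : IsIntegralCurveFrom 𝒢.vertical Γt h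
      (velocity 𝓘(ℝ, E) σ h 0) (velocity 𝓘(ℝ, E) σ h) :=
  ⟨hσ.1, fun t ht => (hσ.2.1 t ht).1, rfl⟩

theorem IsTrajectory.isMIntegralCurveOn_Ψ [FiniteDimensional ℝ E] (hΨ : 𝒢.IsΨRelated Γt Γ)
    {g g' : G} {σ : ℝ → G} (hσ : 𝒢.IsTrajectory Γt h g g' σ) :
    IsMIntegralCurveOn (fun t => 𝒢.Ψ (velocity 𝓘(ℝ, E) σ h t)) Γ (Icc 0 h) := by
  rw [isMIntegralCurveOn_iff_hasVelocity]
  intro t ht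
  have hv := (hσ.2.1 t ht).1
  have h1 := (isMIntegralCurveOn_iff_hasVelocity.1 hσ.1 t ht).comp_within
    (𝒢.mdifferentiableWithinAt_Ψ hv) fun r hr => (hσ.2.1 r hr).1
  rwa [hΨ _ hv] at h1

theorem algebroidProj_Ψ (v : TangentBundle 𝓘(ℝ, E) G) :
    𝒢.algebroidProj (𝒢.Ψ v) = 𝒢.β v.proj := by
  rw [algebroidProj, 𝒢.Ψ_proj, 𝒢.α_ε]

end Trajectory

/-! ### The exponential map in coordinates -/

/-- A family of integral curves of the vector field `Γt` on `Vα` with starting points in `AG`,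
parametrized by points `((h, x), w)` of an open set: the curve is defined on `[0, h]`, and starts at
the vector over the unit with coordinate `x` which has fibre coordinate `w`. Its projection to `G`
ends at the arrow with coordinates `(x, unitCoord x + (h / τ) • Z)`, where `Z` depends smoothly on
`((h, x), w)` and, conversely, `w` depends smoothly on `((h, x), Z)`. -/
structure ExpChart {V : Type*} [NormedAddCommGroup V] [NormedSpace ℝ V]
    (ch : FibredChart E F V 𝒢.α) (q₀ : Q)
    (Γt : (v : TangentBundle 𝓘(ℝ, E) G) → TangentSpace 𝓘(ℝ, E).tangent v) where
  τ : ℝ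
  σ : OpenPartialHomeomorph ((ℝ × F) × V) ((ℝ × F) × V)
  curve : (ℝ × F) × V → ℝ → TangentBundle 𝓘(ℝ, E) G
  τ_pos : 0 < τ
  σ_fst : ∀ z, (σ z).1 = z.1
  contDiffOn_σ : ContDiffOn ℝ ∞ σ σ.source
  contDiffOn_σ_symm : ContDiffOn ℝ ∞ σ.symm σ.target
  mem_unitDom : ∀ {z}, z ∈ σ.source → z.1.2 ∈ 𝒢.unitDom ch q₀
  isIntegralCurve : ∀ {z}, z ∈ σ.source → 0 < z.1.1 → IsIntegralCurveFrom 𝒢.vertical Γt z.1.1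
    (𝒢.vectorOf ch q₀ (z.1.2, 𝒢.unitCoord ch q₀ z.1.2, z.2)) (curve z)
  unique : ∀ {z}, z ∈ σ.source → 0 < z.1.1 → ∀ {c}, IsIntegralCurveFrom 𝒢.vertical Γt z.1.1
    (𝒢.vectorOf ch q₀ (z.1.2, 𝒢.unitCoord ch q₀ z.1.2, z.2)) c → EqOn c (curve z) (Icc 0 z.1.1)
  α_curve : ∀ {z}, z ∈ σ.source → 0 < z.1.1 → ∀ t ∈ Icc 0 z.1.1,
    𝒢.α (curve z t).proj = (chartAt F q₀).symm z.1.2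
  mem_coordImg : ∀ {z}, z ∈ σ.source → 0 < z.1.1 →
    (z.1.2, 𝒢.unitCoord ch q₀ z.1.2 + (z.1.1 / τ) • (σ z).2) ∈ 𝒢.coordImg ch q₀
  curve_end : ∀ {z}, z ∈ σ.source → 0 < z.1.1 → (curve z z.1.1).proj =
    𝒢.arrowOf ch q₀ (z.1.2, 𝒢.unitCoord ch q₀ z.1.2 + (z.1.1 / τ) • (σ z).2)

namespace ExpChart

variable {𝒢} {V : Type*} [NormedAddCommGroup V] [NormedSpace ℝ V] {ch : FibredChart E F V 𝒢.α}
  {q₀ : Q} {Γt : (v : TangentBundle 𝓘(ℝ, E) G) → TangentSpace 𝓘(ℝ, E).tangent v}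
  (S : 𝒢.ExpChart ch q₀ Γt)

/-- The starting point of the curve with parameter `z`. -/
noncomputable def initVector (_ : 𝒢.ExpChart ch q₀ Γt) (z : (ℝ × F) × V) :
    TangentBundle 𝓘(ℝ, E) G :=
  𝒢.vectorOf ch q₀ (z.1.2, 𝒢.unitCoord ch q₀ z.1.2, z.2)

/-- The arrow at which the curve with parameter `z` ends. -/
noncomputable def endArrow (z : (ℝ × F) × V) : G :=
  𝒢.arrowOf ch q₀ (z.1.2, 𝒢.unitCoord ch q₀ z.1.2 + (z.1.1 / S.τ) • (S.σ z).2)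

/-- The parameter of the curve on `[0, h]` which starts at `v`. -/
noncomputable def vecParam (_ : 𝒢.ExpChart ch q₀ Γt) (h : ℝ) (v : TangentBundle 𝓘(ℝ, E) G) :
    (ℝ × F) × V :=
  ((h, chartAt F q₀ (𝒢.α v.proj)), ch.dy v)

/-- The image under `σ` of the parameter of the curve on `[0, h]` which ends at `g`. -/
noncomputable def arrParam (h : ℝ) (g : G) : (ℝ × F) × V :=
  ((h, chartAt F q₀ (𝒢.α g)),
    (S.τ / h) • (ch.y g - 𝒢.unitCoord ch q₀ (chartAt F q₀ (𝒢.α g))))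

/-- The open subset of `TG` which cuts out of `AG` the domain of the exponential map. -/
def vecDom (h : ℝ) : Set (TangentBundle 𝓘(ℝ, E) G) :=
  {v | v.proj ∈ 𝒢.coordDom ch q₀ ∧ S.vecParam h v ∈ S.σ.source}

/-- The image of the exponential map. -/
def arrDom (h : ℝ) : Set G :=
  {g | (g ∈ 𝒢.coordDom ch q₀ ∧ chartAt F q₀ (𝒢.α g) ∈ 𝒢.unitDom ch q₀) ∧
    S.arrParam h g ∈ S.σ.target}

theorem initVector_proj {z : (ℝ × F) × V} (hz : z ∈ S.σ.source) :
    (S.initVector z).proj = 𝒢.ε ((chartAt F q₀).symm z.1.2) := by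
  rw [initVector, 𝒢.vectorOf_unitCoord (S.mem_unitDom hz),
    𝒢.algebroidFrame_proj (S.mem_unitDom hz).2]

theorem α_initVector {z : (ℝ × F) × V} (hz : z ∈ S.σ.source) :
    𝒢.α (S.initVector z).proj = (chartAt F q₀).symm z.1.2 := by
  rw [S.initVector_proj hz, 𝒢.α_ε]

theorem initVector_mem_algebroid {z : (ℝ × F) × V} (hz : z ∈ S.σ.source) :
    S.initVector z ∈ 𝒢.algebroid := by
  rw [initVector, 𝒢.vectorOf_unitCoord (S.mem_unitDom hz)]
  exact 𝒢.algebroidFrame_mem (S.mem_unitDom hz).2 _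

theorem vecParam_initVector {z : (ℝ × F) × V} (hz : z ∈ S.σ.source) :
    S.vecParam z.1.1 (S.initVector z) = z := by
  have h1 : ch.dy (S.initVector z) = z.2 := by
    rw [initVector, 𝒢.vectorOf_unitCoord (S.mem_unitDom hz),
      𝒢.dy_algebroidFrame (S.mem_unitDom hz).2]
  rw [vecParam, h1, S.α_initVector hz, (chartAt F q₀).right_inv (S.mem_unitDom hz).1]

theorem initVector_mem {z : (ℝ × F) × V} (hz : z ∈ S.σ.source) :
    S.initVector z ∈ S.vecDom z.1.1 ∩ 𝒢.algebroid := by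
  refine ⟨⟨?_, ?_⟩, S.initVector_mem_algebroid hz⟩
  · rw [S.initVector_proj hz, ← 𝒢.arrowOf_unitCoord (S.mem_unitDom hz)]
    exact 𝒢.arrowOf_mem (𝒢.unitCoord_mem (S.mem_unitDom hz))
  · rwa [S.vecParam_initVector hz]

theorem initVector_vecParam {h : ℝ} {v : TangentBundle 𝓘(ℝ, E) G}
    (hv : v ∈ S.vecDom h ∩ 𝒢.algebroid) : S.initVector (S.vecParam h v) = v := by
  rw [initVector, 𝒢.vectorOf_unitCoord (S.mem_unitDom hv.1.2)]
  change 𝒢.algebroidFrame ch ((chartAt F q₀).symm (chartAt F q₀ (𝒢.α v.proj)), ch.dy v) = v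
  rw [(chartAt F q₀).left_inv hv.1.1.2.1, 𝒢.algebroidFrame_dy hv.2 hv.1.1.1]

theorem arrParam_endArrow {z : (ℝ × F) × V} (hz : z ∈ S.σ.source) (hpos : 0 < z.1.1) :
    S.arrParam z.1.1 (S.endArrow z) = S.σ z := by
  have h1 := 𝒢.arrowCoord_arrowOf (S.mem_coordImg hz hpos)
  have hx : chartAt F q₀ (𝒢.α (S.endArrow z)) = z.1.2 := congrArg Prod.fst h1
  have hy : ch.y (S.endArrow z) = 𝒢.unitCoord ch q₀ z.1.2 + (z.1.1 / S.τ) • (S.σ z).2 :=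
    congrArg Prod.snd h1
  have hτ := S.τ_pos.ne'
  rw [arrParam, hx, hy, add_sub_cancel_left, smul_smul, div_mul_div_comm, mul_comm S.τ,
    div_self (mul_ne_zero hpos.ne' hτ), one_smul]
  exact Prod.ext (S.σ_fst z).symm rfl

theorem endArrow_mem {z : (ℝ × F) × V} (hz : z ∈ S.σ.source) (hpos : 0 < z.1.1) :
    S.endArrow z ∈ S.arrDom z.1.1 := by
  have h1 := 𝒢.arrowCoord_arrowOf (S.mem_coordImg hz hpos)
  have hx : chartAt F q₀ (𝒢.α (S.endArrow z)) = z.1.2 := congrArg Prod.fst h1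
  refine ⟨⟨𝒢.arrowOf_mem (S.mem_coordImg hz hpos), ?_⟩, ?_⟩
  · rw [hx]
    exact S.mem_unitDom hz
  · rw [S.arrParam_endArrow hz hpos]
    exact S.σ.map_source hz

theorem σ_symm_fst {p : (ℝ × F) × V} (hp : p ∈ S.σ.target) : (S.σ.symm p).1 = p.1 := by
  rw [← S.σ_fst, S.σ.right_inv hp]

theorem endArrow_arrParam {h : ℝ} (hpos : 0 < h) {g : G} (hg : g ∈ S.arrDom h) :
    S.endArrow (S.σ.symm (S.arrParam h g)) = g := by
  have hτ := S.τ_pos.ne'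
  rw [endArrow, S.σ_symm_fst hg.2, S.σ.right_inv hg.2]
  simp only [arrParam]
  rw [smul_smul, div_mul_div_comm, mul_comm h, div_self (mul_ne_zero hτ hpos.ne'), one_smul,
    add_sub_cancel]
  exact 𝒢.arrowOf_arrowCoord hg.1.1

theorem isOpen_vecDom (h : ℝ) : IsOpen (S.vecDom h) := by
  have h1 : ContinuousOn (S.vecParam h) {v | v.proj ∈ 𝒢.coordDom ch q₀} := by
    have h2 : ContinuousOn (fun v : TangentBundle 𝓘(ℝ, E) G => 𝒢.arrowCoord ch q₀ v.proj)
        {v | v.proj ∈ 𝒢.coordDom ch q₀} :=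
      (𝒢.contMDiffOn_arrowCoord ch q₀).continuousOn.comp
        contMDiff_tangentBundle_proj.continuous.continuousOn fun v hv => hv
    exact (continuousOn_const.prodMk (continuous_fst.comp_continuousOn h2)).prodMk
      (ch.contMDiffOn_dy.continuousOn.mono fun v hv => hv.1)
  exact h1.isOpen_inter_preimage (isOpen_proj_preimage (𝒢.isOpen_coordDom ch q₀)) S.σ.open_source

theorem contMDiffOn_chart_α : ContMDiffOn 𝓘(ℝ, E) 𝓘(ℝ, F) ∞
    (fun g => chartAt F q₀ (𝒢.α g)) (𝒢.coordDom ch q₀) :=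
  contDiff_fst.contMDiff.comp_contMDiffOn (𝒢.contMDiffOn_arrowCoord ch q₀)

theorem contMDiffOn_arrParam (h : ℝ) : ContMDiffOn 𝓘(ℝ, E) 𝓘(ℝ, (ℝ × F) × V) ∞ (S.arrParam h)
    {g | g ∈ 𝒢.coordDom ch q₀ ∧ chartAt F q₀ (𝒢.α g) ∈ 𝒢.unitDom ch q₀} := by
  have h1 := (contMDiffOn_chart_α (𝒢 := 𝒢) (ch := ch) (q₀ := q₀)).mono
    (t := {g | g ∈ 𝒢.coordDom ch q₀ ∧ chartAt F q₀ (𝒢.α g) ∈ 𝒢.unitDom ch q₀})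
    fun g hg => hg.1
  have h2 := (𝒢.contDiffOn_unitCoord ch q₀).contMDiffOn.comp h1 fun g hg => hg.2
  have h3 : ContMDiffOn 𝓘(ℝ, E) 𝓘(ℝ, V) ∞ (fun g => (S.τ / h) •
      (ch.y g - 𝒢.unitCoord ch q₀ (chartAt F q₀ (𝒢.α g))))
      {g | g ∈ 𝒢.coordDom ch q₀ ∧ chartAt F q₀ (𝒢.α g) ∈ 𝒢.unitDom ch q₀} :=
    (contDiff_const_smul (S.τ / h)).contMDiff.comp_contMDiffOn
      ((ch.contMDiffOn_y.mono fun g hg => hg.1.1).sub h2)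
  exact (contMDiffOn_const.prodMk_space h1).prodMk_space h3

theorem isOpen_arrDom (h : ℝ) : IsOpen (S.arrDom h) :=
  (S.contMDiffOn_arrParam h).continuousOn.isOpen_inter_preimage
    (contMDiffOn_chart_α.continuousOn.isOpen_inter_preimage (𝒢.isOpen_coordDom ch q₀)
      (𝒢.isOpen_unitDom ch q₀)) S.σ.open_target

theorem isIntegralCurveFrom_curve {h : ℝ} (hpos : 0 < h) {v : TangentBundle 𝓘(ℝ, E) G}
    (hv : v ∈ S.vecDom h ∩ 𝒢.algebroid) : IsIntegralCurveFrom 𝒢.vertical Γt h v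
      (S.curve (S.vecParam h v)) := by
  have h1 := S.isIntegralCurve hv.1.2 hpos
  rwa [show 𝒢.vectorOf ch q₀ _ = v from S.initVector_vecParam hv] at h1

theorem eqOn_curve {h : ℝ} (hpos : 0 < h) {v : TangentBundle 𝓘(ℝ, E) G}
    (hv : v ∈ S.vecDom h ∩ 𝒢.algebroid) {c : ℝ → TangentBundle 𝓘(ℝ, E) G}
    (hc : IsIntegralCurveFrom 𝒢.vertical Γt h v c) :
    EqOn c (S.curve (S.vecParam h v)) (Icc 0 h) := by
  refine S.unique hv.1.2 hpos ?_
  rwa [show 𝒢.vectorOf ch q₀ _ = v from S.initVector_vecParam hv]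

theorem expMap_eq {h : ℝ} (hpos : 0 < h) {v : TangentBundle 𝓘(ℝ, E) G}
    (hv : v ∈ S.vecDom h ∩ 𝒢.algebroid) : 𝒢.expMap Γt h v = S.endArrow (S.vecParam h v) := by
  have hflow : v ∈ flowDomain 𝒢.vertical Γt h := ⟨_, S.isIntegralCurveFrom_curve hpos hv⟩
  rw [expMap, flowMap, dif_pos hflow, S.eqOn_curve hpos hv hflow.choose_spec ⟨hpos.le, le_rfl⟩]
  exact S.curve_end hv.1.2 hpos

/-- The inverse of the exponential map. -/
noncomputable def logMap (h : ℝ) (g : G) : TangentBundle 𝓘(ℝ, E) G :=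
  S.initVector (S.σ.symm (S.arrParam h g))

theorem mapsTo_logMap (h : ℝ) : MapsTo (S.logMap h) (S.arrDom h) (S.vecDom h ∩ 𝒢.algebroid) := by
  intro g hg
  have h1 := S.initVector_mem (S.σ.map_target hg.2)
  rwa [S.σ_symm_fst hg.2] at h1

theorem vecParam_logMap {h : ℝ} {g : G} (hg : g ∈ S.arrDom h) :
    S.vecParam h (S.logMap h g) = S.σ.symm (S.arrParam h g) := by
  have h1 := S.vecParam_initVector (S.σ.map_target hg.2)
  rwa [S.σ_symm_fst hg.2] at h1

theorem expMap_logMap {h : ℝ} (hpos : 0 < h) {g : G} (hg : g ∈ S.arrDom h) :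
    𝒢.expMap Γt h (S.logMap h g) = g := by
  rw [S.expMap_eq hpos (S.mapsTo_logMap h hg), S.vecParam_logMap hg, S.endArrow_arrParam hpos hg]

theorem logMap_expMap {h : ℝ} (hpos : 0 < h) {v : TangentBundle 𝓘(ℝ, E) G}
    (hv : v ∈ S.vecDom h ∩ 𝒢.algebroid) : S.logMap h (𝒢.expMap Γt h v) = v := by
  rw [S.expMap_eq hpos hv, logMap, show S.arrParam h _ = _ from S.arrParam_endArrow hv.1.2 hpos,
    S.σ.left_inv hv.1.2, S.initVector_vecParam hv]

theorem contMDiffOn_initVector :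
    ContMDiffOn 𝓘(ℝ, (ℝ × F) × V) 𝓘(ℝ, E).tangent ∞ S.initVector S.σ.source := by
  have h1 : ContDiff ℝ ∞ (fun z : (ℝ × F) × V => z.1.2) := by fun_prop
  have h2 : ContDiff ℝ ∞ (fun z : (ℝ × F) × V => z.2) := by fun_prop
  exact (𝒢.contMDiffOn_vectorOf ch q₀).comp (h1.contDiffOn.prodMk
    (((𝒢.contDiffOn_unitCoord ch q₀).comp h1.contDiffOn fun z hz => S.mem_unitDom hz).prodMk
      h2.contDiffOn)).contMDiffOn fun z hz => 𝒢.unitCoord_mem (S.mem_unitDom hz)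

theorem contMDiffOn_endArrow : ContMDiffOn 𝓘(ℝ, (ℝ × F) × V) 𝓘(ℝ, E) ∞ S.endArrow
    (S.σ.source ∩ {z | 0 < z.1.1}) := by
  have h1 : ContDiff ℝ ∞ (fun z : (ℝ × F) × V => z.1.2) := by fun_prop
  have h2 : ContDiff ℝ ∞ (fun z : (ℝ × F) × V => z.1.1 / S.τ) := by fun_prop
  have h3 : ContDiffOn ℝ ∞ (fun z => (S.σ z).2) (S.σ.source ∩ {z | 0 < z.1.1}) :=
    contDiff_snd.comp_contDiffOn (S.contDiffOn_σ.mono inter_subset_left)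
  exact (𝒢.contMDiffOn_arrowOf ch q₀).comp (h1.contDiffOn.prodMk
    (((𝒢.contDiffOn_unitCoord ch q₀).comp h1.contDiffOn fun z hz => S.mem_unitDom hz.1).add
      (h2.contDiffOn.smul h3))).contMDiffOn fun z hz => (S.mem_coordImg hz.1 hz.2).1

theorem isDiffeomorphOn_expMap {h : ℝ} (hpos : 0 < h) :
    IsDiffeomorphOn 𝓘(ℝ, E).tangent 𝓘(ℝ, E) (𝒢.expMap Γt h) (S.vecDom h ∩ 𝒢.algebroid)
      (S.arrDom h) := by
  refine ⟨fun v hv => ?_, ?_, S.logMap h, S.mapsTo_logMap h, ?_,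
    fun v hv => S.logMap_expMap hpos hv, fun g hg => S.expMap_logMap hpos hg⟩
  · rw [S.expMap_eq hpos hv]
    exact S.endArrow_mem hv.1.2 hpos
  · have h1 : ContMDiffOn 𝓘(ℝ, E).tangent 𝓘(ℝ, F) ∞
        (fun v : TangentBundle 𝓘(ℝ, E) G => chartAt F q₀ (𝒢.α v.proj))
        (S.vecDom h ∩ 𝒢.algebroid) :=
      contMDiffOn_chart_α.comp contMDiff_tangentBundle_proj.contMDiffOn fun v hv => hv.1.1
    have h2 : ContMDiffOn 𝓘(ℝ, E).tangent 𝓘(ℝ, (ℝ × F) × V) ∞ (S.vecParam h)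
        (S.vecDom h ∩ 𝒢.algebroid) :=
      (contMDiffOn_const.prodMk_space h1).prodMk_space
        (ch.contMDiffOn_dy.mono fun v hv => hv.1.1.1)
    exact (S.contMDiffOn_endArrow.comp h2 fun v hv => ⟨hv.1.2, hpos⟩).congr
      fun v hv => S.expMap_eq hpos hv
  · exact S.contMDiffOn_initVector.comp (S.contDiffOn_σ_symm.contMDiffOn.comp
      ((S.contMDiffOn_arrParam h).mono fun g hg => hg.1) fun g hg => hg.2)
      fun g hg => S.σ.map_target hg.2

/-- The exponential map is the end point map of the trajectories with initial velocity `v`. -/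
theorem isTrajectory (hΓt : 𝒢.IsVerticalSODE Γt) {h : ℝ} (hpos : 0 < h)
    {v : TangentBundle 𝓘(ℝ, E) G} (hv : v ∈ S.vecDom h ∩ 𝒢.algebroid) :
    𝒢.IsTrajectory Γt h v.proj (𝒢.expMap Γt h v)
      (fun t => (S.curve (S.vecParam h v) t).proj) := by
  have h1 := 𝒢.isTrajectory_proj hΓt hpos (S.isIntegralCurveFrom_curve hpos hv) fun t ht => by
    rw [S.α_curve hv.1.2 hpos t ht]
    exact (chartAt F q₀).left_inv hv.1.1.2.1
  rwa [show (S.curve (S.vecParam h v) h).proj = _ from S.curve_end hv.1.2 hpos,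
    show 𝒢.arrowOf ch q₀ _ = _ from (S.expMap_eq hpos hv).symm] at h1

theorem velocity_trajectory (hΓt : 𝒢.IsVerticalSODE Γt) {h : ℝ} (hpos : 0 < h)
    {v : TangentBundle 𝓘(ℝ, E) G} (hv : v ∈ S.vecDom h ∩ 𝒢.algebroid) {t : ℝ}
    (ht : t ∈ Icc 0 h) :
    velocity 𝓘(ℝ, E) (fun t => (S.curve (S.vecParam h v) t).proj) h t =
      S.curve (S.vecParam h v) t :=
  𝒢.velocity_proj hΓt hpos (S.isIntegralCurveFrom_curve hpos hv) ht

/-- Trajectories whose initial velocity lies in the domain of the exponential map are determined by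
their end points. -/
theorem eqOn_of_isTrajectory {h : ℝ} (hpos : 0 < h)
    {v : TangentBundle 𝓘(ℝ, E) G} (hv : v ∈ S.vecDom h ∩ 𝒢.algebroid) {σ' : ℝ → G} {g : G}
    (hσ : 𝒢.IsTrajectory Γt h g (𝒢.expMap Γt h v) σ')
    (hσ' : velocity 𝓘(ℝ, E) σ' h 0 ∈ S.vecDom h ∩ 𝒢.algebroid) :
    EqOn σ' (fun t => (S.curve (S.vecParam h v) t).proj) (Icc 0 h) := by
  have h1 := S.eqOn_curve hpos hσ' hσ.isIntegralCurveFrom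
  have h2 : velocity 𝓘(ℝ, E) σ' h 0 = v := by
    rw [← S.logMap_expMap hpos hσ', ← S.logMap_expMap hpos hv, S.expMap_eq hpos hσ']
    refine congrArg _ (Eq.trans ?_ hσ.2.2.2)
    exact ((congrArg Bundle.TotalSpace.proj (h1 ⟨hpos.le, le_rfl⟩)).trans
      (S.curve_end hσ'.1.2 hpos)).symm
  rw [h2] at h1
  exact fun t ht => congrArg Bundle.TotalSpace.proj (h1 ht)

end ExpChart

end LieGroupoid

namespace LieGroupoid

variable {E : Type u} {F G Q : Type*}
  [NormedAddCommGroup E] [NormedSpace ℝ E] [NormedAddCommGroup F] [NormedSpace ℝ F]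
  [TopologicalSpace G] [ChartedSpace E G] [IsManifold 𝓘(ℝ, E) ∞ G]
  [TopologicalSpace Q] [ChartedSpace F Q] [IsManifold 𝓘(ℝ, F) ∞ Q]
  (𝒢 : LieGroupoid E F G Q)

/-- Existence of the family of integral curves. The parameters `((h, x₀), w)` of short times `h` and
small `w` belong to its domain, and the corresponding curves stay, in coordinates, close to
`(x₀, unitCoord x₀, 0)`. -/
theorem exists_expChart [FiniteDimensional ℝ E] [FiniteDimensional ℝ F] [T2Space G]
    {V : Type*} [NormedAddCommGroup V] [NormedSpace ℝ V] [FiniteDimensional ℝ V]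
    {ch : FibredChart E F V 𝒢.α} {q₀ : Q}
    {Γ Γt : (v : TangentBundle 𝓘(ℝ, E) G) → TangentSpace 𝓘(ℝ, E).tangent v}
    (hq₀ : 𝒢.ε q₀ ∈ ch.dom) (hΓ : 𝒢.IsAlgebroidSODE Γ) (hΓt : 𝒢.IsVerticalSODE Γt)
    (hΨ : 𝒢.IsΨRelated Γt Γ) (hlift : ∀ v ∈ 𝒢.vertical, v.proj ∈ 𝒢.leftDom ch →
      (⟨v, Γt v⟩ : TangentBundle 𝓘(ℝ, E).tangent (TangentBundle 𝓘(ℝ, E) G)) =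
        𝒢.liftedField ch Γ v) :
    ∃ S : 𝒢.ExpChart ch q₀ Γt, ((0, chartAt F q₀ q₀), 0) ∈ S.σ.source ∧
      S.σ ((0, chartAt F q₀ q₀), 0) = ((0, chartAt F q₀ q₀), 0) ∧
      ∀ N ∈ 𝓝 (chartAt F q₀ q₀, 𝒢.unitCoord ch q₀ (chartAt F q₀ q₀), (0 : V)),
        ∀ᶠ z in 𝓝 ((0, chartAt F q₀ q₀), 0), 0 < z.1.1 → ∀ t ∈ Icc 0 z.1.1,
          ∃ p ∈ N, p.1 = z.1.2 ∧ (p.1, p.2.1) ∈ 𝒢.coordImg ch q₀ ∧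
            S.curve z t = 𝒢.vectorOf ch q₀ p := by
  have hx₀ : chartAt F q₀ q₀ ∈ 𝒢.unitDom ch q₀ := by
    refine ⟨mem_chart_target F q₀, ?_⟩
    rwa [(chartAt F q₀).left_inv (mem_chart_source F q₀)]
  obtain ⟨τ, hτ, σ, sol, h0, h0', hfst, hσ, hσ', hX, hsol, hnear⟩ :=
    exists_boundary_value_solution (𝒢.isOpen_vectorDom ch q₀) (𝒢.isOpen_unitDom ch q₀)
      (𝒢.contDiffOn_unitCoord ch q₀) (𝒢.contDiffOn_velocityField ch q₀)
      (𝒢.contDiffOn_forceField ch q₀ hΓ) hx₀ (𝒢.unitCoord_mem hx₀)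
      fun w _ => 𝒢.velocityField_unitCoord hx₀ w
  have hmem : ∀ {z}, z ∈ σ.source → 0 < z.1.1 → ∀ t ∈ Icc 0 z.1.1,
      (z.1.2, (sol z t).1) ∈ 𝒢.coordImg ch q₀ := fun hz hpos t ht =>
    ((hsol _ hz hpos).2.1 t ht).1
  have hproj : ∀ {z}, z ∈ σ.source → 0 < z.1.1 → ∀ t ∈ Icc 0 z.1.1,
      (𝒢.vectorOf ch q₀ (z.1.2, sol z t)).proj = 𝒢.arrowOf ch q₀ (z.1.2, (sol z t).1) :=
    fun hz hpos t ht => 𝒢.vectorOf_proj (z := (_, sol _ t)) (hmem hz hpos t ht)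
  have hcurve : ∀ {z}, z ∈ σ.source → 0 < z.1.1 → IsIntegralCurveFrom 𝒢.vertical Γt z.1.1
      (𝒢.vectorOf ch q₀ (z.1.2, 𝒢.unitCoord ch q₀ z.1.2, z.2))
      (fun t => 𝒢.vectorOf ch q₀ (z.1.2, sol z t)) := by
    intro z hz hpos
    refine ⟨?_, fun t ht => 𝒢.vectorOf_mem_vertical (z := (_, sol _ t)) (hmem hz hpos t ht), ?_⟩
    · rw [isMIntegralCurveOn_iff_hasVelocity]
      exact fun t ht => 𝒢.hasVelocity_vectorOf hlift (hmem hz hpos t ht)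
        ((hsol z hz hpos).2.1 t ht).2
    · exact congrArg (fun u => 𝒢.vectorOf ch q₀ (z.1.2, u)) (hsol z hz hpos).1
  refine ⟨{
    τ := τ
    σ := σ
    curve := fun z t => 𝒢.vectorOf ch q₀ (z.1.2, sol z t)
    τ_pos := hτ
    σ_fst := hfst
    contDiffOn_σ := hσ
    contDiffOn_σ_symm := hσ'
    mem_unitDom := fun hz => hX _ hz
    isIntegralCurve := hcurve
    unique := fun hz hpos c hc => 𝒢.eqOn_of_isIntegralCurveFrom hΓ hΓt hΨ (hcurve hz hpos) hc
      fun t ht => by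
        rw [hproj hz hpos t ht]
        exact 𝒢.arrowOf_mem (hmem hz hpos t ht)
    α_curve := fun hz hpos t ht => by
      rw [hproj hz hpos t ht, 𝒢.α_arrowOf (hmem hz hpos t ht)]
    mem_coordImg := fun {z} hz hpos => by
      rw [← (hsol z hz hpos).2.2]
      exact hmem hz hpos _ ⟨hpos.le, le_rfl⟩
    curve_end := fun {z} hz hpos => by
      rw [hproj hz hpos _ ⟨hpos.le, le_rfl⟩, (hsol z hz hpos).2.2] }, h0, h0', ?_⟩
  intro N hN
  filter_upwards [hnear N hN, σ.open_source.mem_nhds h0] with z hz hzs hpos t ht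
  exact ⟨(z.1.2, sol z t), hz hpos t ht, rfl, hmem hzs hpos t ht, rfl⟩

end LieGroupoid

theorem theorem3p4 {E F G Q : Type*}
    [NormedAddCommGroup E] [NormedSpace ℝ E] [FiniteDimensional ℝ E]
    [NormedAddCommGroup F] [NormedSpace ℝ F] [FiniteDimensional ℝ F]
    [TopologicalSpace G] [ChartedSpace E G] [IsManifold 𝓘(ℝ, E) ∞ G] [T2Space G]
    [TopologicalSpace Q] [ChartedSpace F Q] [IsManifold 𝓘(ℝ, F) ∞ Q] [T2Space Q]
    (𝒢 : LieGroupoid E F G Q)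
    (Γ : (v : TangentBundle 𝓘(ℝ, E) G) → TangentSpace 𝓘(ℝ, E).tangent v)
    (hΓ : 𝒢.IsAlgebroidSODE Γ) (q₀ : Q) :
    -- the SODE on `Vα` which is `Ψ`-related with `Γ`, and its uniqueness
    ∃ Γt : (v : TangentBundle 𝓘(ℝ, E) G) → TangentSpace 𝓘(ℝ, E).tangent v,
      𝒢.IsVerticalSODE Γt ∧ 𝒢.IsΨRelated Γt Γ ∧
      (∀ X : (v : TangentBundle 𝓘(ℝ, E) G) → TangentSpace 𝓘(ℝ, E).tangent v,
        𝒢.IsVerticalSODE X → 𝒢.IsΨRelated X Γ → ∀ v ∈ 𝒢.vertical, X v = Γt v) ∧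
      -- the vectors `v_(h, q₀)`, for `0 < h ≤ h₀`
      ∃ h₀ > 0, ∃ C : Set G, ∃ K : Set (TangentBundle 𝓘(ℝ, E) G),
      ∃ v₀ : ℝ → TangentBundle 𝓘(ℝ, E) G,
        IsCompact C ∧ C ∈ 𝓝 (𝒢.ε q₀) ∧ IsCompact K ∧ K ⊆ 𝒢.vertical ∧
        ∀ h, 0 < h → h ≤ h₀ →
          v₀ h ∈ 𝒢.algebroid ∧ (v₀ h).proj = 𝒢.ε q₀ ∧ v₀ h ∈ K ∧
          (∃ σ : ℝ → G, 𝒢.IsTrajectory Γt h (𝒢.ε q₀) (𝒢.ε q₀) σ ∧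
            (∀ t ∈ Icc 0 h, σ t ∈ C ∧ velocity 𝓘(ℝ, E) σ h t ∈ K) ∧
            velocity 𝓘(ℝ, E) σ h 0 = v₀ h ∧
            ∀ σ' : ℝ → G, 𝒢.IsTrajectory Γt h (𝒢.ε q₀) (𝒢.ε q₀) σ' →
              (∀ t ∈ Icc 0 h, σ' t ∈ C ∧ velocity 𝓘(ℝ, E) σ' h t ∈ K) →
              EqOn σ' σ (Icc 0 h)) ∧
          ∃ 𝒰 : Set (TangentBundle 𝓘(ℝ, E) G), ∃ U : Set G,
            -- `𝒰` is an open subset of `AG`, contained in the domain of the flow at time `h`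
            (∃ O : Set (TangentBundle 𝓘(ℝ, E) G), IsOpen O ∧ 𝒰 = O ∩ 𝒢.algebroid) ∧
            v₀ h ∈ 𝒰 ∧ IsOpen U ∧ 𝒢.ε q₀ ∈ U ∧
            𝒰 ⊆ flowDomain 𝒢.vertical Γt h ∧
            IsDiffeomorphOn 𝓘(ℝ, E).tangent 𝓘(ℝ, E) (𝒢.expMap Γt h) 𝒰 U ∧
            ∀ g ∈ U, ∃ σ : ℝ → G,
              𝒢.IsTrajectory Γt h (𝒢.ε (𝒢.α g)) g σ ∧ velocity 𝓘(ℝ, E) σ h 0 ∈ 𝒰 ∧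
              (∀ σ' : ℝ → G, 𝒢.IsTrajectory Γt h (𝒢.ε (𝒢.α g)) g σ' →
                velocity 𝓘(ℝ, E) σ' h 0 ∈ 𝒰 → EqOn σ' σ (Icc 0 h)) ∧
              -- the induced curve in `AG` and its base trajectory
              (∀ t ∈ Icc 0 h, 𝒢.Ψ (velocity 𝓘(ℝ, E) σ h t) ∈ 𝒢.algebroid) ∧
              IsMIntegralCurveOn (fun t => 𝒢.Ψ (velocity 𝓘(ℝ, E) σ h t)) Γ (Icc 0 h) ∧
              𝒢.algebroidProj (𝒢.Ψ (velocity 𝓘(ℝ, E) σ h 0)) = 𝒢.α g ∧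
              𝒢.algebroidProj (𝒢.Ψ (velocity 𝓘(ℝ, E) σ h h)) = 𝒢.β g := by
  obtain ⟨Γt, hΓt, hΨ, huniq, hlift⟩ := 𝒢.exists_lift hΓ
  refine ⟨Γt, hΓt, hΨ, huniq, ?_⟩
  obtain ⟨V, _, _, ch, _, hdom⟩ := 𝒢.exists_fibredChart (𝒢.ε q₀)
  obtain ⟨S, hS, hS', hnear⟩ := 𝒢.exists_expChart hdom hΓ hΓt hΨ (hlift ch)
  set x₀ : F := chartAt F q₀ q₀ with hx₀
  set y₀ : V := 𝒢.unitCoord ch q₀ x₀ with hy₀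
  have hunit : x₀ ∈ 𝒢.unitDom ch q₀ := S.mem_unitDom hS
  have hsymm : (chartAt F q₀).symm x₀ = q₀ := (chartAt F q₀).left_inv (mem_chart_source F q₀)
  have harrow : 𝒢.arrowOf ch q₀ (x₀, y₀) = 𝒢.ε q₀ := by
    rw [𝒢.arrowOf_unitCoord hunit, hsymm]
  have hmem₀ : (x₀, y₀) ∈ 𝒢.coordImg ch q₀ := 𝒢.unitCoord_mem hunit
  have hcoord₀ : 𝒢.arrowCoord ch q₀ (𝒢.ε q₀) = (x₀, y₀) := by
    rw [← harrow, 𝒢.arrowCoord_arrowOf hmem₀]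
  -- a ball in the coordinates of the arrows, and one in the domain of `S`
  obtain ⟨ρ, hρ, hρsub⟩ := Metric.nhds_basis_closedBall.mem_iff.1
    ((𝒢.isOpen_coordImg ch q₀).mem_nhds hmem₀)
  obtain ⟨r, hr, hrsub⟩ := Metric.nhds_basis_closedBall.mem_iff.1 (S.σ.open_source.mem_nhds hS)
  let C : Set G := 𝒢.arrowOf ch q₀ '' Metric.closedBall (x₀, y₀) ρ
  let B : Set (F × V × V) := {x₀} ×ˢ Metric.closedBall y₀ ρ ×ˢ Metric.closedBall 0 r
  let K : Set (TangentBundle 𝓘(ℝ, E) G) := 𝒢.vectorOf ch q₀ '' B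
  have hBsub : ∀ z ∈ B, (z.1, z.2.1) ∈ Metric.closedBall (x₀, y₀) ρ := by
    rintro ⟨x, y, w⟩ ⟨hx, hy, -⟩
    rw [← closedBall_prod_same]
    refine ⟨?_, hy⟩
    rw [show x = x₀ from hx]
    exact Metric.mem_closedBall_self hρ.le
  have hC : IsCompact C := (isCompact_closedBall _ _).image_of_continuousOn
    ((𝒢.contMDiffOn_arrowOf ch q₀).continuousOn.mono fun p hp => (hρsub hp).1)
  have hCnhds : C ∈ 𝓝 (𝒢.ε q₀) := by
    have h1 : 𝒢.ε q₀ ∈ 𝒢.coordDom ch q₀ := harrow ▸ 𝒢.arrowOf_mem hmem₀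
    have h2 := (𝒢.isOpen_coordDom ch q₀).mem_nhds h1
    have h3 := ((𝒢.contMDiffOn_arrowCoord ch q₀).continuousOn.continuousAt h2).preimage_mem_nhds
      (t := Metric.closedBall (x₀, y₀) ρ) (by
        rw [hcoord₀]
        exact Metric.closedBall_mem_nhds _ hρ)
    filter_upwards [h2, h3] with g hg hg'
    exact ⟨_, hg', 𝒢.arrowOf_arrowCoord hg⟩
  have hK : IsCompact K :=
    (isCompact_singleton.prod ((isCompact_closedBall _ _).prod
      (isCompact_closedBall _ _))).image_of_continuousOn
      ((𝒢.contMDiffOn_vectorOf ch q₀).continuousOn.mono fun z hz => hρsub (hBsub z hz))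
  have hKvert : K ⊆ 𝒢.vertical := by
    rintro _ ⟨z, hz, rfl⟩
    exact 𝒢.vectorOf_mem_vertical (hρsub (hBsub z hz))
  -- for short times, `σ.symm ((h, x₀), 0)` is the parameter of a curve which remains in `K`
  have hev : ∀ᶠ h : ℝ in 𝓝 0, ((h, x₀), (0 : V)) ∈ S.σ.target ∧
      S.σ.symm ((h, x₀), 0) ∈ Metric.closedBall (((0 : ℝ), x₀), (0 : V)) r ∧
      (0 < h → ∀ t ∈ Icc 0 h, S.curve (S.σ.symm ((h, x₀), 0)) t ∈ K) ∧ |h| ≤ r := by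
    have htgt : ((0, x₀), (0 : V)) ∈ S.σ.target := hS' ▸ S.σ.map_source hS
    have hsymm0 : S.σ.symm ((0, x₀), 0) = ((0, x₀), 0) := by
      conv_lhs => rw [← hS']
      exact S.σ.left_inv hS
    have hline : ContinuousAt (fun h : ℝ => ((h, x₀), (0 : V))) 0 := by fun_prop
    have h1 := hline.preimage_mem_nhds (S.σ.open_target.mem_nhds htgt)
    have h2 : Tendsto (fun h : ℝ => S.σ.symm ((h, x₀), (0 : V))) (𝓝 0) (𝓝 ((0, x₀), 0)) := by
      have h3 := (S.σ.continuousAt_symm htgt).tendsto.comp hline.tendsto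
      rwa [hsymm0] at h3
    have hN : {z : F × V × V | z.2 ∈ Metric.closedBall y₀ ρ ×ˢ Metric.closedBall (0 : V) r} ∈
        𝓝 (x₀, y₀, (0 : V)) :=
      continuousAt_snd.preimage_mem_nhds (prod_mem_nhds (Metric.closedBall_mem_nhds _ hρ)
        (Metric.closedBall_mem_nhds _ hr))
    filter_upwards [h1, h2 (Metric.closedBall_mem_nhds _ hr), h2.eventually (hnear _ hN),
      Metric.closedBall_mem_nhds (0 : ℝ) hr] with h hh1 hh2 hh3 hh4
    have h5 : (S.σ.symm ((h, x₀), (0 : V))).1 = (h, x₀) := S.σ_symm_fst hh1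
    rw [h5] at hh3
    refine ⟨hh1, hh2, fun hpos t ht => ?_, by simpa using hh4⟩
    obtain ⟨p, hpN, hpx, -, hp⟩ := hh3 hpos t ht
    exact ⟨p, ⟨hpx, hpN⟩, hp.symm⟩
  obtain ⟨h₀, hh₀, hh₀sub⟩ := Metric.nhds_basis_closedBall.eventually_iff.1 hev
  refine ⟨h₀, hh₀, C, K, fun h => S.initVector (S.σ.symm ((h, x₀), 0)), hC, hCnhds, hK, hKvert, ?_⟩
  intro h hpos hle
  obtain ⟨htgt, hball, hcurveK, hhr⟩ := hh₀sub (x := h) (by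
    rw [Metric.mem_closedBall, Real.dist_0_eq_abs, abs_of_pos hpos]
    exact hle)
  let z : (ℝ × F) × V := S.σ.symm ((h, x₀), 0)
  have hz : z ∈ S.σ.source := S.σ.map_target htgt
  have hz1 : z.1 = (h, x₀) := S.σ_symm_fst htgt
  have hσz : S.σ z = ((h, x₀), 0) := S.σ.right_inv htgt
  have hv : S.initVector z ∈ S.vecDom h ∩ 𝒢.algebroid := by
    have h1 := S.initVector_mem hz
    rwa [hz1] at h1
  have hparam : S.vecParam h (S.initVector z) = z := by
    have h1 := S.vecParam_initVector hz
    rwa [hz1] at h1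
  have hvproj : (S.initVector z).proj = 𝒢.ε q₀ := by
    rw [S.initVector_proj hz, hz1, hsymm]
  have hexp : 𝒢.expMap Γt h (S.initVector z) = 𝒢.ε q₀ := by
    rw [S.expMap_eq hpos hv, hparam, LieGroupoid.ExpChart.endArrow, hσz, hz1]
    simpa using harrow
  have hcurve0 : S.curve z 0 = S.initVector z := (hparam ▸ S.isIntegralCurveFrom_curve hpos hv).2.2
  have hvel : ∀ t ∈ Icc 0 h, velocity 𝓘(ℝ, E) (fun t => (S.curve z t).proj) h t = S.curve z t :=
    fun t ht => hparam ▸ S.velocity_trajectory hΓt hpos hv ht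
  have h0mem : (0 : ℝ) ∈ Icc 0 h := ⟨le_rfl, hpos.le⟩
  have htraj := S.isTrajectory hΓt hpos hv
  rw [hvproj, hexp, hparam] at htraj
  refine ⟨hv.2, hvproj, ?_, ⟨fun t => (S.curve z t).proj, htraj, fun t ht => ⟨?_, ?_⟩, ?_, ?_⟩,
    S.vecDom h ∩ 𝒢.algebroid, S.arrDom h, ⟨S.vecDom h, S.isOpen_vecDom h, rfl⟩, hv,
    S.isOpen_arrDom h, ?_, fun v hv => ⟨_, S.isIntegralCurveFrom_curve hpos hv⟩,
    S.isDiffeomorphOn_expMap hpos, ?_⟩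
  · have h1 := hcurveK hpos 0 h0mem
    rwa [show S.curve _ 0 = _ from hcurve0] at h1
  · obtain ⟨p, hp, hpt⟩ := hcurveK hpos t ht
    change (S.curve z t).proj ∈ C
    rw [← hpt, 𝒢.vectorOf_proj (hρsub (hBsub p hp))]
    exact ⟨_, hBsub p hp, rfl⟩
  · rw [hvel t ht]
    exact hcurveK hpos t ht
  · rw [hvel 0 h0mem, hcurve0]
  · intro σ' hσ' hσ'K
    -- the initial velocity is `vectorOf (x₀, y₀, w)` with `w` in the ball of radius `r`
    obtain ⟨⟨x, y, w⟩, hp, hpv⟩ := (hσ'K 0 h0mem).2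
    have h1 : (velocity 𝓘(ℝ, E) σ' h 0).proj = 𝒢.ε q₀ := hσ'.2.2.1
    rw [← hpv, 𝒢.vectorOf_proj (hρsub (hBsub _ hp))] at h1
    have h2 : (x, y) = (x₀, y₀) := by
      rw [← hcoord₀, ← h1, 𝒢.arrowCoord_arrowOf (hρsub (hBsub _ hp))]
    obtain ⟨rfl, rfl⟩ := Prod.mk.inj h2
    have h3 : ((h, x₀), w) ∈ S.σ.source := by
      apply hrsub
      rw [← closedBall_prod_same, ← closedBall_prod_same]
      exact ⟨⟨by simpa using hhr, Metric.mem_closedBall_self hr.le⟩, hp.2.2⟩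
    have h4 := S.initVector_mem h3
    rw [show S.initVector ((h, x₀), w) = _ from hpv] at h4
    have h5 := S.eqOn_of_isTrajectory hpos hv (by rwa [hexp]) h4
    rwa [hparam] at h5
  · rw [← hexp]
    exact (S.isDiffeomorphOn_expMap hpos).1 hv
  · intro g hg
    have hv' := S.mapsTo_logMap h hg
    have hexp' := S.expMap_logMap hpos hg
    have hproj' : (S.logMap h g).proj = 𝒢.ε (𝒢.α g) := by
      rw [LieGroupoid.ExpChart.logMap, S.initVector_proj (S.σ.map_target hg.2), S.σ_symm_fst hg.2]
      exact congrArg 𝒢.ε ((chartAt F q₀).left_inv hg.1.1.2.1)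
    have htraj' := S.isTrajectory hΓt hpos hv'
    rw [hexp', hproj'] at htraj'
    refine ⟨_, htraj', ?_, fun σ' hσ' h0' => ?_, fun t ht => ?_, htraj'.isMIntegralCurveOn_Ψ hΨ,
      ?_, ?_⟩
    · rw [S.velocity_trajectory hΓt hpos hv' h0mem, (S.isIntegralCurveFrom_curve hpos hv').2.2]
      exact hv'
    · exact S.eqOn_of_isTrajectory hpos hv' (by rwa [hexp']) h0'
    · exact 𝒢.Ψ_mem_algebroid (htraj'.2.1 t ht).1
    · rw [LieGroupoid.algebroidProj_Ψ]
      exact (congrArg 𝒢.β htraj'.2.2.1).trans (𝒢.β_ε _)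
    · rw [LieGroupoid.algebroidProj_Ψ]
      exact congrArg 𝒢.β htraj'.2.2.2
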